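/- Let $m,n\ge 0$ be integers with $m+n>0$, and let $\mathbf B_{m|n}=\{\overline m<\cdots<\overline 1<1<\cdots<n\}$, where $|b|=0$ for $b\in\mathbf B_{m|n}^+=\{\overline m,\dots,\overline 1\}$ and $|b|=1$ for $b\in\mathbf B_{m|n}^-=\{1,\dots,n\}$. Finite words in $\mathbf B_{m|n}$ form a $\mathfrak{gl}_{m|n}$-crystal by the tensor product rule of Benkart–Kang–Kashiwara. Let $\mathbf M$ be the set of matrices $A=(a_{bb'})_{b,b'\in\mathbf B_{m|n}}$ of non-negative integers with $a_{bb'}\le 1$ whenever $|b|\ne|b'|$. The Kashiwara operators $e_i,f_i$ ($i\in I_{m|n}$) act on $A\in\mathbf M$ through the word of row indices obtained by reading the columns of $A$ from left to right, a column with index in $\mathbf B_{m|n}^+$ from bottom to top and a column with index in $\mathbf B_{m|n}^-$ from top to bottom (each row index $b$ repeated $a_{bb'}$ times in column $b'$), the column indices being kept; $e_i^*,f_i^*$ are the corresponding operators with rows and columns interchanged. Let $\mathfrak M=\{A\in\mathbf M : A=A^t\}$, with operators $\mathbf e_i=e_ie_i^*$ and $\mathbf f_i=f_if_i^*$, with weight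 $\mathrm{wt}(A)=\sum_b\big(\sum_{b'}a_{bb'}\big)\epsilon_b$, and with $\varepsilon_i(A)=\max\{k:\mathbf e_i^kA\ne0\}$, $\varphi_i(A)=\max\{k:\mathbf f_i^kA\neq0\}$. For $A\in\mathfrak M$ put $$\mathfrak o(A)=\big|\{b\in\mathbf B_{m|n}^+ : a_{bb}\text{ is odd}\}\big|+\sum_{b\in\mathbf B_{m|n}^-}a_{bb},\qquad \mathfrak M_k=\{A\in\mathfrak M:\mathfrak o(A)=k\}\quad(k\ge0).$$ Then $\mathfrak M$ is stable under the operators $\mathbf e_i,\mathbf f_i$ (up to the formal symbol $0$) and is a $\mathfrak{gl}_{m|n}$-crystal, each $\mathfrak M_k$ is a subcrystal of it, and, as $\mathfrak{gl}_{m|n}$-crystals, $$\mathfrak M=\bigoplus_{k\ge0}\mathfrak M_k .$$ In particular, $$\mathfrak M_0\simeq\bigoplus_{\lambda\in\mathcal P_{m|n},\ \lambda\text{ even}}\mathbf B_{m|n}(\lambda),$$ where $\mathcal P_{m|n}$ is the set of partitions $\lambda$ with $\lambda_{m+1}\le n$, a partition is even if each of its parts is even, and $\mathbf B_{m|n}(\lambda)$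 is the crystal of $(m,n)$-hook semistandard tableaux of shape $\lambda$ (rows and columns weakly increasing, the entries in $\mathbf B^+_{m|n}$ strictly increasing in columns and those in $\mathbf B^-_{m|n}$ strictly increasing in rows), viewed as words by reading the columns from right to left, each from top to bottom. Consequently, with $hs_\lambda(x)=\sum_{T\in\mathbf B_{m|n}(\lambda)}x^{\mathrm{wt}(T)}$, as formal power series in the variables $x_b$ ($b\in\mathbf B_{m|n}$), $$\frac{\prod_{b<b',\,|b|\ne|b'|}(1+x_bx_{b'})}{\prod_{|b|=0}(1-x_b^2)\prod_{b<b',\,|b|=|b'|}(1-x_bx_{b'})}=\sum_{\lambda\in\mathcal P_{m|n},\ \lambda\text{ even}}hs_\lambda(x).$$ -/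

import Mathlib

open scoped MvPowerSeries.WithPiTopology

namespace GLCrystal

/-- The ordered set `𝐁_{m|n} = {m̄ < ⋯ < 1̄ < 1 < ⋯ < n}`, listed in increasing order: the
positions `0, …, m - 1` are the letters `m̄, …, 1̄` (degree `0`) and the positions
`m, …, m + n - 1` are the letters `1, …, n` (degree `1`). -/
abbrev Letter (m n : ℕ) : Type := Fin (m + n)

/-- The index set `I_{m|n}`, in the order of the Dynkin diagram. The index at position `i`
belongs to the arrow from the letter at position `i` to the next one, so that the positions
`i < m - 1` are the indices with a bar, the position `m - 1` is the index `0`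
(present only if `m, n > 0`), and the positions `i ≥ m` are the indices `1, …, n - 1`. -/
abbrev Index (m n : ℕ) : Type := Fin (m + n - 1)

/-- The weight lattice `P_{m|n}`, in the basis `ε_b`. -/
abbrev Weight (m n : ℕ) : Type := Letter m n → ℤ

variable {m n : ℕ}

/-- The degree `|b|`. -/
def deg (b : Letter m n) : ℕ := if (b : ℕ) < m then 0 else 1

/-- The source of the arrow `i` in the crystal graph `𝐁_{m|n}`. -/
def Index.src (i : Index m n) : Letter m n := ⟨i, by omega⟩

/-- The target of the arrow `i` in the crystal graph `𝐁_{m|n}`. -/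
def Index.tgt (i : Index m n) : Letter m n := ⟨i + 1, by omega⟩

/-- `i` is one of `\overline{m-1}, …, \overline{1}`. -/
def Index.IsBar (i : Index m n) : Prop := (i : ℕ) + 1 < m

/-- `i` is the index `0` of the odd simple root. -/
def Index.IsZero (i : Index m n) : Prop := (i : ℕ) + 1 = m

instance (i : Index m n) : Decidable i.IsBar := by unfold Index.IsBar; infer_instance
instance (i : Index m n) : Decidable i.IsZero := by unfold Index.IsZero; infer_instance

/-- The bilinear form on the weight lattice with `(ε_b, ε_{b'}) = (-1)^{|b|} δ_{b b'}`. -/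
def form (x y : Weight m n) : ℤ := ∑ b, (-1) ^ deg b * x b * y b

/-- The simple root `α_i`; it is `ε_b - ε_{b'}` for the arrow `i : b → b'`. -/
def root (i : Index m n) : Weight m n := Pi.single i.src 1 - Pi.single i.tgt 1

/-- The pairing `⟨h_i, x⟩` with the simple coroot `h_i`. -/
def coroot (i : Index m n) (x : Weight m n) : ℤ :=
  if i.IsBar ∨ i.IsZero then form (root i) x else -form (root i) x

/-- A set `B` with maps `wt, ε_i, φ_i, e_i, f_i`; the formal symbol `0` is `none`. -/
structure Precrystal (m n : ℕ) (B : Type*) where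
  wt : B → Weight m n
  eps : Index m n → B → ℕ
  phi : Index m n → B → ℕ
  e : Index m n → B → Option B
  f : Index m n → B → Option B

namespace Precrystal

variable {B B₁ B₂ : Type*}

/-- The axioms of a crystal graph for `𝔤𝔩_{m|n}`. -/
structure IsCrystal (C : Precrystal m n B) : Prop where
  phi_sub_eps : ∀ i : Index m n, ¬ i.IsZero → ∀ b,
    (C.phi i b : ℤ) - C.eps i b = coroot i (C.wt b)
  coroot_zero_nonneg : ∀ i : Index m n, i.IsZero → ∀ b, 0 ≤ coroot i (C.wt b)
  phi_add_eps : ∀ i : Index m n, i.IsZero → ∀ b,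
    C.phi i b + C.eps i b = if coroot i (C.wt b) = 0 then 0 else 1
  of_e : ∀ i b b', C.e i b = some b' →
    C.eps i b = C.eps i b' + 1 ∧ C.phi i b' = C.phi i b + 1 ∧ C.wt b' = C.wt b + root i
  of_f : ∀ i b b', C.f i b = some b' →
    C.eps i b' = C.eps i b + 1 ∧ C.phi i b = C.phi i b' + 1 ∧ C.wt b' = C.wt b - root i
  f_iff_e : ∀ i b b', C.f i b = some b' ↔ C.e i b' = some b

/-- An isomorphism of crystals: a bijection compatible with all the maps. -/
structure IsIso (C₁ : Precrystal m n B₁) (C₂ : Precrystal m n B₂) (ψ : B₁ ≃ B₂) : Prop where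
  wt : ∀ b, C₂.wt (ψ b) = C₁.wt b
  eps : ∀ i b, C₂.eps i (ψ b) = C₁.eps i b
  phi : ∀ i b, C₂.phi i (ψ b) = C₁.phi i b
  e : ∀ i b, C₂.e i (ψ b) = (C₁.e i b).map ψ
  f : ∀ i b, C₂.f i (ψ b) = (C₁.f i b).map ψ

/-- `C₁ ≃ C₂`. -/
def Isomorphic (C₁ : Precrystal m n B₁) (C₂ : Precrystal m n B₂) : Prop :=
  ∃ ψ : B₁ ≃ B₂, IsIso C₁ C₂ ψ

/-- The direct sum: the disjoint union. -/
def directSum {ι : Type*} {B : ι → Type*} (C : ∀ t, Precrystal m n (B t)) :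
    Precrystal m n (Σ t, B t) where
  wt x := (C x.1).wt x.2
  eps i x := (C x.1).eps i x.2
  phi i x := (C x.1).phi i x.2
  e i x := ((C x.1).e i x.2).map (Sigma.mk x.1)
  f i x := ((C x.1).f i x.2).map (Sigma.mk x.1)

open Classical in
/-- The structure that a set `B₁` identified with a subset of `B` by an injection `g` gets
from `B`. If the image of `g` is not stable under the operators, an element that leaves it
is replaced by `0`. -/
noncomputable def induced (C : Precrystal m n B) (g : B₁ ↪ B) : Precrystal m n B₁ where
  wt b := C.wt (g b)
  eps i b := C.eps i (g b)
  phi i b := C.phi i (g b)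
  e i b := if h : ∃ b', C.e i (g b) = some (g b') then some h.choose else none
  f i b := if h : ∃ b', C.f i (g b) = some (g b') then some h.choose else none

/-- The structure induced on a subset. -/
noncomputable def restrict (C : Precrystal m n B) (S : Set B) : Precrystal m n S :=
  C.induced (Function.Embedding.subtype _)

/-- The operators map `S` to `S ∪ {0}`. -/
def StableOn (C : Precrystal m n B) (S : Set B) : Prop :=
  ∀ i, ∀ b ∈ S, ∀ b', (C.e i b = some b' ∨ C.f i b = some b') → b' ∈ S

/-- `S` is a crystal graph with respect to the maps of `C`. -/
def IsSubcrystal (C : Precrystal m n B) (S : Set B) : Prop :=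
  C.StableOn S ∧ (C.restrict S).IsCrystal

end Precrystal

/-! ### Words

The set of words is the union of the tensor powers of `𝐁_{m|n}`. The word `b :: w` is
`b ⊗ w`, and the maps are given by the tensor product rule; `[]` is the trivial crystal. -/

/-- `ε_i` of a letter. -/
def letterEps (i : Index m n) (b : Letter m n) : ℕ := if b = i.tgt then 1 else 0

/-- `φ_i` of a letter. -/
def letterPhi (i : Index m n) (b : Letter m n) : ℕ := if b = i.src then 1 else 0

/-- `e_i` of a letter. -/
def letterE (i : Index m n) (b : Letter m n) : Option (Letter m n) :=
  if b = i.tgt then some i.src else none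

/-- `f_i` of a letter. -/
def letterF (i : Index m n) (b : Letter m n) : Option (Letter m n) :=
  if b = i.src then some i.tgt else none

/-- The weight `ε_b` of a letter. -/
def letterWt (b : Letter m n) : Weight m n := Pi.single b 1

/-- The weight of a word. -/
def wordWt : List (Letter m n) → Weight m n
  | [] => 0
  | b :: w => letterWt b + wordWt w

/-- `ε_i` of a word. -/
def wordEps (i : Index m n) : List (Letter m n) → ℕ
  | [] => 0
  | b :: w =>
    if i.IsBar then
      (max (letterEps i b : ℤ) (wordEps i w - coroot i (letterWt b))).toNat
    else if i.IsZero then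
      if 0 < coroot i (letterWt b) then letterEps i b else wordEps i w
    else
      (max ((letterEps i b : ℤ) - coroot i (wordWt w)) (wordEps i w)).toNat

/-- `φ_i` of a word. -/
def wordPhi (i : Index m n) : List (Letter m n) → ℕ
  | [] => 0
  | b :: w =>
    if i.IsBar then
      (max ((letterPhi i b : ℤ) + coroot i (wordWt w)) (wordPhi i w)).toNat
    else if i.IsZero then
      if 0 < coroot i (letterWt b) then letterPhi i b else wordPhi i w
    else
      (max (letterPhi i b : ℤ) (wordPhi i w + coroot i (letterWt b))).toNat

/-- `e_i` of a word. -/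
def wordE (i : Index m n) : List (Letter m n) → Option (List (Letter m n))
  | [] => none
  | b :: w =>
    if (i.IsBar ∧ wordEps i w ≤ letterPhi i b) ∨
        (i.IsZero ∧ 0 < coroot i (letterWt b)) ∨
        (¬ i.IsBar ∧ ¬ i.IsZero ∧ wordPhi i w < letterEps i b) then
      (letterE i b).map fun b' => b' :: w
    else
      (wordE i w).map fun w' => b :: w'

/-- `f_i` of a word. -/
def wordF (i : Index m n) : List (Letter m n) → Option (List (Letter m n))
  | [] => none
  | b :: w =>
    if (i.IsBar ∧ wordEps i w < letterPhi i b) ∨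
        (i.IsZero ∧ 0 < coroot i (letterWt b)) ∨
        (¬ i.IsBar ∧ ¬ i.IsZero ∧ wordPhi i w ≤ letterEps i b) then
      (letterF i b).map fun b' => b' :: w
    else
      (wordF i w).map fun w' => b :: w'

/-- The crystal `𝒲_{m|n}` of words. -/
def wordCrystal (m n : ℕ) : Precrystal m n (List (Letter m n)) where
  wt := wordWt
  eps := wordEps
  phi := wordPhi
  e := wordE
  f := wordF

/-! ### Hook semistandard tableaux -/

/-- `μ` is an `(m, n)`-hook partition: its `(m + 1)`-st part is at most `n`. -/
def IsHook (m n : ℕ) (μ : YoungDiagram) : Prop := μ.rowLen m ≤ n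

/-- All the parts of `μ` are even. -/
def IsEven (μ : YoungDiagram) : Prop := ∀ k, Even (μ.rowLen k)

/-- The set `𝐁_{m|n}(μ)` of `(m, n)`-hook semistandard tableaux of shape `μ`; a box is a pair
(row, column). -/
@[ext]
structure HookTableau (m n : ℕ) (μ : YoungDiagram) where
  entry : {c : ℕ × ℕ // c ∈ μ} → Letter m n
  row_weak : ∀ c d, c.1.1 = d.1.1 → c.1.2 < d.1.2 → entry c ≤ entry d
  col_weak : ∀ c d, c.1.2 = d.1.2 → c.1.1 < d.1.1 → entry c ≤ entry d
  row_strict : ∀ c d, c.1.1 = d.1.1 → c.1.2 < d.1.2 →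
    deg (entry c) = 1 → deg (entry d) = 1 → entry c < entry d
  col_strict : ∀ c d, c.1.2 = d.1.2 → c.1.1 < d.1.1 →
    deg (entry c) = 0 → deg (entry d) = 0 → entry c < entry d

namespace HookTableau

variable {μ : YoungDiagram}

open Classical in
noncomputable instance : Fintype (HookTableau m n μ) :=
  haveI : Fintype {c : ℕ × ℕ // c ∈ μ} := Fintype.subtype μ.cells fun _ => YoungDiagram.mem_cells _
  Fintype.ofInjective HookTableau.entry fun _ _ h => HookTableau.ext h

/-- The column `j`, read from top to bottom. -/
def column (T : HookTableau m n μ) (j : ℕ) : List (Letter m n) :=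
  (List.finRange (μ.colLen j)).map fun k : Fin (μ.colLen j) =>
    T.entry ⟨(k, j), YoungDiagram.mem_iff_lt_colLen.2 k.2⟩

/-- The column reading: the columns from right to left, each from top to bottom. -/
def word (T : HookTableau m n μ) : List (Letter m n) :=
  (List.range (μ.rowLen 0)).reverse.flatMap T.column

theorem word_injective : Function.Injective (word : HookTableau m n μ → List (Letter m n)) := by
  have key : ∀ (T T' : HookTableau m n μ) (l : List ℕ),
      l.flatMap T.column = l.flatMap T'.column → ∀ j ∈ l, T.column j = T'.column j := by
    intro T T' l
    induction l with
    | nil => simp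
    | cons a l ih =>
      intro h
      simp only [List.flatMap_cons] at h
      obtain ⟨h1, h2⟩ := List.append_inj h (by simp [column])
      intro j hj
      rcases List.mem_cons.1 hj with rfl | hj
      · exact h1
      · exact ih h2 j hj
  intro T T' h
  ext1
  funext ⟨⟨a, b⟩, hc⟩
  have hb : b < μ.rowLen 0 := (YoungDiagram.mem_iff_lt_rowLen.1 hc).trans_le
    (μ.rowLen_anti 0 a (Nat.zero_le _))
  have := key T T' _ h b (by simpa using hb)
  have h3 := List.map_inj_left.1 this ⟨a, YoungDiagram.mem_iff_lt_colLen.1 hc⟩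
    (List.mem_finRange _)
  exact h3

/-- The column reading as an embedding. -/
def wordEmb (m n : ℕ) (μ : YoungDiagram) : HookTableau m n μ ↪ List (Letter m n) :=
  ⟨word, word_injective⟩

end HookTableau

/-- `𝐁_{m|n}(μ)` with the structure that it has as a subset of the crystal of words. -/
noncomputable def tableauCrystal (m n : ℕ) (μ : YoungDiagram) :
    Precrystal m n (HookTableau m n μ) :=
  (wordCrystal m n).induced (HookTableau.wordEmb m n μ)

/-- The hook Schur function `hs_μ = ∑_T x^{wt T}`. -/
noncomputable def hookSchur (m n : ℕ) (μ : YoungDiagram) : MvPowerSeries (Letter m n) ℤ :=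
  ∑ T : HookTableau m n μ, ∏ b, MvPowerSeries.X b ^ T.word.count b

/-! ### Matrices and biwords -/

/-- Matrices of non-negative integers with rows and columns indexed by `𝐁_{m|n}`. -/
abbrev Mat (m n : ℕ) : Type := Matrix (Letter m n) (Letter m n) ℕ

/-- The set `𝐌 = 𝐌_{m|n, m|n}`. -/
def bigM (m n : ℕ) : Set (Mat m n) := {A | ∀ b b', deg b ≠ deg b' → A b b' ≤ 1}

/-- The super lexicographic ordering: `(i, j) < (k, l)`. -/
def SuperLex (p q : Letter m n × Letter m n) : Prop :=
  p.2 < q.2 ∨ (p.2 = q.2 ∧ deg p.2 = 0 ∧ q.1 < p.1) ∨ (p.2 = q.2 ∧ deg p.2 = 1 ∧ p.1 < q.1)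

/-- The set `Ω` of biwords `(𝐢, 𝐣)`, as lists of pairs: weakly increasing for the super
lexicographic ordering, and strictly so at the pairs `(i, j)` with `|i| ≠ |j|`. -/
def Omega (m n : ℕ) : Set (List (Letter m n × Letter m n)) :=
  {w | w.Pairwise fun p q => SuperLex p q ∨ (p = q ∧ deg p.1 = deg p.2)}

/-- The matrix `A(𝐢, 𝐣)`: its entries count the occurrences of each pair. -/
def ofBiword (w : List (Letter m n × Letter m n)) : Mat m n :=
  Matrix.of fun b b' => w.count (b, b')

/-- The biword in `Ω` of a matrix in `𝐌`: the columns are read from left to right, a column of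
degree `0` from bottom to top and a column of degree `1` from top to bottom. -/
def biword (A : Mat m n) : List (Letter m n × Letter m n) :=
  (List.finRange (m + n)).flatMap fun j =>
    (if deg j = 0 then (List.finRange (m + n)).reverse else List.finRange (m + n)).flatMap
      fun i => List.replicate (A i j) (i, j)

/-- `A(𝐢, 𝐣)` and `biword` are inverse bijections between `Ω` and `𝐌`, by this and the next
three facts. -/
theorem ofBiword_biword (A : Mat m n) : ofBiword (biword A) = A := by
  ext b b'
  have h1 : ∀ i j : Letter m n,
      (List.replicate (A i j) (i, j)).count (b, b') =
        if i = b then (if j = b' then A i j else 0) else 0 := by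
    intro i j
    rw [List.count_replicate]
    by_cases h : i = b <;> by_cases h' : j = b' <;> simp [h, h']
  have h2 : ∀ j : Letter m n,
      ((if deg j = 0 then (List.finRange (m + n)).reverse else List.finRange (m + n)).flatMap
        fun i => List.replicate (A i j) (i, j)).count (b, b') = if j = b' then A b j else 0 := by
    intro j
    rw [List.count_flatMap]
    have h3 : ((List.finRange (m + n)).map
        (List.count (b, b') ∘ fun i => List.replicate (A i j) (i, j))).sum =
          if j = b' then A b j else 0 := by
      rw [← Fin.sum_univ_def]
      simp only [Function.comp, h1]
      simp
    split_ifs with hd hj hj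
    · rw [List.map_reverse, List.sum_reverse, h3, if_pos hj]
    · rw [List.map_reverse, List.sum_reverse, h3, if_neg hj]
    · rw [h3, if_pos hj]
    · rw [h3, if_neg hj]
  simp only [ofBiword, biword, Matrix.of_apply]
  rw [List.count_flatMap, ← Fin.sum_univ_def]
  simp only [Function.comp, h2]
  simp

theorem biword_mem_Omega {A : Mat m n} (hA : A ∈ bigM m n) : biword A ∈ Omega m n := by
  simp only [Omega, Set.mem_ofPred_eq, biword, List.pairwise_flatMap]
  have hlt : (List.finRange (m + n)).Pairwise (· < ·) := List.pairwise_lt_finRange _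
  have hrep : ∀ i j : Letter m n, (List.replicate (A i j) (i, j)).Pairwise
      fun p q => SuperLex p q ∨ (p = q ∧ deg p.1 = deg p.2) := by
    intro i j
    rw [List.pairwise_replicate]
    by_cases h : deg i = deg j
    · exact Or.inr (Or.inr ⟨rfl, h⟩)
    · exact Or.inl (hA i j h)
  refine ⟨fun j _ => ⟨fun i _ => hrep i j, ?_⟩, ?_⟩
  · split_ifs with hd
    · rw [List.pairwise_reverse]
      refine hlt.imp ?_
      intro a b hab x hx y hy
      rw [List.eq_of_mem_replicate hx, List.eq_of_mem_replicate hy]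
      exact Or.inl (Or.inr (Or.inl ⟨rfl, hd, hab⟩))
    · refine hlt.imp ?_
      intro a b hab x hx y hy
      rw [List.eq_of_mem_replicate hx, List.eq_of_mem_replicate hy]
      refine Or.inl (Or.inr (Or.inr ⟨rfl, ?_, hab⟩))
      unfold deg at hd ⊢
      split_ifs at hd ⊢ <;> simp_all
  · refine hlt.imp ?_
    intro a b hab x hx y hy
    obtain ⟨i, -, hi⟩ := List.mem_flatMap.1 hx
    obtain ⟨k, -, hk⟩ := List.mem_flatMap.1 hy
    rw [List.eq_of_mem_replicate hi, List.eq_of_mem_replicate hk]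
    exact Or.inl (Or.inl hab)

theorem ofBiword_mem_bigM {w : List (Letter m n × Letter m n)} (hw : w ∈ Omega m n) :
    ofBiword w ∈ bigM m n := by
  intro b b' hb
  by_contra! h
  have h2 : List.Sublist [(b, b'), (b, b')] w := by
    have := List.replicate_sublist_iff.2 (show 2 ≤ w.count (b, b') from h)
    simpa [List.replicate] using this
  have := List.Pairwise.sublist h2 hw
  simp [SuperLex, hb] at this

theorem biword_ofBiword {w : List (Letter m n × Letter m n)} (hw : w ∈ Omega m n) :
    biword (ofBiword w) = w := by
  have hp : (biword (ofBiword w)).Perm w := by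
    rw [List.perm_iff_count]
    rintro ⟨b, b'⟩
    have := congrFun (congrFun (ofBiword_biword (ofBiword w)) b) b'
    simpa [ofBiword] using this
  refine hp.eq_of_pairwise ?_ (biword_mem_Omega (ofBiword_mem_bigM hw)) hw
  rintro ⟨a, b⟩ ⟨c, d⟩ - - h1 h2
  rcases h1 with h1 | ⟨h1, -⟩
  · rcases h2 with h2 | ⟨h2, -⟩
    · exfalso
      rcases h1 with h1 | ⟨h1, h3, h4⟩ | ⟨h1, h3, h4⟩ <;>
        rcases h2 with h2 | ⟨h2, h5, h6⟩ | ⟨h2, h5, h6⟩ <;> dsimp only at * <;>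
        first
          | exact lt_asymm h1 h2
          | exact lt_asymm h4 h6
          | exact h1.ne h2.symm
          | exact h2.ne h1.symm
          | (rw [h1] at h3; omega)
    · exact h2.symm
  · exact h1

/-- The operator on matrices that acts by `op` on the word `𝐢` of the biword `(𝐢, 𝐣)`. -/
def onRows (op : List (Letter m n) → Option (List (Letter m n))) (A : Mat m n) :
    Option (Mat m n) :=
  (op ((biword A).map Prod.fst)).map fun w => ofBiword (w.zip ((biword A).map Prod.snd))

/-- The operator on matrices that acts by `op` on the word `𝐥` of the biword `(𝐤, 𝐥) ∈ Ω*`;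
the pair `(𝐤, 𝐥)` is in `Ω*` if and only if `(𝐥, 𝐤)` is in `Ω`, which gives the transpose. -/
def onCols (op : List (Letter m n) → Option (List (Letter m n))) (A : Mat m n) :
    Option (Mat m n) :=
  (onRows op A.transpose).map Matrix.transpose

/-- The operators `e_i, f_i` of the first `𝔤𝔩_{m|n}` and `e_i^*, f_i^*` of the second one. -/
def matE (i : Index m n) : Mat m n → Option (Mat m n) := onRows (wordE i)
/-- See `matE`. -/
def matF (i : Index m n) : Mat m n → Option (Mat m n) := onRows (wordF i)
/-- See `matE`. -/
def matEStar (i : Index m n) : Mat m n → Option (Mat m n) := onCols (wordE i)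
/-- See `matE`. -/
def matFStar (i : Index m n) : Mat m n → Option (Mat m n) := onCols (wordF i)

/-- The iterates of a partial operator. -/
def iter {X : Type*} (g : X → Option X) : ℕ → X → Option X
  | 0, x => some x
  | k + 1, x => (g x).bind (iter g k)

/-- `max {k | g^k x ≠ 0}`. -/
noncomputable def maxIter {X : Type*} (g : X → Option X) (x : X) : ℕ :=
  sSup {k | iter g k x ≠ none}

/-- The diagonal operator `e_i e_i^*`. -/
def diagE (i : Index m n) (A : Mat m n) : Option (Mat m n) := (matEStar i A).bind (matE i)

/-- The diagonal operator `f_i f_i^*`. -/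
def diagF (i : Index m n) (A : Mat m n) : Option (Mat m n) := (matFStar i A).bind (matF i)

/-- The diagonal action; the weight is the content of the word `𝐢`. -/
noncomputable def diagonal (m n : ℕ) : Precrystal m n (Mat m n) where
  wt A := wordWt ((biword A).map Prod.fst)
  eps i A := maxIter (diagE i) A
  phi i A := maxIter (diagF i) A
  e := diagE
  f := diagF

/-- The set `𝔐` of the symmetric matrices in `𝐌`. -/
def symM (m n : ℕ) : Set (Mat m n) := {A | A ∈ bigM m n ∧ A.transpose = A}

/-- `𝔐` with the diagonal action. -/
noncomputable def symCrystal (m n : ℕ) : Precrystal m n (symM m n) :=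
  (diagonal m n).restrict (symM m n)

/-- The statistic `𝔬(A)` of the diagonal entries. -/
def oddStat (A : Mat m n) : ℕ :=
  (Finset.univ.filter fun b : Letter m n => deg b = 0 ∧ A b b % 2 = 1).card +
    ∑ b ∈ Finset.univ.filter (fun b : Letter m n => deg b = 1), A b b

/-- The set `𝔐_k`. -/
def symMk (m n k : ℕ) : Set (symM m n) := {A | oddStat A.1 = k}

/-! ### The two sides of the character identity -/

/-- `∏_{b < b', |b| ≠ |b'|} (1 + x_b x_{b'})`. -/
noncomputable def charNum (m n : ℕ) : MvPowerSeries (Letter m n) ℤ :=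
  ∏ p ∈ Finset.univ.filter
    (fun p : Letter m n × Letter m n => p.1 < p.2 ∧ deg p.1 ≠ deg p.2),
    (1 + MvPowerSeries.X p.1 * MvPowerSeries.X p.2)

/-- `∏_{|b| = 0} (1 - x_b²) ∏_{b < b', |b| = |b'|} (1 - x_b x_{b'})`. -/
noncomputable def charDen (m n : ℕ) : MvPowerSeries (Letter m n) ℤ :=
  (∏ b ∈ Finset.univ.filter (fun b : Letter m n => deg b = 0), (1 - MvPowerSeries.X b ^ 2)) *
    ∏ p ∈ Finset.univ.filter
      (fun p : Letter m n × Letter m n => p.1 < p.2 ∧ deg p.1 = deg p.2),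
      (1 - MvPowerSeries.X p.1 * MvPowerSeries.X p.2)

end GLCrystal

namespace GLCrystal

variable {m n : ℕ}

/-! The proof is a super version of the symmetric Robinson–Schensted–Knuth correspondence, organised
by last passage tables. Let `lpp m A b j` be the largest length of a chain in the first `b` rows and
`j` columns of `A`, where a row or column of degree 0 may be met only once and one of degree 1
repeatedly. It is computed by a local rule, `cell`, which does not change when rows and columns are
exchanged (`cell_swap`). The last column of the table gives the partial sums of the first column of
the insertion tableau of `A`, and the last row does the same for the recording tableau. Subtracting
the mixed second difference of the table from `A` leaves a matrix `resid m A`, again in `𝐌`, which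
yields the other columns of both tableaux. Transposition therefore exchanges the two tableaux.

Crystals enter through column insertion: inserting a column `a` into a tableau column `c` replaces
`c ⊗ a` by `bumped ⊗ insCol`, and this exchange commutes with `e_i` (`insert_tensor`). Sweeping an
empty column through `A`, then through its residual matrices, turns the row word of `A` into the
word of its tableau, still commuting with `e_i` (`RowE.tabCols`). The recording tableau does not
move (`RowE.lpp_top_iterate`).

The local rule is reversible. Hence a matrix is determined by its two tableaux, and every pair with
equal shapes occurs (`eq_of_lpp_iterate`, `exists_lpp_iterate_eq`); symmetric matrices are those
whose two tableaux agree. Since `e_i` changes the insertion tableau only, and `e_i^*` the recording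
tableau only and in the same way, `e_i e_i^*` preserves symmetry and acts as `e_i` on the common
tableau (`InS.symm_of_rowE`, `DiagE.tabCols`).

On the diagonal of a symmetric matrix the local rule gives `𝔬(A) + 𝔬(resid A) = lpp A N N`, the
length of the first tableau column, where `N = m + n` (`InS.oStat_add`). So `𝔬(A)` is the
alternating sum of the column lengths, which is the number of odd rows: it depends on the shape
alone, is invariant under the operators, and vanishes exactly for even shapes. The character
identity counts `𝔐_0` twice, by tableaux and by the independent entries on and above the diagonal.
-/

/-! ### The tensor product rule for words -/

theorem form_single (x : Weight m n) (b : Letter m n) :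
    form x (Pi.single b 1) = (-1) ^ deg b * x b := by
  unfold form
  rw [Finset.sum_eq_single b] <;> simp +contextual

theorem coroot_add (i : Index m n) (x y : Weight m n) :
    coroot i (x + y) = coroot i x + coroot i y := by
  have h : form (root i) (x + y) = form (root i) x + form (root i) y := by
    simp [form, mul_add, Finset.sum_add_distrib]
  unfold coroot
  split_ifs <;> rw [h]
  ring

theorem coroot_zero (i : Index m n) : coroot i 0 = 0 := by
  simp [coroot, form]

theorem Index.src_ne_tgt (i : Index m n) : i.src ≠ i.tgt := by
  simp [Index.src, Index.tgt]

theorem root_apply (i : Index m n) (b : Letter m n) :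
    root i b = letterPhi i b - letterEps i b := by
  have := i.src_ne_tgt
  simp [root, letterPhi, letterEps, Pi.single_apply]

theorem coroot_letterWt_of_not_isZero {i : Index m n} (hi : ¬ i.IsZero) (b : Letter m n) :
    coroot i (letterWt b) = letterPhi i b - letterEps i b := by
  unfold coroot letterWt
  rw [form_single, root_apply]
  simp only [letterPhi, letterEps, deg, Index.IsBar, Index.IsZero, Index.src, Index.tgt,
    Fin.ext_iff] at *
  split_ifs <;> simp <;> omega

theorem coroot_letterWt_of_isZero {i : Index m n} (hi : i.IsZero) (b : Letter m n) :
    coroot i (letterWt b) = letterPhi i b + letterEps i b := by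
  unfold coroot letterWt
  rw [form_single, root_apply]
  simp only [letterPhi, letterEps, deg, Index.IsBar, Index.IsZero, Index.src, Index.tgt,
    Fin.ext_iff] at *
  split_ifs <;> simp <;> omega

theorem letterPhi_add_letterEps_le (i : Index m n) (b : Letter m n) :
    letterPhi i b + letterEps i b ≤ 1 := by
  have := i.src_ne_tgt
  unfold letterPhi letterEps
  split_ifs <;> simp_all

theorem Index.not_isZero_of_isBar {i : Index m n} (h : i.IsBar) : ¬ i.IsZero := by
  unfold Index.IsBar Index.IsZero at *; omega

/-- `ε_i(u ⊗ v)` in terms of `ε_i(u), φ_i(u), ε_i(v), φ_i(v)`. -/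
def tensorEps (i : Index m n) (e₁ p₁ e₂ p₂ : ℕ) : ℕ :=
  if i.IsBar then e₁ + (e₂ - p₁) else if i.IsZero then (if 0 < e₁ + p₁ then e₁ else e₂)
  else e₂ + (e₁ - p₂)

/-- `φ_i(u ⊗ v)` in terms of `ε_i(u), φ_i(u), ε_i(v), φ_i(v)`. -/
def tensorPhi (i : Index m n) (e₁ p₁ e₂ p₂ : ℕ) : ℕ :=
  if i.IsBar then p₂ + (p₁ - e₂) else if i.IsZero then (if 0 < e₁ + p₁ then p₁ else p₂)
  else p₁ + (p₂ - e₁)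

/-- `e_i(u ⊗ v) = e_i u ⊗ v`. -/
def tensorLeftE (i : Index m n) (e₁ p₁ e₂ p₂ : ℕ) : Prop :=
  if i.IsBar then e₂ ≤ p₁ else if i.IsZero then 0 < e₁ + p₁ else p₂ < e₁

/-- `f_i(u ⊗ v) = f_i u ⊗ v`. -/
def tensorLeftF (i : Index m n) (e₁ p₁ e₂ p₂ : ℕ) : Prop :=
  if i.IsBar then e₂ < p₁ else if i.IsZero then 0 < e₁ + p₁ else p₂ ≤ e₁

instance (i : Index m n) (e₁ p₁ e₂ p₂ : ℕ) : Decidable (tensorLeftE i e₁ p₁ e₂ p₂) := by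
  unfold tensorLeftE; infer_instance

instance (i : Index m n) (e₁ p₁ e₂ p₂ : ℕ) : Decidable (tensorLeftF i e₁ p₁ e₂ p₂) := by
  unfold tensorLeftF; infer_instance

/-- Removes the weights from the tensor product rule: away from the odd index they enter only
through `φ_i - ε_i`, so the rule depends only on the four numbers `ε_i, φ_i` of the two factors. -/
theorem wordPhi_sub_wordEps {i : Index m n} (hi : ¬ i.IsZero) (w : List (Letter m n)) :
    (wordPhi i w : ℤ) - wordEps i w = coroot i (wordWt w) := by
  induction w with
  | nil => simp [wordPhi, wordEps, wordWt, coroot_zero]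
  | cons b w ih =>
    have h := coroot_letterWt_of_not_isZero hi b
    have h2 := letterPhi_add_letterEps_le i b
    simp only [wordPhi, wordEps, wordWt, coroot_add, if_neg hi]
    split_ifs <;> omega

theorem wordEps_cons (i : Index m n) (b : Letter m n) (w : List (Letter m n)) :
    wordEps i (b :: w) =
      tensorEps i (letterEps i b) (letterPhi i b) (wordEps i w) (wordPhi i w) := by
  have h2 := letterPhi_add_letterEps_le i b
  by_cases hi : i.IsZero
  · have h := coroot_letterWt_of_isZero hi b
    have hb : ¬ i.IsBar := fun h => Index.not_isZero_of_isBar h hi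
    simp only [wordEps, tensorEps, if_neg hb, if_pos hi]
    split_ifs <;> omega
  · have h := coroot_letterWt_of_not_isZero hi b
    have h1 := wordPhi_sub_wordEps hi w
    simp only [wordEps, tensorEps, if_neg hi, h, ← h1]
    by_cases hb : i.IsBar
    · simp only [if_pos hb]
      omega
    · simp only [if_neg hb]
      omega

theorem wordPhi_cons (i : Index m n) (b : Letter m n) (w : List (Letter m n)) :
    wordPhi i (b :: w) =
      tensorPhi i (letterEps i b) (letterPhi i b) (wordEps i w) (wordPhi i w) := by
  have h2 := letterPhi_add_letterEps_le i b
  by_cases hi : i.IsZero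
  · have h := coroot_letterWt_of_isZero hi b
    have hb : ¬ i.IsBar := fun h => Index.not_isZero_of_isBar h hi
    simp only [wordPhi, tensorPhi, if_neg hb, if_pos hi]
    split_ifs <;> omega
  · have h := coroot_letterWt_of_not_isZero hi b
    have h1 := wordPhi_sub_wordEps hi w
    simp only [wordPhi, tensorPhi, if_neg hi, h, ← h1]
    by_cases hb : i.IsBar
    · simp only [if_pos hb]
      omega
    · simp only [if_neg hb]
      omega

theorem wordE_cons (i : Index m n) (b : Letter m n) (w : List (Letter m n)) :
    wordE i (b :: w) =
      if tensorLeftE i (letterEps i b) (letterPhi i b) (wordEps i w) (wordPhi i w) then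
        (letterE i b).map fun b' => b' :: w
      else (wordE i w).map fun w' => b :: w' := by
  rw [wordE]
  refine if_congr ?_ rfl rfl
  unfold tensorLeftE
  by_cases hi : i.IsZero
  · have h := coroot_letterWt_of_isZero hi b
    have : ¬ i.IsBar := fun h => Index.not_isZero_of_isBar h hi
    simp only [hi, this]
    simp [h]
    omega
  · by_cases hb : i.IsBar <;> simp [hi, hb]

theorem wordF_cons (i : Index m n) (b : Letter m n) (w : List (Letter m n)) :
    wordF i (b :: w) =
      if tensorLeftF i (letterEps i b) (letterPhi i b) (wordEps i w) (wordPhi i w) then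
        (letterF i b).map fun b' => b' :: w
      else (wordF i w).map fun w' => b :: w' := by
  rw [wordF]
  refine if_congr ?_ rfl rfl
  unfold tensorLeftF
  by_cases hi : i.IsZero
  · have h := coroot_letterWt_of_isZero hi b
    have : ¬ i.IsBar := fun h => Index.not_isZero_of_isBar h hi
    simp only [hi, this]
    simp [h]
    omega
  · by_cases hb : i.IsBar <;> simp [hi, hb]

/-- At the odd index a word behaves like the first of its letters that is `i.src` or `i.tgt`. -/
theorem wordPhi_add_wordEps_le {i : Index m n} (hi : i.IsZero) (w : List (Letter m n)) :
    wordPhi i w + wordEps i w ≤ 1 := by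
  induction w with
  | nil => simp [wordPhi, wordEps]
  | cons b w ih =>
    have h2 := letterPhi_add_letterEps_le i b
    have : ¬ i.IsBar := fun h => Index.not_isZero_of_isBar h hi
    simp only [wordPhi_cons, wordEps_cons, tensorEps, tensorPhi, hi, this]
    simp only [if_true, if_false]
    split_ifs <;> omega

/-- Associativity of the tensor product rule: a word may be cut anywhere, not only after its first
letter. -/
theorem wordEps_append (i : Index m n) (u v : List (Letter m n)) :
    wordEps i (u ++ v) =
      tensorEps i (wordEps i u) (wordPhi i u) (wordEps i v) (wordPhi i v) ∧
    wordPhi i (u ++ v) =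
      tensorPhi i (wordEps i u) (wordPhi i u) (wordEps i v) (wordPhi i v) := by
  induction u with
  | nil =>
    simp only [List.nil_append, wordEps, wordPhi, tensorEps, tensorPhi, lt_irrefl, if_false]
    split_ifs <;> omega
  | cons b u ih =>
    simp only [List.cons_append, wordEps_cons, wordPhi_cons, ih.1, ih.2]
    simp only [tensorEps, tensorPhi]
    have := fun hi => wordPhi_add_wordEps_le (i := i) hi u
    split_ifs <;> omega

theorem wordE_eq_none_iff (i : Index m n) (w : List (Letter m n)) :
    wordE i w = none ↔ wordEps i w = 0 := by
  induction w with
  | nil => simp [wordE, wordEps]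
  | cons b w ih =>
    have hl : letterE i b = none ↔ letterEps i b = 0 := by
      unfold letterE letterEps; split_ifs <;> simp
    have := letterPhi_add_letterEps_le i b
    simp only [wordE_cons, wordEps_cons, tensorEps, tensorLeftE]
    split_ifs <;> simp only [Option.map_eq_none_iff, ih, hl] <;> omega

theorem wordF_eq_none_iff (i : Index m n) (w : List (Letter m n)) :
    wordF i w = none ↔ wordPhi i w = 0 := by
  induction w with
  | nil => simp [wordF, wordPhi]
  | cons b w ih =>
    have hl : letterF i b = none ↔ letterPhi i b = 0 := by
      unfold letterF letterPhi; split_ifs <;> simp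
    have := letterPhi_add_letterEps_le i b
    simp only [wordF_cons, wordPhi_cons, tensorPhi, tensorLeftF]
    split_ifs <;> simp only [Option.map_eq_none_iff, ih, hl] <;> omega

theorem wordE_append (i : Index m n) (u v : List (Letter m n)) :
    wordE i (u ++ v) =
      if tensorLeftE i (wordEps i u) (wordPhi i u) (wordEps i v) (wordPhi i v) then
        (wordE i u).map (· ++ v)
      else (wordE i v).map (u ++ ·) := by
  induction u with
  | nil =>
    have := wordE_eq_none_iff i v
    simp only [List.nil_append, wordEps, wordPhi, tensorLeftE, wordE]
    split_ifs <;> simp <;> first | omega | (apply this.2; omega)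
  | cons b u ih =>
    have h2 := letterPhi_add_letterEps_le i b
    have hz := fun hi => wordPhi_add_wordEps_le (i := i) hi u
    have hl : letterE i b = none ↔ letterEps i b = 0 := by
      unfold letterE letterEps; split_ifs <;> simp
    have hu := wordE_eq_none_iff i u
    have hv := wordE_eq_none_iff i v
    have hA := wordEps_append i u v
    simp only [List.cons_append, wordEps_cons, wordPhi_cons, wordE_cons, ih, hA.1, hA.2]
    simp only [tensorEps, tensorPhi, tensorLeftE]
    by_cases hb : i.IsBar
    · simp only [hb, if_true]
      split_ifs <;> first | omega | simp [Function.comp_def]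
    by_cases hi : i.IsZero
    · simp only [hb, hi, if_true, if_false]
      split_ifs <;> first | omega | simp [Function.comp_def]
    · simp only [hb, hi, if_false]
      split_ifs <;> first | omega | simp [Function.comp_def]

theorem wordF_append (i : Index m n) (u v : List (Letter m n)) :
    wordF i (u ++ v) =
      if tensorLeftF i (wordEps i u) (wordPhi i u) (wordEps i v) (wordPhi i v) then
        (wordF i u).map (· ++ v)
      else (wordF i v).map (u ++ ·) := by
  induction u with
  | nil =>
    have := wordF_eq_none_iff i v
    simp only [List.nil_append, wordEps, wordPhi, tensorLeftF, wordF]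
    split_ifs <;> simp <;> first | omega | (apply this.2; omega)
  | cons b u ih =>
    have h2 := letterPhi_add_letterEps_le i b
    have hz := fun hi => wordPhi_add_wordEps_le (i := i) hi u
    have hl : letterF i b = none ↔ letterPhi i b = 0 := by
      unfold letterF letterPhi; split_ifs <;> simp
    have hu := wordF_eq_none_iff i u
    have hv := wordF_eq_none_iff i v
    have hA := wordEps_append i u v
    simp only [List.cons_append, wordEps_cons, wordPhi_cons, wordF_cons, ih, hA.1, hA.2]
    simp only [tensorEps, tensorPhi, tensorLeftF]
    by_cases hb : i.IsBar
    · simp only [hb, if_true]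
      split_ifs <;> first | omega | simp [Function.comp_def]
    by_cases hi : i.IsZero
    · simp only [hb, hi, if_true, if_false]
      split_ifs <;> first | omega | simp [Function.comp_def]
    · simp only [hb, hi, if_false]
      split_ifs <;> first | omega | simp [Function.comp_def]

theorem letterEps_src (i : Index m n) : letterEps i i.src = 0 := by
  simp [letterEps, i.src_ne_tgt]

theorem letterPhi_src (i : Index m n) : letterPhi i i.src = 1 := by
  simp [letterPhi]

theorem letterEps_tgt (i : Index m n) : letterEps i i.tgt = 1 := by
  simp [letterEps]

theorem letterPhi_tgt (i : Index m n) : letterPhi i i.tgt = 0 := by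
  simp [letterPhi, i.src_ne_tgt.symm]

theorem letterE_eq_some {i : Index m n} {b b' : Letter m n} :
    letterE i b = some b' ↔ b = i.tgt ∧ b' = i.src := by
  unfold letterE; split_ifs <;> simp [*, eq_comm]

theorem letterF_eq_some {i : Index m n} {b b' : Letter m n} :
    letterF i b = some b' ↔ b = i.src ∧ b' = i.tgt := by
  unfold letterF; split_ifs <;> simp [*, eq_comm]

/-- One induction serves all four claims, since recognising the branch of the rule that `f_i` takes
on the new word requires the new values of `ε_i` and `φ_i`. -/
theorem wordE_spec {i : Index m n} {w w' : List (Letter m n)} (h : wordE i w = some w') :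
    wordEps i w = wordEps i w' + 1 ∧ wordPhi i w' = wordPhi i w + 1 ∧
      wordWt w' = wordWt w + root i ∧ wordF i w' = some w := by
  induction w generalizing w' with
  | nil => simp [wordE] at h
  | cons b w ih =>
    have hbz := fun hb => Index.not_isZero_of_isBar (i := i) hb
    have hzw := fun hi => wordPhi_add_wordEps_le (i := i) hi w
    rw [wordE_cons] at h
    split_ifs at h with hc
    · obtain ⟨b', hb', rfl⟩ := Option.map_eq_some_iff.1 h
      obtain ⟨rfl, rfl⟩ := letterE_eq_some.1 hb'
      have hF : tensorLeftF i 0 1 (wordEps i w) (wordPhi i w) := by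
        rw [letterEps_tgt, letterPhi_tgt] at hc
        unfold tensorLeftE at hc
        unfold tensorLeftF
        split_ifs at * <;> omega
      refine ⟨?_, ?_, ?_, ?_⟩
      · rw [wordEps_cons, wordEps_cons, letterEps_src, letterEps_tgt, letterPhi_src,
          letterPhi_tgt]
        rw [letterEps_tgt, letterPhi_tgt] at hc
        unfold tensorLeftE at hc
        unfold tensorEps
        split_ifs at * <;> omega
      · rw [wordPhi_cons, wordPhi_cons, letterEps_src, letterEps_tgt, letterPhi_src,
          letterPhi_tgt]
        rw [letterEps_tgt, letterPhi_tgt] at hc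
        unfold tensorLeftE at hc
        unfold tensorPhi
        split_ifs at * <;> omega
      · simp only [wordWt, letterWt, root]
        abel
      · rw [wordF_cons, letterEps_src, letterPhi_src, if_pos hF, letterF, if_pos rfl]
        rfl
    · obtain ⟨w₁, hw₁, rfl⟩ := Option.map_eq_some_iff.1 h
      obtain ⟨h1, h2, h3, h4⟩ := ih hw₁
      have hzw' := fun hi => wordPhi_add_wordEps_le (i := i) hi w₁
      have hb := letterPhi_add_letterEps_le i b
      have hF : ¬ tensorLeftF i (letterEps i b) (letterPhi i b) (wordEps i w₁)
          (wordPhi i w₁) := by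
        unfold tensorLeftE at hc
        unfold tensorLeftF
        split_ifs at * <;> omega
      refine ⟨?_, ?_, ?_, ?_⟩
      · rw [wordEps_cons, wordEps_cons]
        unfold tensorLeftE at hc
        unfold tensorEps
        split_ifs at * <;> omega
      · rw [wordPhi_cons, wordPhi_cons]
        unfold tensorLeftE at hc
        unfold tensorPhi
        split_ifs at * <;> omega
      · simp only [wordWt, h3]
        abel
      · rw [wordF_cons, if_neg hF, h4]
        rfl

theorem wordE_of_wordF {i : Index m n} {w w' : List (Letter m n)} (h : wordF i w = some w') :
    wordE i w' = some w := by
  induction w generalizing w' with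
  | nil => simp [wordF] at h
  | cons b w ih =>
    have hbz := fun hb => Index.not_isZero_of_isBar (i := i) hb
    rw [wordF_cons] at h
    split_ifs at h with hc
    · obtain ⟨b', hb', rfl⟩ := Option.map_eq_some_iff.1 h
      obtain ⟨rfl, rfl⟩ := letterF_eq_some.1 hb'
      have hF : tensorLeftE i 1 0 (wordEps i w) (wordPhi i w) := by
        rw [letterEps_src, letterPhi_src] at hc
        unfold tensorLeftF at hc
        unfold tensorLeftE
        split_ifs at * <;> omega
      rw [wordE_cons, letterEps_tgt, letterPhi_tgt, if_pos hF, letterE, if_pos rfl]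
      rfl
    · obtain ⟨w₁, hw₁, rfl⟩ := Option.map_eq_some_iff.1 h
      have h4 := ih hw₁
      obtain ⟨h1, h2, -, -⟩ := wordE_spec h4
      have hb := letterPhi_add_letterEps_le i b
      have hF : ¬ tensorLeftE i (letterEps i b) (letterPhi i b) (wordEps i w₁)
          (wordPhi i w₁) := by
        unfold tensorLeftF at hc
        unfold tensorLeftE
        split_ifs at * <;> omega
      rw [wordE_cons, if_neg hF, h4]
      rfl

theorem wordF_iff_wordE {i : Index m n} {w w' : List (Letter m n)} :
    wordF i w = some w' ↔ wordE i w' = some w :=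
  ⟨wordE_of_wordF, fun h => (wordE_spec h).2.2.2⟩

theorem coroot_wordWt_of_isZero {i : Index m n} (hi : i.IsZero) (w : List (Letter m n)) :
    0 ≤ coroot i (wordWt w) ∧
      wordPhi i w + wordEps i w = if coroot i (wordWt w) = 0 then 0 else 1 := by
  have hb : ¬ i.IsBar := fun h => Index.not_isZero_of_isBar h hi
  induction w with
  | nil => simp [wordWt, coroot_zero, wordPhi, wordEps]
  | cons b w ih =>
    have h := coroot_letterWt_of_isZero hi b
    have h2 := letterPhi_add_letterEps_le i b
    rw [wordPhi_cons, wordEps_cons, wordWt, coroot_add, h]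
    simp only [tensorEps, tensorPhi, if_neg hb, if_pos hi]
    obtain ⟨h3, h4⟩ := ih
    refine ⟨by omega, ?_⟩
    split_ifs at * <;> omega

theorem wordCrystal_isCrystal (m n : ℕ) : (wordCrystal m n).IsCrystal where
  phi_sub_eps _ hi w := wordPhi_sub_wordEps hi w
  coroot_zero_nonneg _ hi w := (coroot_wordWt_of_isZero hi w).1
  phi_add_eps _ hi w := (coroot_wordWt_of_isZero hi w).2
  of_e _ _ _ h := let s := wordE_spec h; ⟨s.1, s.2.1, s.2.2.1⟩
  of_f i w w' h := by
    obtain ⟨h1, h2, h3, -⟩ := wordE_spec (wordE_of_wordF h)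
    exact ⟨h1, h2, by simp only [wordCrystal]; rw [h3]; abel⟩
  f_iff_e _ _ _ := wordF_iff_wordE

/-! ### Words of single columns -/

/-- The word with `v b` letters `b`, decreasing if `d = 0` and increasing otherwise. -/
def colWord (m n d : ℕ) (v : ℕ → ℕ) : List (Letter m n) :=
  (if d = 0 then (List.finRange (m + n)).reverse else List.finRange (m + n)).flatMap
    fun b : Letter m n => List.replicate (v b) b

/-- The condition on the multiplicities of the letters in a column of degree `d`. -/
def ColValid (m d : ℕ) (v : ℕ → ℕ) : Prop :=
  ∀ b, (b < m ∧ d = 0) ∨ (m ≤ b ∧ d ≠ 0) ∨ v b ≤ 1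

/-- `ε_i` of a column of degree `d` with `x` letters `i.src` and `y` letters `i.tgt`. -/
def colEps (i : Index m n) (d x y : ℕ) : ℕ :=
  if i.IsBar then (if d = 0 then y else y - x)
  else if i.IsZero then
    (if d = 0 then min y 1 else if 0 < x then 0 else min y 1)
  else (if d = 0 then y - x else y)

/-- `φ_i` of a column of degree `d` with `x` letters `i.src` and `y` letters `i.tgt`. -/
def colPhi (i : Index m n) (d x y : ℕ) : ℕ :=
  if i.IsBar then (if d = 0 then x else x - y)
  else if i.IsZero then
    (if d = 0 then (if 0 < y then 0 else min x 1) else min x 1)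
  else (if d = 0 then x - y else x)

theorem Index.isBar_iff {i : Index m n} : i.IsBar ↔ (i : ℕ) + 1 < m := Iff.rfl

theorem Index.isZero_iff {i : Index m n} : i.IsZero ↔ (i : ℕ) + 1 = m := Iff.rfl

theorem colEps_colPhi_cases (i : Index m n) (d x y : ℕ) :
    ((i : ℕ) + 1 < m ∧ d = 0 ∧ colEps i d x y = y ∧ colPhi i d x y = x) ∨
    ((i : ℕ) + 1 < m ∧ d ≠ 0 ∧ colEps i d x y = y - x ∧ colPhi i d x y = x - y) ∨
    ((i : ℕ) + 1 = m ∧ d = 0 ∧ 0 < y ∧ colEps i d x y = 1 ∧ colPhi i d x y = 0) ∨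
    ((i : ℕ) + 1 = m ∧ d = 0 ∧ y = 0 ∧ colEps i d x y = 0 ∧ colPhi i d x y = min x 1) ∨
    ((i : ℕ) + 1 = m ∧ d ≠ 0 ∧ 0 < x ∧ colEps i d x y = 0 ∧ colPhi i d x y = 1) ∨
    ((i : ℕ) + 1 = m ∧ d ≠ 0 ∧ x = 0 ∧ colEps i d x y = min y 1 ∧ colPhi i d x y = 0) ∨
    (m < (i : ℕ) + 1 ∧ d = 0 ∧ colEps i d x y = y - x ∧ colPhi i d x y = x - y) ∨
    (m < (i : ℕ) + 1 ∧ d ≠ 0 ∧ colEps i d x y = y ∧ colPhi i d x y = x) := by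
  by_cases hb : i.IsBar
  · have hb' := Index.isBar_iff.1 hb
    by_cases hd : d = 0
    · exact Or.inl ⟨hb', hd, by simp [colEps, hb, hd], by simp [colPhi, hb, hd]⟩
    · exact Or.inr (Or.inl ⟨hb', hd, by simp [colEps, hb, hd], by simp [colPhi, hb, hd]⟩)
  have hb' := mt Index.isBar_iff.2 hb
  iterate 2 apply Or.inr
  by_cases hz : i.IsZero
  · have hz' := Index.isZero_iff.1 hz
    by_cases hd : d = 0
    · rcases Nat.eq_zero_or_pos y with hy | hy
      · exact Or.inr (Or.inl ⟨hz', hd, hy, by simp [colEps, hb, hz, hd, hy],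
          by simp [colPhi, hb, hz, hd, hy]⟩)
      · exact Or.inl ⟨hz', hd, hy, by simp [colEps, hb, hz, hd]; omega,
          by simp [colPhi, hb, hz, hd, hy]⟩
    · iterate 2 apply Or.inr
      rcases Nat.eq_zero_or_pos x with hx | hx
      · exact Or.inr (Or.inl ⟨hz', hd, hx, by simp [colEps, hb, hz, hd, hx],
          by simp [colPhi, hb, hz, hd, hx]⟩)
      · exact Or.inl ⟨hz', hd, hx, by simp [colEps, hb, hz, hd]; omega,
          by simp [colPhi, hb, hz, hd]; omega⟩
  · have hz' := mt Index.isZero_iff.2 hz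
    iterate 4 apply Or.inr
    by_cases hd : d = 0
    · exact Or.inl ⟨by omega, hd, by simp [colEps, hb, hz, hd], by simp [colPhi, hb, hz, hd]⟩
    · exact Or.inr ⟨by omega, hd, by simp [colEps, hb, hz, hd], by simp [colPhi, hb, hz, hd]⟩

/-- Replace one letter `i + 1` by `i`. -/
def raise (i : ℕ) (v : ℕ → ℕ) : ℕ → ℕ :=
  fun k => if k = i then v k + 1 else if k = i + 1 then v k - 1 else v k

/-- Replace one letter `i` by `i + 1`. -/
def lower (i : ℕ) (v : ℕ → ℕ) : ℕ → ℕ :=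
  fun k => if k = i then v k - 1 else if k = i + 1 then v k + 1 else v k

theorem word_neutral {i : Index m n} {w : List (Letter m n)} (hs : i.src ∉ w) (ht : i.tgt ∉ w) :
    wordEps i w = 0 ∧ wordPhi i w = 0 := by
  induction w with
  | nil => simp [wordEps, wordPhi]
  | cons b w ih =>
    simp only [List.mem_cons, not_or] at hs ht
    obtain ⟨h1, h2⟩ := ih hs.2 ht.2
    have h3 : letterEps i b = 0 := if_neg (Ne.symm ht.1)
    have h4 : letterPhi i b = 0 := if_neg (Ne.symm hs.1)
    rw [wordEps_cons, wordPhi_cons, h1, h2, h3, h4]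
    simp [tensorEps, tensorPhi]

/-- Letters other than `i.src` and `i.tgt` are invisible to the index `i`. In a column the two
relevant letters form adjacent blocks, so only these blocks have to be examined. -/
theorem word_neutral_context {i : Index m n} {U V : List (Letter m n)} (M : List (Letter m n))
    (hUs : i.src ∉ U) (hUt : i.tgt ∉ U) (hVs : i.src ∉ V) (hVt : i.tgt ∉ V) :
    wordEps i (U ++ (M ++ V)) = wordEps i M ∧ wordPhi i (U ++ (M ++ V)) = wordPhi i M ∧
      wordE i (U ++ (M ++ V)) = (wordE i M).map fun M' => U ++ (M' ++ V) := by
  obtain ⟨hU1, hU2⟩ := word_neutral hUs hUt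
  obtain ⟨hV1, hV2⟩ := word_neutral hVs hVt
  have h1 := wordEps_append i U (M ++ V)
  have h2 := wordEps_append i M V
  have hz := fun hi => wordPhi_add_wordEps_le (i := i) hi M
  have hUE := (wordE_eq_none_iff i U).2 hU1
  have hVE := (wordE_eq_none_iff i V).2 hV1
  have hM := wordE_eq_none_iff i M
  rw [wordE_append, wordE_append, h1.1, h1.2, h2.1, h2.2, hU1, hU2, hV1, hV2, hUE, hVE]
  refine ⟨?_, ?_, ?_⟩
  · unfold tensorEps tensorPhi
    split_ifs <;> omega
  · unfold tensorEps tensorPhi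
    split_ifs <;> omega
  · unfold tensorEps tensorPhi tensorLeftE
    by_cases h0 : wordEps i M = 0
    · rw [hM.2 h0]
      simp
    · have : 0 < wordEps i M + wordPhi i M := by omega
      have : 0 < wordEps i M := by omega
      split_ifs <;> first | omega | simp [Function.comp_def]

theorem word_replicate_src (i : Index m n) (x : ℕ) :
    wordEps i (List.replicate x i.src) = 0 ∧
      wordPhi i (List.replicate x i.src) = if i.IsZero then min x 1 else x := by
  have hbz := fun hb => Index.not_isZero_of_isBar (i := i) hb
  induction x with
  | zero => simp [wordEps, wordPhi]
  | succ x ih =>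
    rw [List.replicate_succ, wordEps_cons, wordPhi_cons, ih.1, ih.2, letterEps_src, letterPhi_src]
    unfold tensorEps tensorPhi
    refine ⟨?_, ?_⟩ <;> split_ifs at * <;> first | omega | simp_all

theorem word_replicate_tgt (i : Index m n) (y : ℕ) :
    wordPhi i (List.replicate y i.tgt) = 0 ∧
      wordEps i (List.replicate y i.tgt) = if i.IsZero then min y 1 else y := by
  have hbz := fun hb => Index.not_isZero_of_isBar (i := i) hb
  induction y with
  | zero => simp [wordEps, wordPhi]
  | succ x ih =>
    rw [List.replicate_succ, wordEps_cons, wordPhi_cons, ih.1, ih.2, letterEps_tgt, letterPhi_tgt]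
    unfold tensorEps tensorPhi
    refine ⟨?_, ?_⟩ <;> split_ifs at * <;> first | omega | simp_all

theorem wordE_replicate_tgt (i : Index m n) (y : ℕ) :
    wordE i (List.replicate (y + 1) i.tgt) =
      some (if i.IsBar then List.replicate y i.tgt ++ [i.src]
        else i.src :: List.replicate y i.tgt) := by
  have hbz := fun hb => Index.not_isZero_of_isBar (i := i) hb
  have hl : letterE i i.tgt = some i.src := if_pos rfl
  by_cases hb : i.IsBar
  · rw [if_pos hb]
    induction y with
    | zero =>
      simp [wordE_cons, letterPhi_tgt, wordEps, tensorLeftE, hb, hl]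
    | succ y ih =>
      rw [List.replicate_succ, wordE_cons, ih, (word_replicate_tgt i _).1,
        (word_replicate_tgt i _).2, letterEps_tgt, letterPhi_tgt]
      simp [tensorLeftE, hb, hbz hb, List.replicate_succ]
  · rw [if_neg hb, List.replicate_succ, wordE_cons, letterEps_tgt, letterPhi_tgt,
      (word_replicate_tgt i _).1]
    simp [tensorLeftE, hb, hl]

theorem word_pair (i : Index m n) (d x y : ℕ) :
    let M := if d = 0 then List.replicate y i.tgt ++ List.replicate x i.src
      else List.replicate x i.src ++ List.replicate y i.tgt
    wordEps i M = colEps i d x y ∧ wordPhi i M = colPhi i d x y := by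
  have hbz := fun hb => Index.not_isZero_of_isBar (i := i) hb
  obtain ⟨h1, h2⟩ := word_replicate_src i x
  obtain ⟨h3, h4⟩ := word_replicate_tgt i y
  intro M
  have hM : M = if d = 0 then List.replicate y i.tgt ++ List.replicate x i.src
      else List.replicate x i.src ++ List.replicate y i.tgt := rfl
  rw [hM]
  unfold colEps colPhi
  by_cases hd : d = 0
  · simp only [if_pos hd, (wordEps_append i _ _).1, (wordEps_append i _ _).2, h1, h2, h3, h4]
    unfold tensorEps tensorPhi
    refine ⟨?_, ?_⟩ <;> split_ifs at * <;> first | omega | simp_all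
  · simp only [if_neg hd, (wordEps_append i _ _).1, (wordEps_append i _ _).2, h1, h2, h3, h4]
    unfold tensorEps tensorPhi
    refine ⟨?_, ?_⟩ <;> split_ifs at * <;> first | omega | simp_all

/-- The altered `i.tgt` must border the block of `i.src` for the result to be a column again. When
the rule alters the far end of the block instead, validity and positivity of `ε_i` leave a single
`i.tgt`, and no `i.src` on the wrong side of it. -/
theorem wordE_pair (i : Index m n) {d x y : ℕ}
    (hx : ((i : ℕ) < m ∧ d = 0) ∨ (m ≤ (i : ℕ) ∧ d ≠ 0) ∨ x ≤ 1)
    (hy : ((i : ℕ) + 1 < m ∧ d = 0) ∨ (m ≤ (i : ℕ) + 1 ∧ d ≠ 0) ∨ y ≤ 1)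
    (h0 : 0 < colEps i d x y) :
    wordE i (if d = 0 then List.replicate y i.tgt ++ List.replicate x i.src
        else List.replicate x i.src ++ List.replicate y i.tgt) =
      some (if d = 0 then List.replicate (y - 1) i.tgt ++ List.replicate (x + 1) i.src
        else List.replicate (x + 1) i.src ++ List.replicate (y - 1) i.tgt) := by
  have hbz := fun hb => Index.not_isZero_of_isBar (i := i) hb
  obtain ⟨h1, h2⟩ := word_replicate_src i x
  obtain ⟨h3, h4⟩ := word_replicate_tgt i y
  have hE := (wordE_eq_none_iff i (List.replicate x i.src)).2 h1
  have hcases := colEps_colPhi_cases i d x y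
  have hy0 : 0 < y := by omega
  obtain ⟨y, rfl⟩ : ∃ k, y = k + 1 := ⟨y - 1, by omega⟩
  have hEt := wordE_replicate_tgt i y
  by_cases hd0 : d = 0
  · simp only [if_pos hd0, wordE_append, h1, h2, h3, h4]
    rw [if_pos, hEt]
    · by_cases hb : i.IsBar
      · simp [hb, List.replicate_succ]
      · have : y = 0 := by
          unfold Index.IsBar at hb
          omega
        subst this
        simp [hb, List.replicate_succ]
    · unfold tensorLeftE
      split_ifs at * <;> simp only [Index.isBar_iff, Index.isZero_iff] at * <;> omega
  · simp only [if_neg hd0, wordE_append, h1, h2, h3, h4]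
    rw [if_neg, hEt]
    · by_cases hb : i.IsBar
      · have hb' := hb
        unfold Index.IsBar at hb'
        have h5 : x = 0 := by omega
        have h6 : y = 0 := by omega
        subst h5 h6
        simp [hb]
      · simp [hb, List.replicate_succ', List.append_assoc]
    · unfold tensorLeftE
      split_ifs at * <;> simp only [Index.isBar_iff, Index.isZero_iff] at * <;> omega

theorem finRange_split (i : Index m n) :
    ∃ L₁ L₂ : List (Letter m n), List.finRange (m + n) = L₁ ++ (i.src :: i.tgt :: L₂) ∧
      i.src ∉ L₁ ∧ i.tgt ∉ L₁ ∧ i.src ∉ L₂ ∧ i.tgt ∉ L₂ := by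
  have h : List.finRange (m + n) = (List.finRange (m + n)).take i ++
      (i.src :: i.tgt :: (List.finRange (m + n)).drop (i + 2)) := by
    conv_lhs => rw [← List.take_append_drop i (List.finRange (m + n))]
    have := i.2
    rw [List.drop_eq_getElem_cons (by simp; omega), List.drop_eq_getElem_cons (by simp; omega)]
    simp [Index.src, Index.tgt]
  refine ⟨_, _, h, ?_⟩
  have hn := List.nodup_finRange (m + n)
  rw [h] at hn
  simp only [List.nodup_append, List.nodup_cons, List.mem_cons] at hn
  obtain ⟨-, ⟨h1, h2, -⟩, h3⟩ := hn
  refine ⟨fun h => h3 _ h _ (Or.inl rfl) rfl, fun h => h3 _ h _ (Or.inr (Or.inl rfl)) rfl,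
    fun h => h1 (Or.inr h), h2⟩

theorem colWord_split (i : Index m n) (d : ℕ) :
    ∃ L₁ L₂ : List (Letter m n), i.src ∉ L₁ ∧ i.tgt ∉ L₁ ∧ i.src ∉ L₂ ∧ i.tgt ∉ L₂ ∧
      ∀ v, colWord m n d v = (L₁.flatMap fun b : Letter m n => List.replicate (v b) b) ++
        ((if d = 0 then List.replicate (v (i + 1)) i.tgt ++ List.replicate (v i) i.src
        else List.replicate (v i) i.src ++ List.replicate (v (i + 1)) i.tgt) ++
          (L₂.flatMap fun b : Letter m n => List.replicate (v b) b)) := by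
  obtain ⟨L₁, L₂, h, h1, h2, h3, h4⟩ := finRange_split i
  have hs : ((i.src : Letter m n) : ℕ) = i := rfl
  have ht : ((i.tgt : Letter m n) : ℕ) = i + 1 := rfl
  by_cases hd : d = 0
  · refine ⟨L₂.reverse, L₁.reverse, by simpa, by simpa, by simpa, by simpa, fun v => ?_⟩
    unfold colWord
    rw [if_pos hd, if_pos hd, h]
    simp [hs, ht]
  · refine ⟨L₁, L₂, by simpa, by simpa, by simpa, by simpa, fun v => ?_⟩
    unfold colWord
    rw [if_neg hd, if_neg hd, h]
    simp [hs, ht]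

theorem not_mem_flatMap_replicate {b : Letter m n} {L : List (Letter m n)} (h : b ∉ L)
    (v : ℕ → ℕ) : b ∉ L.flatMap fun b : Letter m n => List.replicate (v b) b := by
  intro h'
  obtain ⟨c, hc, hc'⟩ := List.mem_flatMap.1 h'
  exact h (List.eq_of_mem_replicate hc' ▸ hc)

theorem word_colWord (i : Index m n) (d : ℕ) (v : ℕ → ℕ) :
    wordEps i (colWord m n d v) = colEps i d (v i) (v (i + 1)) ∧
      wordPhi i (colWord m n d v) = colPhi i d (v i) (v (i + 1)) := by
  obtain ⟨L₁, L₂, h1, h2, h3, h4, h⟩ := colWord_split i d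
  rw [h]
  obtain ⟨h5, h6, -⟩ := word_neutral_context
    (if d = 0 then List.replicate (v (i + 1)) i.tgt ++ List.replicate (v i) i.src
        else List.replicate (v i) i.src ++ List.replicate (v (i + 1)) i.tgt)
    (not_mem_flatMap_replicate h1 v) (not_mem_flatMap_replicate h2 v)
    (not_mem_flatMap_replicate h3 v) (not_mem_flatMap_replicate h4 v)
  rw [h5, h6]
  exact word_pair i d _ _

theorem wordE_colWord (i : Index m n) {d : ℕ} {v : ℕ → ℕ} (hv : ColValid m d v) :
    wordE i (colWord m n d v) = if 0 < colEps i d (v i) (v (i + 1)) then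
      some (colWord m n d (raise i v)) else none := by
  split_ifs with h0
  · obtain ⟨L₁, L₂, h1, h2, h3, h4, h⟩ := colWord_split i d
    rw [h, h]
    obtain ⟨-, -, h7⟩ := word_neutral_context
      (if d = 0 then List.replicate (v (i + 1)) i.tgt ++ List.replicate (v i) i.src
          else List.replicate (v i) i.src ++ List.replicate (v (i + 1)) i.tgt)
      (not_mem_flatMap_replicate h1 v) (not_mem_flatMap_replicate h2 v)
      (not_mem_flatMap_replicate h3 v) (not_mem_flatMap_replicate h4 v)
    have hcongr : ∀ L : List (Letter m n), i.src ∉ L → i.tgt ∉ L →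
        (L.flatMap fun b : Letter m n => List.replicate (raise i v b) b) =
          L.flatMap fun b : Letter m n => List.replicate (v b) b := by
      intro L hs ht
      refine List.flatMap_congr fun b hb => ?_
      have h8 : (b : ℕ) ≠ i := fun h => hs (by rwa [show i.src = b from Fin.ext h.symm])
      have h9 : (b : ℕ) ≠ i + 1 := fun h => ht (by rwa [show i.tgt = b from Fin.ext h.symm])
      simp [raise, h8, h9]
    rw [h7, wordE_pair i (hv _) (hv _) h0, hcongr _ h1 h2, hcongr _ h3 h4]
    simp [raise]
  · rw [wordE_eq_none_iff, (word_colWord i d v).1]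
    omega

/-- Where the multiplicity of `i.src` is bounded by one, positivity of `ε_i` forces it to be zero,
so there is room for one more. -/
theorem ColValid.raise {i : Index m n} {d : ℕ} {v : ℕ → ℕ} (hv : ColValid m d v)
    (h0 : 0 < colEps i d (v i) (v (i + 1))) : ColValid m d (raise i v) := by
  intro b
  have h1 := hv b
  have h2 := hv (i + 1)
  have h3 := colEps_colPhi_cases i d (v i) (v (i + 1))
  unfold GLCrystal.raise
  split_ifs with h4 h5
  · subst h4
    omega
  · omega
  · exact h1

theorem ColValid.lower {i : Index m n} {d : ℕ} {v : ℕ → ℕ} (hv : ColValid m d v)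
    (h0 : 0 < colPhi i d (v i) (v (i + 1))) : ColValid m d (lower i v) := by
  intro b
  have h1 := hv b
  have h2 := hv i
  have h3 := colEps_colPhi_cases i d (v i) (v (i + 1))
  unfold GLCrystal.lower
  split_ifs with h4 h5
  · omega
  · subst h5
    omega
  · exact h1

theorem wordF_colWord (i : Index m n) {d : ℕ} {v : ℕ → ℕ} (hv : ColValid m d v) :
    wordF i (colWord m n d v) = if 0 < colPhi i d (v i) (v (i + 1)) then
      some (colWord m n d (lower i v)) else none := by
  split_ifs with h0
  · have h7 := colEps_colPhi_cases i d (v i) (v (i + 1))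
    have hx : 0 < v i := by omega
    have h1 : raise i (lower i v) = v := by
      funext k
      simp only [raise, lower]
      split_ifs <;> first | omega | (subst_vars; omega)
    have h2 : lower i v i = v i - 1 := by simp [lower]
    have h3 : lower i v (i + 1) = v (i + 1) + 1 := by simp [lower]
    rw [wordF_iff_wordE, wordE_colWord i (hv.lower h0), h1, if_pos]
    rw [h2, h3]
    have h5 := hv i
    have h6 := hv (i + 1)
    have h8 := colEps_colPhi_cases i d (v i - 1) (v (i + 1) + 1)
    omega
  · rw [wordF_eq_none_iff, (word_colWord i d v).2]
    omega

/-! ### The local rule and column insertion -/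

/-- The degree of the letter at position `b`. -/
def dg (m b : ℕ) : ℕ := if b < m then 0 else 1

theorem dg_cases (m b : ℕ) : (b < m ∧ dg m b = 0) ∨ (m ≤ b ∧ dg m b = 1) := by
  unfold dg; split_ifs <;> omega

/-- The local rule at a cell whose row has degree `p` and whose column has degree `q`. -/
def cell (p q lam mu nu a : ℕ) : ℕ :=
  if p = 0 then (if q = 0 then max (max mu nu) (lam + min a 1) else max (mu + a) nu)
  else (if q = 0 then max mu (nu + a) else max mu nu + a)

theorem cell_cases (p q lam mu nu a : ℕ) :
    (p = 0 ∧ q = 0 ∧ cell p q lam mu nu a = max (max mu nu) (lam + min a 1)) ∨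
    (p = 0 ∧ q ≠ 0 ∧ cell p q lam mu nu a = max (mu + a) nu) ∨
    (p ≠ 0 ∧ q = 0 ∧ cell p q lam mu nu a = max mu (nu + a)) ∨
    (p ≠ 0 ∧ q ≠ 0 ∧ cell p q lam mu nu a = max mu nu + a) := by
  unfold cell; split_ifs <;> simp [*]

/-- The branches with equal degrees are symmetric in `mu` and `nu`, and the two mixed branches are
exchanged. All later symmetry under transposition comes from this. -/
theorem cell_swap (p q lam mu nu a : ℕ) : cell p q lam mu nu a = cell q p lam nu mu a := by
  have h1 := cell_cases p q lam mu nu a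
  have h2 := cell_cases q p lam nu mu a
  omega

/-- The partial sums of the multiplicities of the letters after a column `a` of degree `q` is
inserted into a column with partial sums `s`. -/
def newSum (m q : ℕ) (s a : ℕ → ℕ) : ℕ → ℕ
  | 0 => 0
  | b + 1 => cell (dg m b) q (s b) (newSum m q s a b) (s (b + 1)) (a b)

/-- Partial sums. -/
def psum (v : ℕ → ℕ) : ℕ → ℕ
  | 0 => 0
  | b + 1 => psum v b + v b

/-- The column that results from inserting `a` into `c`. -/
def insCol (m q : ℕ) (c a : ℕ → ℕ) : ℕ → ℕ :=
  fun b => newSum m q (psum c) a (b + 1) - newSum m q (psum c) a b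

/-- The letters that are bumped when `a` is inserted into `c`. -/
def bumped (m q : ℕ) (c a : ℕ → ℕ) : ℕ → ℕ :=
  fun b => a b + c b - insCol m q c a b

theorem newSum_mono (m q : ℕ) (s a : ℕ → ℕ) (b : ℕ) :
    newSum m q s a b ≤ newSum m q s a (b + 1) ∧ s (b + 1) ≤ newSum m q s a (b + 1) := by
  have := cell_cases (dg m b) q (s b) (newSum m q s a b) (s (b + 1)) (a b)
  rw [newSum]
  omega

theorem psum_insCol (m q : ℕ) (c a : ℕ → ℕ) :
    psum (insCol m q c a) = newSum m q (psum c) a := by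
  funext b
  induction b with
  | zero => rfl
  | succ b ih =>
    rw [psum, ih, insCol]
    have := newSum_mono m q (psum c) a b
    omega

theorem psum_le_newSum (m q : ℕ) (c a : ℕ → ℕ) (b : ℕ) :
    psum c b ≤ newSum m q (psum c) a b := by
  cases b with
  | zero => exact le_rfl
  | succ b => exact (newSum_mono m q (psum c) a b).2

/-- A chain meets a column of degree 0 at most once, so such a column lengthens it by at most one.
-/
theorem newSum_le {m q : ℕ} {c a : ℕ → ℕ} (hq : q = 0) (ha : ColValid m q a)
    (hc : ColValid m 1 c) (b : ℕ) :
    newSum m q (psum c) a b ≤ psum c b + 1 := by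
  induction b with
  | zero => simp [newSum]
  | succ b ih =>
    have h1 := cell_cases (dg m b) q (psum c b) (newSum m q (psum c) a b) (psum c (b + 1)) (a b)
    have h2 := dg_cases m b
    have h3 := ha b
    have h4 := hc b
    rw [newSum]
    rw [psum] at *
    omega

/-- Ensures that the truncated subtraction in `bumped` is exact, and that both outputs of an
insertion obey the multiplicity bounds of columns of their degrees. -/
theorem insCol_spec {m q : ℕ} {c a : ℕ → ℕ} (ha : ColValid m q a) (hc : ColValid m 1 c) (b : ℕ) :
    insCol m q c a b ≤ a b + c b ∧ (b < m → insCol m q c a b ≤ 1) ∧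
      ((b < m ∧ q = 0) ∨ (m ≤ b ∧ q ≠ 0) ∨ bumped m q c a b ≤ 1) := by
  have h1 := cell_cases (dg m b) q (psum c b) (newSum m q (psum c) a b) (psum c (b + 1)) (a b)
  have h2 := dg_cases m b
  have h3 := ha b
  have h4 := hc b
  have h5 := psum_le_newSum m q c a b
  have h6 := fun hq => newSum_le hq ha hc b
  simp only [bumped, insCol]
  rw [newSum]
  rw [psum] at *
  omega

theorem ColValid.insCol {m q : ℕ} {c a : ℕ → ℕ} (ha : ColValid m q a) (hc : ColValid m 1 c) :
    ColValid m 1 (insCol m q c a) := by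
  intro b
  have := insCol_spec ha hc b
  omega

theorem ColValid.bumped {m q : ℕ} {c a : ℕ → ℕ} (ha : ColValid m q a) (hc : ColValid m 1 c) :
    ColValid m q (bumped m q c a) :=
  fun b => (insCol_spec ha hc b).2.2

/-! ### Insertion commutes with the crystal operators -/

/-- `e_i` on a pair of columns. -/
def PairE (i : Index m n) (d₁ d₂ : ℕ) (v₁ v₂ v₁' v₂' : ℕ → ℕ) : Prop :=
  let E₁ := colEps i d₁ (v₁ i) (v₁ (i + 1))
  let P₁ := colPhi i d₁ (v₁ i) (v₁ (i + 1))
  let E₂ := colEps i d₂ (v₂ i) (v₂ (i + 1))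
  let P₂ := colPhi i d₂ (v₂ i) (v₂ (i + 1))
  (tensorLeftE i E₁ P₁ E₂ P₂ ∧ 0 < E₁ ∧ v₁' = raise i v₁ ∧ v₂' = v₂) ∨
  (¬ tensorLeftE i E₁ P₁ E₂ P₂ ∧ 0 < E₂ ∧ v₁' = v₁ ∧ v₂' = raise i v₂)

-- Only the letters at positions `i` and `i + 1` matter, so the commutation concerns two adjacent
-- cells of the local rule. Here `L` and `M` are the old and new partial sums before position `i`,
-- the multiplicities are `x, y` in `c` and `z, w` in `a`, and primes mark the new column and the
-- bumped letters. `N₁, N₂` are the partial sums recomputed after `e_i` has acted on `c ⊗ a`. That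
-- `N₂` keeps its old value confines the change to these two letters. If `N₁` is also unchanged,
-- `e_i` has acted on the bumped letters; if it has grown by one, on the new column.
set_option maxHeartbeats 1000000 in
theorem insert_tensor_aux (i : Index m n) {q L M x y z w x' y' z' w' : ℕ}
    (hM : L ≤ M) (hM' : q = 0 → M ≤ L + 1)
    (hx : (i : ℕ) < m → x ≤ 1) (hy : (i : ℕ) + 1 < m → y ≤ 1)
    (hz : ((i : ℕ) < m ∧ q = 0) ∨ (m ≤ (i : ℕ) ∧ q ≠ 0) ∨ z ≤ 1)
    (hw : ((i : ℕ) + 1 < m ∧ q = 0) ∨ (m ≤ (i : ℕ) + 1 ∧ q ≠ 0) ∨ w ≤ 1)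
    (h₁ : M + x' = cell (dg m i) q L M (L + x) z)
    (h₂ : M + x' + y' = cell (dg m (i + 1)) q (L + x) (M + x') (L + x + y) w)
    (h₃ : z' + x' = z + x) (h₄ : w' + y' = w + y) :
    (tensorEps i (colEps i q z' w') (colPhi i q z' w') (colEps i 1 x' y') (colPhi i 1 x' y') =
      tensorEps i (colEps i 1 x y) (colPhi i 1 x y) (colEps i q z w) (colPhi i q z w)) ∧
    (tensorPhi i (colEps i q z' w') (colPhi i q z' w') (colEps i 1 x' y') (colPhi i 1 x' y') =
      tensorPhi i (colEps i 1 x y) (colPhi i 1 x y) (colEps i q z w) (colPhi i q z w)) ∧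
    (∀ N₁ N₂, tensorLeftE i (colEps i 1 x y) (colPhi i 1 x y) (colEps i q z w) (colPhi i q z w) →
      0 < colEps i 1 x y → N₁ = cell (dg m i) q L M (L + x + 1) z →
      N₂ = cell (dg m (i + 1)) q (L + x + 1) N₁ (L + x + y) w →
      N₂ = M + x' + y' ∧
      ((N₁ = M + x' ∧ tensorLeftE i (colEps i q z' w') (colPhi i q z' w') (colEps i 1 x' y')
          (colPhi i 1 x' y') ∧ 0 < colEps i q z' w') ∨
        (N₁ = M + x' + 1 ∧ ¬ tensorLeftE i (colEps i q z' w') (colPhi i q z' w')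
          (colEps i 1 x' y') (colPhi i 1 x' y') ∧ 0 < colEps i 1 x' y'))) ∧
    (∀ N₁ N₂, ¬ tensorLeftE i (colEps i 1 x y) (colPhi i 1 x y) (colEps i q z w)
      (colPhi i q z w) → 0 < colEps i q z w → N₁ = cell (dg m i) q L M (L + x) (z + 1) →
      N₂ = cell (dg m (i + 1)) q (L + x) N₁ (L + x + y) (w - 1) →
      N₂ = M + x' + y' ∧
      ((N₁ = M + x' ∧ tensorLeftE i (colEps i q z' w') (colPhi i q z' w') (colEps i 1 x' y')
          (colPhi i 1 x' y') ∧ 0 < colEps i q z' w') ∨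
        (N₁ = M + x' + 1 ∧ ¬ tensorLeftE i (colEps i q z' w') (colPhi i q z' w')
          (colEps i 1 x' y') (colPhi i 1 x' y') ∧ 0 < colEps i 1 x' y'))) := by
  obtain ⟨k, rfl⟩ := Nat.exists_eq_add_of_le hM
  have hd0 := dg_cases m i
  have hd1 := dg_cases m (i + 1)
  by_cases hb : i.IsBar
  · have hb' := Index.isBar_iff.1 hb
    have hp0 : dg m i = 0 := by omega
    have hp1 : dg m (i + 1) = 0 := by omega
    by_cases hq : q = 0
    · replace hM' := hM' hq
      simp only [cell, colEps, colPhi, tensorEps, tensorPhi, tensorLeftE, hb, hp0, hp1, hq,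
        if_true, one_ne_zero, if_false] at h₁ h₂ ⊢
      have hx1 : x ≤ 1 := by omega
      have hy1 : y ≤ 1 := by omega
      clear hx hy hz hw hd0 hd1 hp0 hp1 hb hb' hq hM
      -- The multiplicities `x, y` and the gap `k = M - L` are all at most one here, so these three
      -- are enumerated before the arithmetic.
      obtain rfl | rfl : x = 0 ∨ x = 1 := by omega
      all_goals obtain rfl | rfl : y = 0 ∨ y = 1 := by omega
      all_goals obtain rfl | rfl : k = 0 ∨ k = 1 := by omega
      all_goals
        refine ⟨?_, ?_, fun N₁ N₂ h1 h2 h3 h4 => ⟨?_, ?_⟩, fun N₁ N₂ h1 h2 h3 h4 => ⟨?_, ?_⟩⟩ <;>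
          grind (splits := 40)
    · simp only [cell, colEps, colPhi, tensorEps, tensorPhi, tensorLeftE, hb, hp0, hp1, hq,
        if_true, one_ne_zero, if_false] at h₁ h₂ ⊢
      have hx1 : x ≤ 1 := by omega
      have hy1 : y ≤ 1 := by omega
      have hz1 : z ≤ 1 := by omega
      have hw1 : w ≤ 1 := by omega
      clear hx hy hz hw hd0 hd1 hp0 hp1 hb hb' hq hM hM'
      refine ⟨?_, ?_, fun N₁ N₂ h1 h2 h3 h4 => ⟨?_, ?_⟩, fun N₁ N₂ h1 h2 h3 h4 => ⟨?_, ?_⟩⟩ <;>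
        grind (splits := 40)
  have hb' := mt Index.isBar_iff.2 hb
  by_cases h0 : i.IsZero
  · have h0' := Index.isZero_iff.1 h0
    have hp0 : dg m i = 0 := by omega
    have hp1 : dg m (i + 1) = 1 := by omega
    by_cases hq : q = 0
    · replace hM' := hM' hq
      simp only [cell, colEps, colPhi, tensorEps, tensorPhi, tensorLeftE, hb, h0, hp0, hp1, hq,
        if_true, one_ne_zero, if_false] at h₁ h₂ ⊢
      have hx1 : x ≤ 1 := by omega
      have hw1 : w ≤ 1 := by omega
      clear hx hy hz hw hd0 hd1 hp0 hp1 hb hb' hq hM h0 h0'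
      refine ⟨?_, ?_, fun N₁ N₂ h1 h2 h3 h4 => ⟨?_, ?_⟩, fun N₁ N₂ h1 h2 h3 h4 => ⟨?_, ?_⟩⟩ <;>
        grind (splits := 40)
    · simp only [cell, colEps, colPhi, tensorEps, tensorPhi, tensorLeftE, hb, h0, hp0, hp1, hq,
        if_true, one_ne_zero, if_false] at h₁ h₂ ⊢
      have hx1 : x ≤ 1 := by omega
      have hz1 : z ≤ 1 := by omega
      clear hx hy hz hw hd0 hd1 hp0 hp1 hb hb' hq hM hM' h0 h0'
      refine ⟨?_, ?_, fun N₁ N₂ h1 h2 h3 h4 => ⟨?_, ?_⟩, fun N₁ N₂ h1 h2 h3 h4 => ⟨?_, ?_⟩⟩ <;>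
        grind (splits := 40)
  · have h0' := mt Index.isZero_iff.2 h0
    have hp0 : dg m i = 1 := by omega
    have hp1 : dg m (i + 1) = 1 := by omega
    by_cases hq : q = 0
    · replace hM' := hM' hq
      simp only [cell, colEps, colPhi, tensorEps, tensorPhi, tensorLeftE, hb, h0, hp0, hp1, hq,
        if_true, one_ne_zero, if_false] at h₁ h₂ ⊢
      have hz1 : z ≤ 1 := by omega
      have hw1 : w ≤ 1 := by omega
      clear hx hy hz hw hd0 hd1 hp0 hp1 hb hb' hq hM h0 h0'
      refine ⟨?_, ?_, fun N₁ N₂ h1 h2 h3 h4 => ⟨?_, ?_⟩, fun N₁ N₂ h1 h2 h3 h4 => ⟨?_, ?_⟩⟩ <;>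
        grind (splits := 40)
    · simp only [cell, colEps, colPhi, tensorEps, tensorPhi, tensorLeftE, hb, h0, hp0, hp1, hq,
        one_ne_zero, if_false] at h₁ h₂ ⊢
      clear hx hy hz hw hd0 hd1 hp0 hp1 hb hb' hq hM hM' h0 h0'
      refine ⟨?_, ?_, fun N₁ N₂ h1 h2 h3 h4 => ⟨?_, ?_⟩, fun N₁ N₂ h1 h2 h3 h4 => ⟨?_, ?_⟩⟩ <;>
        grind (splits := 40)

theorem colEps_pos {i : Index m n} {d x y : ℕ} (h : 0 < colEps i d x y) : 0 < y := by
  have := colEps_colPhi_cases i d x y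
  omega

theorem psum_raise {i : ℕ} {c : ℕ → ℕ} (h : 0 < c (i + 1)) (k : ℕ) :
    psum (raise i c) k = if k = i + 1 then psum c k + 1 else psum c k := by
  have h1 : ∀ k ≤ i, psum (raise i c) k = psum c k := by
    intro k
    induction k with
    | zero => simp [psum]
    | succ k ih =>
      intro hk
      rw [psum, psum, ih (by omega), raise, if_neg (by omega), if_neg (by omega)]
  have h2 : psum (raise i c) (i + 1) = psum c (i + 1) + 1 := by
    rw [psum, psum, h1 i le_rfl, raise, if_pos rfl, add_assoc]
  have h3 : ∀ j, psum (raise i c) (i + 2 + j) = psum c (i + 2 + j) := by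
    intro j
    induction j with
    | zero =>
      rw [add_zero, psum, h2, raise, if_neg (by omega), if_pos rfl,
        show psum c (i + 2) = psum c (i + 1) + c (i + 1) from rfl]
      omega
    | succ j ih =>
      rw [← add_assoc, psum, psum, ih, raise, if_neg (by omega), if_neg (by omega)]
  split_ifs with hk
  · rw [hk, h2]
  · rcases Nat.lt_or_ge i k with h4 | h4
    · obtain ⟨j, rfl⟩ : ∃ j, k = i + 2 + j := ⟨k - (i + 2), by omega⟩
      exact h3 j
    · exact h1 k h4

theorem newSum_congr_le {m q K : ℕ} {s a s' a' : ℕ → ℕ} (hs : ∀ k ≤ K, s k = s' k)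
    (ha : ∀ k < K, a k = a' k) : ∀ k ≤ K, newSum m q s a k = newSum m q s' a' k := by
  intro k
  induction k with
  | zero => intro _; rfl
  | succ k ih =>
    intro hk
    rw [newSum, newSum, ih (by omega), hs k (by omega), hs (k + 1) hk, ha k hk]

theorem newSum_congr_ge {m q K : ℕ} {s a s' a' : ℕ → ℕ}
    (h : newSum m q s a K = newSum m q s' a' K) (hs : ∀ k, K ≤ k → s k = s' k)
    (ha : ∀ k, K ≤ k → a k = a' k) :
    ∀ k, K ≤ k → newSum m q s a k = newSum m q s' a' k := by
  intro k hk
  induction k, hk using Nat.le_induction with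
  | base => exact h
  | succ k hk ih => rw [newSum, newSum, ih, hs k hk, hs (k + 1) (by omega), ha k hk]

/-- Insertion preserves the total content, which changes by `raise`; so exactly one of the two
outputs is raised, and the partial sum at `i + 1` tells which. -/
theorem insCol_bumped_of_newSum {m q i : ℕ} {c a c' a' : ℕ → ℕ}
    (hy : 0 < a (i + 1) + c (i + 1)) (hle : ∀ k, insCol m q c a k ≤ a k + c k)
    (ht : ∀ k, a' k + c' k = raise i (fun k => a k + c k) k)
    (hS : ∀ k, k ≠ i + 1 → newSum m q (psum c') a' k = newSum m q (psum c) a k) :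
    (newSum m q (psum c') a' (i + 1) = newSum m q (psum c) a (i + 1) →
      insCol m q c' a' = insCol m q c a ∧
        (0 < bumped m q c a (i + 1) → bumped m q c' a' = raise i (bumped m q c a))) ∧
    (newSum m q (psum c') a' (i + 1) = newSum m q (psum c) a (i + 1) + 1 →
      0 < insCol m q c a (i + 1) →
      insCol m q c' a' = raise i (insCol m q c a) ∧ bumped m q c' a' = bumped m q c a) := by
  have hS0 := hS i (by omega)
  have hS2 := hS (i + 2) (by omega)
  have m0 := newSum_mono m q (psum c) a i
  have m1 : newSum m q (psum c) a (i + 1) ≤ newSum m q (psum c) a (i + 2) :=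
    (newSum_mono m q (psum c) a (i + 1)).1
  constructor
  · intro h
    have h1 : insCol m q c' a' = insCol m q c a := by
      funext k
      simp only [insCol]
      by_cases hk : k = i
      · subst hk; rw [h, hS0]
      by_cases hk1 : k = i + 1
      · subst hk1; rw [h, hS2]
      · rw [hS k hk1, hS (k + 1) (by omega)]
    refine ⟨h1, fun _ => ?_⟩
    funext k
    have := hle k
    simp only [bumped, h1, ht, raise]
    split_ifs <;> omega
  · intro h hpos
    have h1 : insCol m q c' a' = raise i (insCol m q c a) := by
      funext k
      simp only [insCol, raise]
      by_cases hk : k = i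
      · subst hk; rw [h, hS0, if_pos rfl]; omega
      rw [if_neg hk]
      by_cases hk1 : k = i + 1
      · subst hk1; rw [h, hS2, if_pos rfl, show i + 1 + 1 = i + 2 from rfl]; omega
      · rw [if_neg hk1, hS k hk1, hS (k + 1) (by omega)]
    refine ⟨h1, ?_⟩
    funext k
    have := hle k
    simp only [bumped, h1, ht, raise]
    split_ifs <;> first | omega | (subst_vars; omega)

/-- The new partial sums up to `i` do not see the action of `e_i`, and by `insert_tensor_aux` the
one at `i + 2` keeps its value, hence so do all later ones. The only freedom left is the partial sum
at `i + 1`. -/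
theorem insert_tensor (i : Index m n) {q : ℕ} {c a : ℕ → ℕ} (ha : ColValid m q a)
    (hc : ColValid m 1 c) :
    (tensorEps i (colEps i q (bumped m q c a i) (bumped m q c a (i + 1)))
      (colPhi i q (bumped m q c a i) (bumped m q c a (i + 1)))
      (colEps i 1 (insCol m q c a i) (insCol m q c a (i + 1)))
      (colPhi i 1 (insCol m q c a i) (insCol m q c a (i + 1))) =
      tensorEps i (colEps i 1 (c i) (c (i + 1))) (colPhi i 1 (c i) (c (i + 1)))
        (colEps i q (a i) (a (i + 1))) (colPhi i q (a i) (a (i + 1)))) ∧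
    (tensorPhi i (colEps i q (bumped m q c a i) (bumped m q c a (i + 1)))
      (colPhi i q (bumped m q c a i) (bumped m q c a (i + 1)))
      (colEps i 1 (insCol m q c a i) (insCol m q c a (i + 1)))
      (colPhi i 1 (insCol m q c a i) (insCol m q c a (i + 1))) =
      tensorPhi i (colEps i 1 (c i) (c (i + 1))) (colPhi i 1 (c i) (c (i + 1)))
        (colEps i q (a i) (a (i + 1))) (colPhi i q (a i) (a (i + 1)))) ∧
    ∀ c' a', PairE i 1 q c a c' a' →
      PairE i q 1 (bumped m q c a) (insCol m q c a) (bumped m q c' a') (insCol m q c' a') := by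
  have m0 := newSum_mono m q (psum c) a i
  have m1 : newSum m q (psum c) a (i + 1) ≤ newSum m q (psum c) a (i + 2) :=
    (newSum_mono m q (psum c) a (i + 1)).1
  have i0 := (insCol_spec ha hc i).1
  have i1 := (insCol_spec ha hc (i + 1)).1
  have e1 : newSum m q (psum c) a i + insCol m q c a i = newSum m q (psum c) a (i + 1) := by
    rw [insCol]; omega
  have e2 : newSum m q (psum c) a (i + 1) + insCol m q c a (i + 1) =
      newSum m q (psum c) a (i + 2) := by
    rw [insCol, show (i : ℕ) + 1 + 1 = i + 2 from rfl]; omega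
  have hci := hc i
  have hci1 := hc (i + 1)
  obtain ⟨t1, t2, t3, t4⟩ := insert_tensor_aux i (q := q) (L := psum c i)
    (M := newSum m q (psum c) a i)
    (x := c i) (y := c (i + 1)) (z := a i) (w := a (i + 1)) (x' := insCol m q c a i)
    (y' := insCol m q c a (i + 1)) (z' := bumped m q c a i) (w' := bumped m q c a (i + 1))
    (psum_le_newSum m q c a i) (fun hq => newSum_le hq ha hc i)
    (by omega) (by omega) (ha i) (ha (i + 1)) (by rw [e1]; rfl) (by rw [e1, e2]; rfl)
    (by rw [bumped]; omega) (by rw [bumped]; omega)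
  rw [e1, e2] at t3 t4
  refine ⟨t1, t2, ?_⟩
  rintro c' a' (⟨hL, hE, rfl, rfl⟩ | ⟨hL, hE, rfl, rfl⟩)
  · have hy := colEps_pos hE
    have p0 := psum_raise hy
    have s0 : ∀ k ≤ (i : ℕ), newSum m q (psum (raise i c)) a' k = newSum m q (psum c) a' k :=
      newSum_congr_le (fun k hk => by rw [p0, if_neg (by omega)]) (fun _ _ => rfl)
    obtain ⟨hN2, hN⟩ := t3 (newSum m q (psum (raise i c)) a' (i + 1))
      (newSum m q (psum (raise i c)) a' (i + 2)) hL hE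
      (by rw [newSum, s0 i le_rfl, p0, p0, if_neg (by omega), if_pos rfl]; rfl)
      (by rw [newSum, p0, p0, if_pos rfl, if_neg (by omega)]; rfl)
    have s2 := newSum_congr_ge hN2 (fun k hk => by rw [p0, if_neg (by omega)])
      (fun _ _ => rfl)
    have key := insCol_bumped_of_newSum (m := m) (q := q) (i := i) (c := c) (a := a')
      (c' := raise i c) (a' := a') (by omega) (fun k => (insCol_spec ha hc k).1)
      (fun k => by simp only [raise]; split_ifs <;> first | omega | (subst_vars; omega))
      (fun k hk => by
        rcases Nat.lt_or_ge i k with h | h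
        · exact s2 k (by omega)
        · exact s0 k h)
    rcases hN with ⟨h1, h2, h3⟩ | ⟨h1, h2, h3⟩
    · obtain ⟨k1, k2⟩ := key.1 h1
      exact Or.inl ⟨h2, h3, k2 (colEps_pos h3), k1⟩
    · obtain ⟨k1, k2⟩ := key.2 h1 (colEps_pos h3)
      exact Or.inr ⟨h2, h3, k2, k1⟩
  · have hy := colEps_pos hE
    have s0 : ∀ k ≤ (i : ℕ), newSum m q (psum c') (raise i a) k = newSum m q (psum c') a k :=
      newSum_congr_le (fun _ _ => rfl)
        (fun k hk => by rw [raise, if_neg (by omega), if_neg (by omega)])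
    obtain ⟨hN2, hN⟩ := t4 (newSum m q (psum c') (raise i a) (i + 1))
      (newSum m q (psum c') (raise i a) (i + 2)) hL hE
      (by rw [newSum, s0 i le_rfl, raise, if_pos rfl]; rfl)
      (by rw [newSum, raise, if_neg (by omega), if_pos rfl]; rfl)
    have s2 := newSum_congr_ge hN2 (fun _ _ => rfl)
      (fun k hk => by rw [raise, if_neg (by omega), if_neg (by omega)])
    have key := insCol_bumped_of_newSum (m := m) (q := q) (i := i) (c := c') (a := a)
      (c' := c') (a' := raise i a) (by omega) (fun k => (insCol_spec ha hc k).1)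
      (fun k => by simp only [raise]; split_ifs <;> first | omega | (subst_vars; omega))
      (fun k hk => by
        rcases Nat.lt_or_ge i k with h | h
        · exact s2 k (by omega)
        · exact s0 k h)
    rcases hN with ⟨h1, h2, h3⟩ | ⟨h1, h2, h3⟩
    · obtain ⟨k1, k2⟩ := key.1 h1
      exact Or.inl ⟨h2, h3, k2 (colEps_pos h3), k1⟩
    · obtain ⟨k1, k2⟩ := key.2 h1 (colEps_pos h3)
      exact Or.inr ⟨h2, h3, k2, k1⟩

/-! ### Sweeping a column through a sequence of columns -/

/-- The word of a sequence of columns with degrees. -/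
def colsWord (m n : ℕ) (L : List (ℕ × (ℕ → ℕ))) : List (Letter m n) :=
  L.flatMap fun c => colWord m n c.1 c.2

theorem colsWord_cons (c : ℕ × (ℕ → ℕ)) (L : List (ℕ × (ℕ → ℕ))) :
    colsWord m n (c :: L) = colWord m n c.1 c.2 ++ colsWord m n L := rfl

theorem colsWord_append (L L' : List (ℕ × (ℕ → ℕ))) :
    colsWord m n (L ++ L') = colsWord m n L ++ colsWord m n L' := List.flatMap_append

theorem wordEps_colsWord_cons (i : Index m n) (d : ℕ) (v : ℕ → ℕ) (L : List (ℕ × (ℕ → ℕ))) :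
    wordEps i (colsWord m n ((d, v) :: L)) = tensorEps i (colEps i d (v i) (v (i + 1)))
        (colPhi i d (v i) (v (i + 1))) (wordEps i (colsWord m n L)) (wordPhi i (colsWord m n L)) ∧
    wordPhi i (colsWord m n ((d, v) :: L)) = tensorPhi i (colEps i d (v i) (v (i + 1)))
        (colPhi i d (v i) (v (i + 1))) (wordEps i (colsWord m n L))
        (wordPhi i (colsWord m n L)) := by
  rw [colsWord_cons, (wordEps_append i _ _).1, (wordEps_append i _ _).2, (word_colWord i d v).1,
    (word_colWord i d v).2]
  exact ⟨rfl, rfl⟩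

/-- The operator `e_i` on sequences of columns. -/
def colsE (i : Index m n) : List (ℕ × (ℕ → ℕ)) → Option (List (ℕ × (ℕ → ℕ)))
  | [] => none
  | (d, v) :: L =>
    if tensorLeftE i (colEps i d (v i) (v (i + 1))) (colPhi i d (v i) (v (i + 1)))
        (wordEps i (colsWord m n L)) (wordPhi i (colsWord m n L)) then
      if 0 < colEps i d (v i) (v (i + 1)) then some ((d, raise i v) :: L) else none
    else (colsE i L).map ((d, v) :: ·)

/-- The operator `f_i` on sequences of columns. -/
def colsF (i : Index m n) : List (ℕ × (ℕ → ℕ)) → Option (List (ℕ × (ℕ → ℕ)))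
  | [] => none
  | (d, v) :: L =>
    if tensorLeftF i (colEps i d (v i) (v (i + 1))) (colPhi i d (v i) (v (i + 1)))
        (wordEps i (colsWord m n L)) (wordPhi i (colsWord m n L)) then
      if 0 < colPhi i d (v i) (v (i + 1)) then some ((d, lower i v) :: L) else none
    else (colsF i L).map ((d, v) :: ·)

/-- Unlike the plain word, a sequence of columns remembers which column each letter belongs to, as
the passage back to matrices requires. -/
theorem wordE_colsWord (i : Index m n) {L : List (ℕ × (ℕ → ℕ))}
    (hL : ∀ c ∈ L, ColValid m c.1 c.2) :
    wordE i (colsWord m n L) = (colsE i L).map (colsWord m n) := by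
  induction L with
  | nil => rfl
  | cons c L ih =>
    obtain ⟨d, v⟩ := c
    have hv : ColValid m d v := hL (d, v) List.mem_cons_self
    rw [colsWord_cons, wordE_append, (word_colWord i d v).1, (word_colWord i d v).2,
      wordE_colWord i hv, ih fun c hc => hL c (List.mem_cons_of_mem _ hc), colsE]
    split_ifs
    · rfl
    · rfl
    · simp [Function.comp_def, colsWord_cons]

theorem wordF_colsWord (i : Index m n) {L : List (ℕ × (ℕ → ℕ))}
    (hL : ∀ c ∈ L, ColValid m c.1 c.2) :
    wordF i (colsWord m n L) = (colsF i L).map (colsWord m n) := by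
  induction L with
  | nil => rfl
  | cons c L ih =>
    obtain ⟨d, v⟩ := c
    have hv : ColValid m d v := hL (d, v) List.mem_cons_self
    rw [colsWord_cons, wordF_append, (word_colWord i d v).1, (word_colWord i d v).2,
      wordF_colWord i hv, ih fun c hc => hL c (List.mem_cons_of_mem _ hc), colsF]
    split_ifs
    · rfl
    · rfl
    · simp [Function.comp_def, colsWord_cons]

theorem colsE_eq_set {i : Index m n} {L L' : List (ℕ × (ℕ → ℕ))} (h : colsE i L = some L') :
    ∃ (k d : ℕ) (v : ℕ → ℕ), L[k]? = some (d, v) ∧ 0 < colEps i d (v i) (v (i + 1)) ∧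
      L' = L.set k (d, raise i v) := by
  induction L generalizing L' with
  | nil => simp [colsE] at h
  | cons c L ih =>
    obtain ⟨d, v⟩ := c
    rw [colsE] at h
    split_ifs at h with h1 h2
    · obtain rfl := Option.some.inj h
      exact ⟨0, d, v, rfl, h2, rfl⟩
    · obtain ⟨L₁, hL₁, rfl⟩ := Option.map_eq_some_iff.1 h
      obtain ⟨k, d', v', h3, h4, rfl⟩ := ih hL₁
      exact ⟨k + 1, d', v', h3, h4, rfl⟩

theorem colsF_eq_set {i : Index m n} {L L' : List (ℕ × (ℕ → ℕ))} (h : colsF i L = some L') :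
    ∃ (k d : ℕ) (v : ℕ → ℕ), L[k]? = some (d, v) ∧ 0 < colPhi i d (v i) (v (i + 1)) ∧
      L' = L.set k (d, lower i v) := by
  induction L generalizing L' with
  | nil => simp [colsF] at h
  | cons c L ih =>
    obtain ⟨d, v⟩ := c
    rw [colsF] at h
    split_ifs at h with h1 h2
    · obtain rfl := Option.some.inj h
      exact ⟨0, d, v, rfl, h2, rfl⟩
    · obtain ⟨L₁, hL₁, rfl⟩ := Option.map_eq_some_iff.1 h
      obtain ⟨k, d', v', h3, h4, rfl⟩ := ih hL₁
      exact ⟨k + 1, d', v', h3, h4, rfl⟩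

/-- Insert a sequence of columns into a column `c`; the last entry is the resulting column. -/
def sweep (m : ℕ) : (ℕ → ℕ) → List (ℕ × (ℕ → ℕ)) → List (ℕ × (ℕ → ℕ))
  | c, [] => [(1, c)]
  | c, (q, a) :: L => (q, bumped m q c a) :: sweep m (insCol m q c a) L

theorem wordEps_sweep (i : Index m n) {c : ℕ → ℕ} (hc : ColValid m 1 c)
    {L : List (ℕ × (ℕ → ℕ))} (hL : ∀ c ∈ L, ColValid m c.1 c.2) :
    wordEps i (colsWord m n (sweep m c L)) = wordEps i (colsWord m n ((1, c) :: L)) ∧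
      wordPhi i (colsWord m n (sweep m c L)) = wordPhi i (colsWord m n ((1, c) :: L)) := by
  induction L generalizing c with
  | nil => exact ⟨rfl, rfl⟩
  | cons x L ih =>
    obtain ⟨q, a⟩ := x
    have ha : ColValid m q a := hL (q, a) List.mem_cons_self
    obtain ⟨h1, h2⟩ := ih (ha.insCol hc) fun c hc => hL c (List.mem_cons_of_mem _ hc)
    obtain ⟨h3, h4, -⟩ := insert_tensor i ha hc
    have h5 : ∀ d v d' v', wordEps i (colWord m n d v ++ colWord m n d' v') = tensorEps i
        (colEps i d (v i) (v (i + 1))) (colPhi i d (v i) (v (i + 1)))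
        (colEps i d' (v' i) (v' (i + 1))) (colPhi i d' (v' i) (v' (i + 1))) ∧
        wordPhi i (colWord m n d v ++ colWord m n d' v') = tensorPhi i
        (colEps i d (v i) (v (i + 1))) (colPhi i d (v i) (v (i + 1)))
        (colEps i d' (v' i) (v' (i + 1))) (colPhi i d' (v' i) (v' (i + 1))) := by
      intro d v d' v'
      rw [(wordEps_append i _ _).1, (wordEps_append i _ _).2, (word_colWord i d v).1,
        (word_colWord i d v).2, (word_colWord i d' v').1, (word_colWord i d' v').2]
      exact ⟨rfl, rfl⟩
    rw [← (h5 _ _ _ _).1, ← (h5 _ _ _ _).1] at h3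
    rw [← (h5 _ _ _ _).2, ← (h5 _ _ _ _).2] at h4
    rw [sweep, colsWord_cons, colsWord_cons, colsWord_cons, (wordEps_append i _ _).1,
      (wordEps_append i _ _).2, h1, h2, ← (wordEps_append i _ _).1, ← (wordEps_append i _ _).2,
      colsWord_cons]
    simp only [← List.append_assoc]
    rw [(wordEps_append i _ (colsWord m n L)).1, (wordEps_append i _ (colsWord m n L)).2,
      (wordEps_append i _ (colsWord m n L)).1, (wordEps_append i _ (colsWord m n L)).2, h3, h4]
    exact ⟨rfl, rfl⟩

/-- The factor of a triple product on which `e_i` acts does not depend on the bracketing; the two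
parts treat the first and the middle factor. -/
theorem tensorLeftE_assoc (i : Index m n) (e₁ p₁ e₂ p₂ e₃ p₃ : ℕ) :
    (tensorLeftE i e₁ p₁ (tensorEps i e₂ p₂ e₃ p₃) (tensorPhi i e₂ p₂ e₃ p₃) ↔
      tensorLeftE i (tensorEps i e₁ p₁ e₂ p₂) (tensorPhi i e₁ p₁ e₂ p₂) e₃ p₃ ∧
        tensorLeftE i e₁ p₁ e₂ p₂) ∧
    (¬ tensorLeftE i e₁ p₁ (tensorEps i e₂ p₂ e₃ p₃) (tensorPhi i e₂ p₂ e₃ p₃) ∧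
        tensorLeftE i e₂ p₂ e₃ p₃ ↔
      tensorLeftE i (tensorEps i e₁ p₁ e₂ p₂) (tensorPhi i e₁ p₁ e₂ p₂) e₃ p₃ ∧
        ¬ tensorLeftE i e₁ p₁ e₂ p₂) := by
  unfold tensorLeftE tensorEps tensorPhi
  split_ifs <;> omega

/-- A sweep is a succession of exchanges `c ⊗ a ↦ bumped ⊗ insCol`. If `e_i` acts within the first
two columns, `insert_tensor` describes the first exchange; if it acts further right, that exchange
is unaffected. The induction hypothesis applies whenever the action has to be carried to the right
of the first exchange. -/
theorem colsE_sweep {i : Index m n} {c c' : ℕ → ℕ} (hc : ColValid m 1 c)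
    {L L' : List (ℕ × (ℕ → ℕ))} (hL : ∀ c ∈ L, ColValid m c.1 c.2)
    (h : colsE i ((1, c) :: L) = some ((1, c') :: L')) :
    colsE i (sweep m c L) = some (sweep m c' L') := by
  induction L generalizing c c' L' with
  | nil =>
    have : L' = [] := by
      rw [colsE] at h
      split_ifs at h
      · simp_all
      · simp [colsE] at h
    subst this
    exact h
  | cons x L ih =>
    obtain ⟨q, a⟩ := x
    have ha : ColValid m q a := hL (q, a) List.mem_cons_self
    have hL' : ∀ c ∈ L, ColValid m c.1 c.2 := fun c hc => hL c (List.mem_cons_of_mem _ hc)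
    obtain ⟨t1, t2, t3⟩ := insert_tensor i ha hc
    obtain ⟨s1, s2⟩ := wordEps_sweep i (ha.insCol hc) hL'
    have ih' := fun c' L' => ih (c' := c') (L' := L') (ha.insCol hc) hL'
    obtain ⟨r1, r2⟩ := tensorLeftE_assoc i (colEps i 1 (c i) (c (i + 1)))
      (colPhi i 1 (c i) (c (i + 1))) (colEps i q (a i) (a (i + 1))) (colPhi i q (a i) (a (i + 1)))
      (wordEps i (colsWord m n L)) (wordPhi i (colsWord m n L))
    obtain ⟨r3, r4⟩ := tensorLeftE_assoc i
      (colEps i q (bumped m q c a i) (bumped m q c a (i + 1)))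
      (colPhi i q (bumped m q c a i) (bumped m q c a (i + 1)))
      (colEps i 1 (insCol m q c a i) (insCol m q c a (i + 1)))
      (colPhi i 1 (insCol m q c a i) (insCol m q c a (i + 1)))
      (wordEps i (colsWord m n L)) (wordPhi i (colsWord m n L))
    rw [t1, t2] at r3 r4
    rw [colsE, colsE, (wordEps_colsWord_cons i q a L).1, (wordEps_colsWord_cons i q a L).2] at h
    rw [sweep, colsE, s1, s2, (wordEps_colsWord_cons i _ _ L).1, (wordEps_colsWord_cons i _ _ L).2]
    have ihc := fun c' L' (hh : _ = some _) => ih' c' L' (by rw [colsE]; exact hh)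
    -- The case of an action within `c ⊗ a`, treated once for both positions; `a'` is the second
    -- column afterwards.
    have pair : ∀ a', tensorLeftE i (tensorEps i (colEps i 1 (c i) (c (i + 1)))
        (colPhi i 1 (c i) (c (i + 1))) (colEps i q (a i) (a (i + 1)))
        (colPhi i q (a i) (a (i + 1)))) (tensorPhi i (colEps i 1 (c i) (c (i + 1)))
        (colPhi i 1 (c i) (c (i + 1))) (colEps i q (a i) (a (i + 1)))
        (colPhi i q (a i) (a (i + 1)))) (wordEps i (colsWord m n L)) (wordPhi i (colsWord m n L)) →
        PairE i 1 q c a c' a' → L' = (q, a') :: L →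
        (if tensorLeftE i (colEps i q (bumped m q c a i) (bumped m q c a (i + 1)))
            (colPhi i q (bumped m q c a i) (bumped m q c a (i + 1)))
            (tensorEps i (colEps i 1 (insCol m q c a i) (insCol m q c a (i + 1)))
              (colPhi i 1 (insCol m q c a i) (insCol m q c a (i + 1)))
              (wordEps i (colsWord m n L)) (wordPhi i (colsWord m n L)))
            (tensorPhi i (colEps i 1 (insCol m q c a i) (insCol m q c a (i + 1)))
              (colPhi i 1 (insCol m q c a i) (insCol m q c a (i + 1)))
              (wordEps i (colsWord m n L)) (wordPhi i (colsWord m n L))) then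
          if 0 < colEps i q (bumped m q c a i) (bumped m q c a (i + 1)) then
            some ((q, raise i (bumped m q c a)) :: sweep m (insCol m q c a) L)
          else none
        else (colsE i (sweep m (insCol m q c a) L)).map ((q, bumped m q c a) :: ·)) =
        some (sweep m c' L') := by
      rintro a' hl hp rfl
      rcases t3 _ _ hp with ⟨h1, h2, h3, h4⟩ | ⟨h1, h2, h3, h4⟩
      · rw [if_pos (r3.2 ⟨hl, h1⟩), if_pos h2, sweep, h3, h4]
      · obtain ⟨h5, h6⟩ := r4.2 ⟨hl, h1⟩
        rw [if_neg h5, ihc (raise i (insCol m q c a)) L (by rw [if_pos h6, if_pos h2]), sweep, h3,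
          h4]
        rfl
    split_ifs at h with h1 h2 h3 h4
    · obtain ⟨h5, h6⟩ := r1.1 h1
      simp only [Option.some.injEq, List.cons.injEq, Prod.mk.injEq, true_and] at h
      exact pair a h5 (Or.inl ⟨h6, h2, h.1.symm, rfl⟩) h.2.symm
    · obtain ⟨h5, h6⟩ := r2.1 ⟨h1, h3⟩
      simp only [Option.map_some, Option.some.injEq, List.cons.injEq, Prod.mk.injEq,
        true_and] at h
      exact pair _ h5 (Or.inr ⟨h6, h4, h.1.symm, rfl⟩) h.2.symm
    · simp at h
    · obtain ⟨L₁, hL₁, h5⟩ := Option.map_eq_some_iff.1 h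
      obtain ⟨L₂, hL₂, rfl⟩ := Option.map_eq_some_iff.1 hL₁
      simp only [List.cons.injEq, Prod.mk.injEq, true_and] at h5
      obtain ⟨rfl, rfl⟩ := h5
      -- The action takes place to the right of `c ⊗ a`, and therefore also to the right of `bumped
      -- ⊗ insCol`, which has the same `ε_i` and `φ_i`.
      have h6 : ¬ tensorLeftE i (tensorEps i (colEps i 1 (c i) (c (i + 1)))
          (colPhi i 1 (c i) (c (i + 1))) (colEps i q (a i) (a (i + 1)))
          (colPhi i q (a i) (a (i + 1)))) (tensorPhi i (colEps i 1 (c i) (c (i + 1)))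
          (colPhi i 1 (c i) (c (i + 1))) (colEps i q (a i) (a (i + 1)))
          (colPhi i q (a i) (a (i + 1)))) (wordEps i (colsWord m n L))
          (wordPhi i (colsWord m n L)) := by
        intro h6
        by_cases h7 : tensorLeftE i (colEps i 1 (c i) (c (i + 1))) (colPhi i 1 (c i) (c (i + 1)))
          (colEps i q (a i) (a (i + 1))) (colPhi i q (a i) (a (i + 1)))
        · exact h1 (r1.2 ⟨h6, h7⟩)
        · exact h3 (r2.2 ⟨h6, h7⟩).2
      have h7 := fun h => h6 (r3.1 h).1
      have h8 := fun h => h6 (r4.1 ⟨h7, h⟩).1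
      rw [if_neg h7, ihc (insCol m q c a) L₂ (by rw [if_neg h8, hL₂]; rfl), sweep]
      rfl

/-! ### The last passage table and the residual matrix -/

/-- The column obtained from the empty one by inserting the first `j` columns of `A`. -/
def colState (m : ℕ) (A : ℕ → ℕ → ℕ) : ℕ → ℕ → ℕ
  | 0 => fun _ => 0
  | j + 1 => insCol m (dg m j) (colState m A j) fun b => A b j

/-- The last passage table: the length of a longest chain in the first `b` rows and the first `j`
columns of `A`. -/
def lpp (m : ℕ) (A : ℕ → ℕ → ℕ) (b j : ℕ) : ℕ := psum (colState m A j) b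

/-- The matrix of the bumped letters. -/
def resid (m : ℕ) (A : ℕ → ℕ → ℕ) (b j : ℕ) : ℕ :=
  bumped m (dg m j) (colState m A j) (fun b => A b j) b

/-- The matrices in `𝐌`, extended by zero. -/
structure InM (m n : ℕ) (A : ℕ → ℕ → ℕ) : Prop where
  valid : ∀ j, ColValid m (dg m j) fun b => A b j
  row : ∀ b j, m + n ≤ b → A b j = 0
  col : ∀ b j, m + n ≤ j → A b j = 0

theorem lpp_zero_left (m : ℕ) (A : ℕ → ℕ → ℕ) (j : ℕ) : lpp m A 0 j = 0 := rfl

theorem psum_zero (b : ℕ) : psum (fun _ => 0) b = 0 := by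
  induction b with
  | zero => rfl
  | succ b ih => rw [psum, ih]

theorem lpp_zero_right (m : ℕ) (A : ℕ → ℕ → ℕ) (b : ℕ) : lpp m A b 0 = 0 := psum_zero b

theorem lpp_col_succ (m : ℕ) (A : ℕ → ℕ → ℕ) (b j : ℕ) :
    lpp m A b (j + 1) = newSum m (dg m j) (psum (colState m A j)) (fun b => A b j) b := by
  rw [lpp, colState, psum_insCol]

theorem lpp_succ (m : ℕ) (A : ℕ → ℕ → ℕ) (b j : ℕ) :
    lpp m A (b + 1) (j + 1) = cell (dg m b) (dg m j) (lpp m A b j) (lpp m A b (j + 1))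
      (lpp m A (b + 1) j) (A b j) := by
  rw [lpp_col_succ, lpp_col_succ, newSum]
  rfl

/-- Both sides vanish on the boundary and satisfy the same recursion, by `cell_swap`. -/
theorem lpp_transpose (m : ℕ) (A : ℕ → ℕ → ℕ) (b j : ℕ) :
    lpp m (fun x y => A y x) b j = lpp m A j b := by
  induction b generalizing j with
  | zero => rw [lpp_zero_left, lpp_zero_right]
  | succ b ih =>
    induction j with
    | zero => rw [lpp_zero_left, lpp_zero_right]
    | succ j ih' => rw [lpp_succ, lpp_succ, ih, ih, ih', cell_swap]

theorem InM.colState {A : ℕ → ℕ → ℕ} (hA : InM m n A) (j : ℕ) : ColValid m 1 (colState m A j) := by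
  induction j with
  | zero => exact fun b => by simp [GLCrystal.colState]
  | succ j ih => exact (hA.valid j).insCol ih

/-- Collects what is needed at one cell: the table grows in both directions, by at most one across a
row or column of degree 0. The last identity writes `resid`, defined column by column, as `A` minus
a mixed second difference of the table, which treats rows and columns alike. -/
theorem InM.cell_spec {A : ℕ → ℕ → ℕ} (hA : InM m n A) (b j : ℕ) :
    lpp m A b j ≤ lpp m A b (j + 1) ∧ lpp m A b j ≤ lpp m A (b + 1) j ∧
    lpp m A b (j + 1) ≤ lpp m A (b + 1) (j + 1) ∧ lpp m A (b + 1) j ≤ lpp m A (b + 1) (j + 1) ∧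
    (b < m → lpp m A (b + 1) j ≤ lpp m A b j + 1) ∧
    (b < m → lpp m A (b + 1) (j + 1) ≤ lpp m A b (j + 1) + 1) ∧
    (j < m → lpp m A b (j + 1) ≤ lpp m A b j + 1) ∧
    (j < m → lpp m A (b + 1) (j + 1) ≤ lpp m A (b + 1) j + 1) ∧
    resid m A b j + lpp m A (b + 1) (j + 1) + lpp m A b j =
      A b j + lpp m A b (j + 1) + lpp m A (b + 1) j := by
  have hc := hA.colState j
  have hc' := hA.colState (j + 1)
  have h1 : ∀ b j, lpp m A (b + 1) j = lpp m A b j + GLCrystal.colState m A j b := fun b j => rfl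
  have h2 := lpp_col_succ m A b j
  have h3 := lpp_col_succ m A (b + 1) j
  have h4 := psum_le_newSum m (dg m j) (GLCrystal.colState m A j) (fun b => A b j) b
  have h5 := psum_le_newSum m (dg m j) (GLCrystal.colState m A j) (fun b => A b j) (b + 1)
  have h6 := fun hq => newSum_le (q := dg m j) hq (hA.valid j) hc b
  have h7 := fun hq => newSum_le (q := dg m j) hq (hA.valid j) hc (b + 1)
  rw [← h2] at h4 h6
  rw [← h3] at h5 h7
  change lpp m A b j ≤ _ at h4
  change lpp m A (b + 1) j ≤ _ at h5
  change _ → _ ≤ lpp m A b j + 1 at h6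
  change _ → _ ≤ lpp m A (b + 1) j + 1 at h7
  have h8 := (insCol_spec (hA.valid j) hc b).1
  have h9 : resid m A b j = A b j + GLCrystal.colState m A j b -
    GLCrystal.colState m A (j + 1) b := rfl
  change GLCrystal.colState m A (j + 1) b ≤ _ at h8
  have h10 := h1 b j
  have h11 := h1 b (j + 1)
  have h12 := dg_cases m j
  have h13 := hc b
  have h14 := hc' b
  omega

theorem InM.transpose {A : ℕ → ℕ → ℕ} (hA : InM m n A) : InM m n fun b j => A j b where
  valid j b := by
    have h1 := hA.valid b j
    have h2 := dg_cases m b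
    have h3 := dg_cases m j
    dsimp only at h1 ⊢
    omega
  row b j h := hA.col j b h
  col b j h := hA.row j b h

theorem resid_transpose {A : ℕ → ℕ → ℕ} (hA : InM m n A) :
    resid m (fun b j => A j b) = fun b j => resid m A j b := by
  funext b j
  have h1 := hA.transpose.cell_spec b j
  have h2 := hA.cell_spec j b
  simp only [lpp_transpose] at h1
  omega

theorem newSum_zero (m q : ℕ) (c : ℕ → ℕ) : newSum m q (psum c) (fun _ => 0) = psum c := by
  funext b
  induction b with
  | zero => rfl
  | succ b ih =>
    rw [newSum, ih]
    have := cell_cases (dg m b) q (psum c b) (psum c b) (psum c (b + 1)) 0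
    have : psum c (b + 1) = psum c b + c b := rfl
    omega

theorem InM.resid {A : ℕ → ℕ → ℕ} (hA : InM m n A) : InM m n (resid m A) where
  valid j := (hA.valid j).bumped (hA.colState j)
  row b j h := by
    have h1 : ∀ j, GLCrystal.colState m A j b = 0 := by
      intro j
      induction j with
      | zero => rfl
      | succ j ih =>
        have := (insCol_spec (hA.valid j) (hA.colState j) b).1
        have h2 := hA.row b j h
        rw [GLCrystal.colState]
        omega
    have h2 := hA.row b j h
    have h3 := h1 j
    rw [GLCrystal.resid, GLCrystal.bumped]
    omega
  col b j h := by
    have h1 : (fun b => A b j) = fun _ => 0 := funext fun b => hA.col b j h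
    rw [GLCrystal.resid, h1, GLCrystal.bumped, GLCrystal.insCol, newSum_zero]
    have : psum (GLCrystal.colState m A j) (b + 1) =
      psum (GLCrystal.colState m A j) b + GLCrystal.colState m A j b := rfl
    omega

theorem InM.iterate {A : ℕ → ℕ → ℕ} (hA : InM m n A) (t : ℕ) :
    InM m n ((GLCrystal.resid m)^[t] A) := by
  induction t generalizing A with
  | zero => exact hA
  | succ t ih => exact ih hA.resid

theorem iterate_resid_transpose {A : ℕ → ℕ → ℕ} (hA : InM m n A) (t : ℕ) :
    (resid m)^[t] (fun b j => A j b) = fun b j => (resid m)^[t] A j b := by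
  induction t generalizing A with
  | zero => rfl
  | succ t ih => rw [Function.iterate_succ_apply, resid_transpose hA, ih hA.resid]; rfl

theorem lpp_mono {A : ℕ → ℕ → ℕ} (hA : InM m n A) {b b' j j' : ℕ} (hb : b ≤ b') (hj : j ≤ j') :
    lpp m A b j ≤ lpp m A b' j' := by
  have h1 : lpp m A b j ≤ lpp m A b' j := by
    induction b', hb using Nat.le_induction with
    | base => exact le_rfl
    | succ k _ ih => exact ih.trans (hA.cell_spec k j).2.1
  refine h1.trans ?_
  induction j', hj using Nat.le_induction with
  | base => exact le_rfl
  | succ k _ ih => exact ih.trans (hA.cell_spec b' k).1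

/-- The sum of the entries in the first `N` rows and columns. -/
def total (N : ℕ) (A : ℕ → ℕ → ℕ) : ℕ := ∑ j ∈ Finset.range N, ∑ b ∈ Finset.range N, A b j

/-- The mixed second differences telescope to the value of the table at the corner. -/
theorem total_resid {A : ℕ → ℕ → ℕ} (hA : InM m n A) (N : ℕ) :
    total N (resid m A) + lpp m A N N = total N A := by
  have h : ∀ j b, ∑ x ∈ Finset.range b, resid m A x j + lpp m A b (j + 1) =
      ∑ x ∈ Finset.range b, A x j + lpp m A b j := by
    intro j b
    induction b with
    | zero => simp [lpp_zero_left]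
    | succ b ih =>
      rw [Finset.sum_range_succ, Finset.sum_range_succ]
      have := hA.cell_spec b j
      omega
  have h2 : ∀ k, ∑ j ∈ Finset.range k, ∑ b ∈ Finset.range N, resid m A b j + lpp m A N k =
      ∑ j ∈ Finset.range k, ∑ b ∈ Finset.range N, A b j := by
    intro k
    induction k with
    | zero => simp [lpp_zero_right]
    | succ k ih =>
      rw [Finset.sum_range_succ, Finset.sum_range_succ]
      have := h k N
      omega
  exact h2 N

/-- A nonzero entry makes the table positive at its cell, hence at the corner by monotonicity. With
`total_resid`, the total of a nonzero matrix drops strictly, so the residual matrices reach zero. -/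
theorem InM.eq_zero_of_lpp {A : ℕ → ℕ → ℕ} (hA : InM m n A) (h : lpp m A (m + n) (m + n) = 0) :
    A = fun _ _ => 0 := by
  funext b j
  by_cases hb : m + n ≤ b
  · exact hA.row b j hb
  by_cases hj : m + n ≤ j
  · exact hA.col b j hj
  have h1 := lpp_mono hA (show b + 1 ≤ m + n by omega) (show j + 1 ≤ m + n by omega)
  have h2 := lpp_succ m A b j
  have h3 := cell_cases (dg m b) (dg m j) (lpp m A b j) (lpp m A b (j + 1)) (lpp m A (b + 1) j)
    (A b j)
  omega

theorem InM.iterate_eq_zero {A : ℕ → ℕ → ℕ} (hA : InM m n A) {K : ℕ} (hK : total (m + n) A ≤ K) :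
    (GLCrystal.resid m)^[K] A = fun _ _ => 0 := by
  induction K generalizing A with
  | zero =>
    apply hA.eq_zero_of_lpp
    have := total_resid hA (m + n)
    omega
  | succ K ih =>
    rw [Function.iterate_succ_apply]
    by_cases h0 : lpp m A (m + n) (m + n) = 0
    · have h1 : total (m + n) A = 0 := by
        rw [hA.eq_zero_of_lpp h0]; simp [total]
      have := total_resid hA (m + n)
      exact ih hA.resid (by omega)
    · have := total_resid hA (m + n)
      exact ih hA.resid (by omega)

/-! ### Row operators: effect on the insertion and the recording tableau -/

/-- The columns `j, …, j + k - 1` of `A`. -/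
def cols (m : ℕ) (A : ℕ → ℕ → ℕ) (j k : ℕ) : List (ℕ × (ℕ → ℕ)) :=
  (List.range' j k).map fun j => (dg m j, fun b => A b j)

theorem length_cols (m : ℕ) (A : ℕ → ℕ → ℕ) (j k : ℕ) : (cols m A j k).length = k := by
  simp [cols]

theorem cols_succ (m : ℕ) (A : ℕ → ℕ → ℕ) (j k : ℕ) :
    cols m A j (k + 1) = (dg m j, fun b => A b j) :: cols m A (j + 1) k := by
  simp [cols, List.range'_succ]

theorem cols_append (m : ℕ) (A : ℕ → ℕ → ℕ) (j k l : ℕ) :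
    cols m A j (k + l) = cols m A j k ++ cols m A (j + k) l := by
  rw [cols, cols, cols, ← List.map_append, List.range'_append_1]

theorem InM.cols_valid {A : ℕ → ℕ → ℕ} (hA : InM m n A) (j k : ℕ) :
    ∀ c ∈ cols m A j k, ColValid m c.1 c.2 := by
  intro c hc
  obtain ⟨j, -, rfl⟩ := List.mem_map.1 hc
  exact hA.valid j

/-- Identifies the column-by-column construction of `resid` and `colState` with a sweep, so that
`colsE_sweep` applies to matrices. -/
theorem sweep_cols (m : ℕ) (A : ℕ → ℕ → ℕ) (j k : ℕ) :
    sweep m (colState m A j) (cols m A j k) =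
      cols m (resid m A) j k ++ [(1, colState m A (j + k))] := by
  induction k generalizing j with
  | zero => rfl
  | succ k ih =>
    have := ih (j + 1)
    rw [cols_succ, cols_succ, sweep]
    rw [colState, add_right_comm] at this
    rw [this]
    rfl

theorem cols_eq_iff {A B : ℕ → ℕ → ℕ} {j k : ℕ} :
    cols m A j k = cols m B j k ↔ ∀ x, j ≤ x → x < j + k → ∀ b, A b x = B b x := by
  rw [cols, cols, List.map_inj_left]
  simp only [List.mem_range'_1, Prod.mk.injEq, true_and, funext_iff]
  grind

theorem InM.eq_of_cols {A B : ℕ → ℕ → ℕ} (hA : InM m n A) (hB : InM m n B)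
    (h : cols m A 0 (m + n) = cols m B 0 (m + n)) : A = B := by
  funext b j
  by_cases hj : m + n ≤ j
  · rw [hA.col b j hj, hB.col b j hj]
  · exact cols_eq_iff.1 h j (Nat.zero_le _) (by omega) b

theorem colState_congr {A B : ℕ → ℕ → ℕ} {j : ℕ} (h : cols m A 0 j = cols m B 0 j) :
    colState m A j = colState m B j := by
  induction j with
  | zero => rfl
  | succ j ih =>
    rw [cols_eq_iff] at h
    rw [colState, colState, ih (cols_eq_iff.2 fun x h1 h2 => h x h1 (by omega))]
    congr 1
    funext b
    exact h j (Nat.zero_le _) (by omega) b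

theorem colEps_zero (i : Index m n) (d : ℕ) : colEps i d 0 0 = 0 ∧ colPhi i d 0 0 = 0 := by
  have := colEps_colPhi_cases i d 0 0
  omega

theorem wordEps_zero_cons (i : Index m n) (L : List (ℕ × (ℕ → ℕ))) :
    wordEps i (colsWord m n ((1, fun _ => 0) :: L)) = wordEps i (colsWord m n L) ∧
    wordPhi i (colsWord m n ((1, fun _ => 0) :: L)) = wordPhi i (colsWord m n L) := by
  have : colWord m n 1 (fun _ => 0) = [] := by simp [colWord]
  rw [colsWord_cons, this]
  exact ⟨rfl, rfl⟩

theorem wordEps_pos_of_colsE {i : Index m n} {L L' : List (ℕ × (ℕ → ℕ))}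
    (hL : ∀ c ∈ L, ColValid m c.1 c.2) (h : colsE i L = some L') :
    0 < wordEps i (colsWord m n L) := by
  have h1 := wordE_colsWord i hL
  have h2 := wordE_eq_none_iff i (colsWord m n L)
  rw [h] at h1
  rw [h1] at h2
  simp at h2
  omega

theorem colsE_zero_cons {i : Index m n} {L L' : List (ℕ × (ℕ → ℕ))}
    (hL : ∀ c ∈ L, ColValid m c.1 c.2) (h : colsE i L = some L') :
    colsE i ((1, fun _ => 0) :: L) = some ((1, fun _ => 0) :: L') := by
  have h1 := wordEps_pos_of_colsE hL h
  have h2 := colEps_zero i 1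
  rw [colsE, if_neg, h]
  · rfl
  · rw [h2.1, h2.2]
    unfold tensorLeftE
    split_ifs <;> omega

theorem colsE_append (i : Index m n) {L₁ L₂ : List (ℕ × (ℕ → ℕ))}
    (h₁ : ∀ c ∈ L₁, ColValid m c.1 c.2) (h₂ : ∀ c ∈ L₂, ColValid m c.1 c.2) :
    colsE i (L₁ ++ L₂) =
      if tensorLeftE i (wordEps i (colsWord m n L₁)) (wordPhi i (colsWord m n L₁))
        (wordEps i (colsWord m n L₂)) (wordPhi i (colsWord m n L₂)) then
        (colsE i L₁).map (· ++ L₂)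
      else (colsE i L₂).map (L₁ ++ ·) := by
  induction L₁ with
  | nil =>
    have h3 := wordE_colsWord i h₂
    have h4 := wordE_eq_none_iff i (colsWord m n L₂)
    rw [h3, Option.map_eq_none_iff] at h4
    simp only [List.nil_append, colsE, colsWord, List.flatMap_nil, wordEps, wordPhi]
    split_ifs with h5
    · unfold tensorLeftE at h5
      have : wordEps i (colsWord m n L₂) = 0 := by
        rw [colsWord]
        split_ifs at h5 <;> omega
      simpa using h4.2 this
    · simp
  | cons x L₁ ih =>
    obtain ⟨d, v⟩ := x
    obtain ⟨r1, r2⟩ := tensorLeftE_assoc i (colEps i d (v i) (v (i + 1)))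
      (colPhi i d (v i) (v (i + 1))) (wordEps i (colsWord m n L₁)) (wordPhi i (colsWord m n L₁))
      (wordEps i (colsWord m n L₂)) (wordPhi i (colsWord m n L₂))
    rw [List.cons_append, colsE, colsE, ih fun c hc => h₁ c (List.mem_cons_of_mem _ hc),
      (wordEps_colsWord_cons i _ _ L₁).1, (wordEps_colsWord_cons i _ _ L₁).2, colsWord_append,
      (wordEps_append i _ _).1, (wordEps_append i _ _).2]
    clear ih h₁ h₂
    split_ifs <;> first | (exfalso; simp_all; done) | simp [Function.comp_def]

/-- `e_i` sends the row word of `A` to the row word of `B`. -/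
def RowE (i : Index m n) (A B : ℕ → ℕ → ℕ) : Prop :=
  colsE i (cols m A 0 (m + n)) = some (cols m B 0 (m + n))

theorem colsE_resid {i : Index m n} {A B : ℕ → ℕ → ℕ} (hA : InM m n A) {j : ℕ}
    (h : colsE i (cols m A 0 j) = some (cols m B 0 j)) :
    colsE i (cols m (resid m A) 0 j ++ [(1, colState m A j)]) =
      some (cols m (resid m B) 0 j ++ [(1, colState m B j)]) := by
  have h1 := colsE_sweep (hA.colState 0) (hA.cols_valid 0 j)
    (colsE_zero_cons (hA.cols_valid 0 j) h)
  rw [sweep_cols, zero_add] at h1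
  have h2 := sweep_cols m B 0 j
  rw [zero_add] at h2
  rw [h1]
  exact congrArg some h2

theorem wordEps_resid (i : Index m n) {A : ℕ → ℕ → ℕ} (hA : InM m n A) (j : ℕ) :
    wordEps i (colsWord m n (cols m (resid m A) 0 j ++ [(1, colState m A j)])) =
      wordEps i (colsWord m n (cols m A 0 j)) ∧
    wordPhi i (colsWord m n (cols m (resid m A) 0 j ++ [(1, colState m A j)])) =
      wordPhi i (colsWord m n (cols m A 0 j)) := by
  have h1 := wordEps_sweep i (hA.colState 0) (hA.cols_valid 0 j)
  rw [sweep_cols, zero_add] at h1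
  have h2 := wordEps_zero_cons i (cols m A 0 j)
  exact ⟨h1.1.trans h2.1, h1.2.trans h2.2⟩

theorem colsE_singleton {i : Index m n} {d : ℕ} {v : ℕ → ℕ} {L : List (ℕ × (ℕ → ℕ))}
    (h : colsE i [(d, v)] = some L) :
    0 < colEps i d (v i) (v (i + 1)) ∧ L = [(d, raise i v)] := by
  rw [colsE] at h
  split_ifs at h with h1 h2
  · exact ⟨h2, (Option.some.inj h).symm⟩
  · simp [colsE] at h

theorem psum_raise_top {i : Index m n} {d : ℕ} {v : ℕ → ℕ}
    (h : 0 < colEps i d (v i) (v (i + 1))) : psum (raise i v) (m + n) = psum v (m + n) := by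
  have := i.2
  rw [psum_raise (colEps_pos h), if_neg (by omega)]

theorem colsE_snoc {i : Index m n} {L L' : List (ℕ × (ℕ → ℕ))} {c c' : ℕ → ℕ}
    (hL : ∀ c ∈ L, ColValid m c.1 c.2) (hc : ColValid m 1 c)
    (h : colsE i (L ++ [(1, c)]) = some (L' ++ [(1, c')])) :
    (tensorLeftE i (wordEps i (colsWord m n L)) (wordPhi i (colsWord m n L))
      (wordEps i (colsWord m n [(1, c)])) (wordPhi i (colsWord m n [(1, c)])) ∧
        colsE i L = some L' ∧ c' = c) ∨
    (¬ tensorLeftE i (wordEps i (colsWord m n L)) (wordPhi i (colsWord m n L))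
      (wordEps i (colsWord m n [(1, c)])) (wordPhi i (colsWord m n [(1, c)])) ∧
        colsE i [(1, c)] = some [(1, c')] ∧ 0 < colEps i 1 (c i) (c (i + 1)) ∧
        c' = raise i c ∧ L' = L) := by
  rw [colsE_append i hL (by simpa using hc)] at h
  split_ifs at h with h1
  · obtain ⟨L₁, h2, h3⟩ := Option.map_eq_some_iff.1 h
    obtain ⟨rfl, h4⟩ := List.append_inj' h3 rfl
    simp only [List.cons.injEq, Prod.mk.injEq, true_and, and_true] at h4
    exact Or.inl ⟨h1, h2, h4.symm⟩
  · obtain ⟨L₁, h2, h3⟩ := Option.map_eq_some_iff.1 h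
    obtain ⟨h4, rfl⟩ := colsE_singleton h2
    obtain ⟨rfl, h5⟩ := List.append_inj' h3 rfl
    simp only [List.cons.injEq, Prod.mk.injEq, true_and, and_true] at h5
    exact Or.inr ⟨h1, h5 ▸ h2, h4, h5.symm, rfl⟩

/-- After the sweep, `e_i` acts either on the residual columns, leaving the tableau column alone, or
on the tableau column, where it exchanges a letter and keeps the length. -/
theorem lpp_top_of_colsE {i : Index m n} {A B : ℕ → ℕ → ℕ} (hA : InM m n A) {j : ℕ}
    (h : colsE i (cols m A 0 j) = some (cols m B 0 j)) :
    lpp m B (m + n) j = lpp m A (m + n) j := by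
  rcases colsE_snoc (hA.resid.cols_valid 0 j) (hA.colState j) (colsE_resid hA h) with
    ⟨-, -, h1⟩ | ⟨-, -, h1, h2, -⟩
  · rw [lpp, lpp, h1]
  · rw [lpp, lpp, h2, psum_raise_top h1]

/-- The first column of the recording tableau is invariant: for each `j`, either `e_i` acts within
the first `j` columns or it does not touch them. -/
theorem RowE.lpp_top {i : Index m n} {A B : ℕ → ℕ → ℕ} (hA : InM m n A) (h : RowE i A B) {j : ℕ}
    (hj : j ≤ m + n) : lpp m B (m + n) j = lpp m A (m + n) j := by
  obtain ⟨k, hk⟩ := Nat.exists_eq_add_of_le hj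
  rw [RowE, hk, cols_append, cols_append,
    colsE_append i (hA.cols_valid _ _) (hA.cols_valid _ _)] at h
  split_ifs at h
  · obtain ⟨L₁, h2, h3⟩ := Option.map_eq_some_iff.1 h
    obtain ⟨rfl, h4⟩ := List.append_inj' h3 (by simp [length_cols])
    exact lpp_top_of_colsE hA h2
  · obtain ⟨L₁, h2, h3⟩ := Option.map_eq_some_iff.1 h
    obtain ⟨h3, -⟩ := List.append_inj h3 (by simp [length_cols])
    rw [lpp, lpp, colState_congr h3]

/-- The columns of the tableau of `A`, from right to left, if `A` is exhausted after `K` steps. -/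
def tabCols (m N : ℕ) : ℕ → (ℕ → ℕ → ℕ) → List (ℕ × (ℕ → ℕ))
  | 0, _ => []
  | K + 1, A => tabCols m N K (resid m A) ++ [(1, colState m A N)]

theorem InM.tabCols_valid {A : ℕ → ℕ → ℕ} (hA : InM m n A) (N K : ℕ) :
    ∀ c ∈ tabCols m N K A, ColValid m c.1 c.2 := by
  induction K generalizing A with
  | zero => simp [tabCols]
  | succ K ih =>
    intro c hc
    rw [tabCols, List.mem_append, List.mem_singleton] at hc
    rcases hc with hc | rfl
    · exact ih hA.resid c hc
    · exact hA.colState N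

theorem wordEps_tabCols (i : Index m n) {A : ℕ → ℕ → ℕ} (hA : InM m n A) (K : ℕ) :
    wordEps i (colsWord m n (cols m ((resid m)^[K] A) 0 (m + n) ++ tabCols m (m + n) K A)) =
      wordEps i (colsWord m n (cols m A 0 (m + n))) ∧
    wordPhi i (colsWord m n (cols m ((resid m)^[K] A) 0 (m + n) ++ tabCols m (m + n) K A)) =
      wordPhi i (colsWord m n (cols m A 0 (m + n))) := by
  induction K generalizing A with
  | zero => simp [tabCols]
  | succ K ih =>
    obtain ⟨h1, h2⟩ := wordEps_resid i hA (m + n)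
    obtain ⟨h3, h4⟩ := ih hA.resid
    rw [Function.iterate_succ_apply, tabCols, ← List.append_assoc, colsWord_append,
      (wordEps_append i _ _).1, (wordEps_append i _ _).2, h3, h4, ← (wordEps_append i _ _).1,
      ← (wordEps_append i _ _).2, ← colsWord_append]
    exact ⟨h1, h2⟩

/-- Repeated sweeps commute with `e_i`. Once `K` exhausts both matrices, this says that `e_i` on the
row word is `e_i` on the tableau. -/
theorem RowE.tabCols {i : Index m n} {A B : ℕ → ℕ → ℕ} (hA : InM m n A) (hB : InM m n B)
    (h : RowE i A B) (K : ℕ) :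
    colsE i (cols m ((resid m)^[K] A) 0 (m + n) ++ tabCols m (m + n) K A) =
      some (cols m ((resid m)^[K] B) 0 (m + n) ++ GLCrystal.tabCols m (m + n) K B) := by
  induction K generalizing A B with
  | zero => simpa [GLCrystal.tabCols, RowE] using h
  | succ K ih =>
    obtain ⟨h3, h4⟩ := wordEps_tabCols i hA.resid K
    have hv : ∀ c ∈ cols m ((resid m)^[K] (resid m A)) 0 (m + n) ++
        GLCrystal.tabCols m (m + n) K (resid m A), ColValid m c.1 c.2 := by
      intro c hc
      rcases List.mem_append.1 hc with hc | hc
      · exact (hA.resid.iterate K).cols_valid _ _ c hc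
      · exact hA.resid.tabCols_valid _ _ c hc
    have hc : ∀ c ∈ [(1, colState m A (m + n))], ColValid m c.1 c.2 := by
      simpa using hA.colState (m + n)
    rw [Function.iterate_succ_apply, Function.iterate_succ_apply, GLCrystal.tabCols,
      GLCrystal.tabCols, ← List.append_assoc, ← List.append_assoc, colsE_append i hv hc, h3, h4]
    -- Further sweeps preserve `ε_i` and `φ_i` of the residual part, so they do not affect the
    -- choice made by the tensor product rule. If it selects the tableau column, the residual
    -- matrices of `A` and `B` coincide.
    rcases colsE_snoc (hA.resid.cols_valid 0 _) (hA.colState _) (colsE_resid hA h) with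
      ⟨h1, h2, h5⟩ | ⟨h1, h2, -, -, h5⟩
    · rw [if_pos h1, ih hA.resid hB.resid h2, h5]
      rfl
    · rw [if_neg h1, h2, hA.resid.eq_of_cols hB.resid h5.symm]
      rfl

/-- The residual matrix is either moved by `e_i` or left fixed, so the invariance passes to every
column of the recording tableau. -/
theorem RowE.lpp_top_iterate {i : Index m n} {A B : ℕ → ℕ → ℕ} (hA : InM m n A)
    (hB : InM m n B) (h : RowE i A B) (t : ℕ) {j : ℕ} (hj : j ≤ m + n) :
    lpp m ((resid m)^[t] B) (m + n) j = lpp m ((resid m)^[t] A) (m + n) j := by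
  induction t generalizing A B with
  | zero => exact h.lpp_top hA hj
  | succ t ih =>
    rw [Function.iterate_succ_apply, Function.iterate_succ_apply]
    rcases colsE_snoc (hA.resid.cols_valid 0 _) (hA.colState _) (colsE_resid hA h) with
      ⟨-, h2, -⟩ | ⟨-, -, -, -, h5⟩
    · exact ih hA.resid hB.resid h2
    · rw [hA.resid.eq_of_cols hB.resid h5.symm]

/-! ### Inverting the correspondence -/

/-- Compares consecutive tableau columns: the first bound is weak increase along rows, the second
strict increase for the letters of degree 1. The third is the transposed form of the second, proved
in the same double induction. -/
theorem lpp_resid_le {A : ℕ → ℕ → ℕ} (hA : InM m n A) (b j : ℕ) :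
    lpp m (resid m A) b j ≤ lpp m A b j ∧
    (m + 1 ≤ b → lpp m (resid m A) b j ≤ lpp m A (b - 1) j) ∧
    (m + 1 ≤ j → lpp m (resid m A) b j ≤ lpp m A b (j - 1)) := by
  induction b generalizing j with
  | zero => simp [lpp_zero_left]
  | succ b ih =>
    induction j with
    | zero => simp [lpp_zero_right]
    | succ j ih' =>
      have h1 := ih j
      have h2 := ih (j + 1)
      have c1 := hA.cell_spec b j
      have c2 := lpp_succ m A b j
      have c3 := lpp_succ m (resid m A) b j
      have c4 := cell_cases (dg m b) (dg m j) (lpp m A b j) (lpp m A b (j + 1))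
        (lpp m A (b + 1) j) (A b j)
      have c5 := cell_cases (dg m b) (dg m j) (lpp m (resid m A) b j)
        (lpp m (resid m A) b (j + 1)) (lpp m (resid m A) (b + 1) j) (resid m A b j)
      have d1 := dg_cases m b
      have d2 := dg_cases m j
      have v := hA.valid j b
      simp only [Nat.add_sub_cancel] at *
      rw [← c2] at c4
      rw [← c3] at c5
      clear c2 c3 ih
      rcases d1 with ⟨d1, d1'⟩ | ⟨d1, d1'⟩ <;> rcases d2 with ⟨d2, d2'⟩ | ⟨d2, d2'⟩ <;>
        simp only [d1', d2', one_ne_zero, ne_eq, not_true_eq_false, not_false_eq_true, true_and,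
          false_and, or_false, false_or, and_false] at c4 c5 v <;> grind

/-- The local rule is reversible: the residual entry retains what the maximum in `cell` forgets. -/
theorem cell_inj {m n : ℕ} {A B : ℕ → ℕ → ℕ} (hA : InM m n A) (hB : InM m n B) {b j : ℕ}
    (h1 : lpp m A (b + 1) (j + 1) = lpp m B (b + 1) (j + 1))
    (h2 : lpp m A b (j + 1) = lpp m B b (j + 1)) (h3 : lpp m A (b + 1) j = lpp m B (b + 1) j)
    (h4 : resid m A b j = resid m B b j) :
    lpp m A b j = lpp m B b j ∧ A b j = B b j := by
  have a1 := hA.cell_spec b j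
  have a2 := lpp_succ m A b j
  have a3 := cell_cases (dg m b) (dg m j) (lpp m A b j) (lpp m A b (j + 1))
    (lpp m A (b + 1) j) (A b j)
  have a4 := hA.valid j b
  have b1 := hB.cell_spec b j
  have b2 := lpp_succ m B b j
  have b3 := cell_cases (dg m b) (dg m j) (lpp m B b j) (lpp m B b (j + 1))
    (lpp m B (b + 1) j) (B b j)
  have b4 := hB.valid j b
  dsimp only at a4 b4
  rw [← a2] at a3
  rw [← b2] at b3
  clear a2 b2
  rcases dg_cases m b with ⟨d1, d1'⟩ | ⟨d1, d1'⟩ <;>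
    rcases dg_cases m j with ⟨d2, d2'⟩ | ⟨d2, d2'⟩ <;>
    simp only [d1', d2', one_ne_zero, ne_eq, not_true_eq_false, not_false_eq_true, true_and,
      false_and, or_false, false_or, and_false] at a3 b3 a4 b4 <;> grind

/-- The table is recovered from its last row and column by descending induction on both coordinates,
one cell at a time. -/
theorem resid_inj {A B : ℕ → ℕ → ℕ} (hA : InM m n A) (hB : InM m n B)
    (hR : resid m A = resid m B) (hp : ∀ b ≤ m + n, lpp m A b (m + n) = lpp m B b (m + n))
    (hq : ∀ j ≤ m + n, lpp m A (m + n) j = lpp m B (m + n) j) : A = B := by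
  have key : ∀ x b, b + x = m + n → ∀ y j, j + y = m + n → lpp m A b j = lpp m B b j := by
    intro x
    induction x with
    | zero =>
      intro b hb y j hj
      obtain rfl : b = m + n := hb
      exact hq j (by omega)
    | succ x ih =>
      intro b hb y
      induction y with
      | zero =>
        intro j hj
        obtain rfl : j = m + n := hj
        exact hp b (by omega)
      | succ y ih' =>
        intro j hj
        exact (cell_inj hA hB (ih (b + 1) (by omega) y (j + 1) (by omega))
          (ih' (j + 1) (by omega)) (ih (b + 1) (by omega) (y + 1) j hj)
          (congrFun (congrFun hR b) j)).1
  have key' : ∀ b j, b ≤ m + n → j ≤ m + n → lpp m A b j = lpp m B b j := fun b j hb hj =>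
    key (m + n - b) b (by omega) (m + n - j) j (by omega)
  funext b j
  by_cases hb : m + n ≤ b
  · rw [hA.row b j hb, hB.row b j hb]
  by_cases hj : m + n ≤ j
  · rw [hA.col b j hj, hB.col b j hj]
  exact (cell_inj hA hB (key' _ _ (by omega) (by omega)) (key' _ _ (by omega) (by omega))
    (key' _ _ (by omega) (by omega)) (congrFun (congrFun hR b) j)).2

theorem eq_of_lpp_iterate {A B : ℕ → ℕ → ℕ} (hA : InM m n A) (hB : InM m n B)
    (hp : ∀ t, ∀ b ≤ m + n,
      lpp m ((resid m)^[t] A) b (m + n) = lpp m ((resid m)^[t] B) b (m + n))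
    (hq : ∀ t, ∀ j ≤ m + n,
      lpp m ((resid m)^[t] A) (m + n) j = lpp m ((resid m)^[t] B) (m + n) j) : A = B := by
  have key : ∀ (K : ℕ) {A B : ℕ → ℕ → ℕ}, InM m n A → InM m n B →
      (∀ t, ∀ b ≤ m + n,
        lpp m ((resid m)^[t] A) b (m + n) = lpp m ((resid m)^[t] B) b (m + n)) →
      (∀ t, ∀ j ≤ m + n,
        lpp m ((resid m)^[t] A) (m + n) j = lpp m ((resid m)^[t] B) (m + n) j) →
      (resid m)^[K] A = (resid m)^[K] B → A = B := by
    intro K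
    induction K with
    | zero => exact fun _ _ _ _ h => h
    | succ K ih =>
      intro A B hA hB hp hq h
      exact resid_inj hA hB (ih hA.resid hB.resid (fun t => hp (t + 1)) (fun t => hq (t + 1)) h)
        (hp 0) (hq 0)
  refine key (max (total (m + n) A) (total (m + n) B)) hA hB hp hq ?_
  rw [hA.iterate_eq_zero (le_max_left _ _), hB.iterate_eq_zero (le_max_right _ _)]

/-- The inverse of the local rule. -/
def invCell (p q ρ μ ν a : ℕ) : ℕ :=
  if p = 0 then
    if q = 0 then if μ = ν ∧ ρ = μ ∧ a ≠ 0 then μ - 1 else min μ ν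
    else if a ≠ 0 then ν - 1 else min μ ν
  else if q = 0 then if a ≠ 0 then μ - 1 else min μ ν
  else min μ ν - a

/-- The last passage table with given values at the last row and column and given residual
matrix, in coordinates that count from the end. -/
def invTable (m N : ℕ) (R : ℕ → ℕ → ℕ) (p q : ℕ → ℕ) : ℕ → ℕ → ℕ
  | 0, y => q (N - y)
  | x + 1, 0 => p (N - (x + 1))
  | x + 1, y + 1 => invCell (dg m (N - (x + 1))) (dg m (N - (y + 1))) (invTable m N R p q x y)
      (invTable m N R p q (x + 1) y) (invTable m N R p q x (y + 1))
      (R (N - (x + 1)) (N - (y + 1)))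

/-- The step of the backward reconstruction; the index `₂` marks the table of the residual matrix.
Interlacing with that table justifies each subtraction in `invCell`, and the bounds are reproduced
at the new corner so that the reconstruction can continue. -/
theorem invCell_spec {b j m ρ μ ν a ρ₂ μ₂ ν₂ lam₂ : ℕ} (h₁ : μ ≤ ρ) (h₂ : ν ≤ ρ)
    (h₃ : b < m → ρ ≤ μ + 1) (h₄ : j < m → ρ ≤ ν + 1)
    (ha : (b < m ∧ dg m j = 0) ∨ (m ≤ b ∧ dg m j ≠ 0) ∨ a ≤ 1)
    (hρ : ρ₂ = cell (dg m b) (dg m j) lam₂ μ₂ ν₂ a) (hlam : lam₂ ≤ μ₂)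
    (hρρ : ρ₂ ≤ ρ) (hμ : μ₂ ≤ μ) (hν : ν₂ ≤ ν) (hb : m ≤ b → ρ₂ ≤ μ) (hj : m ≤ j → ρ₂ ≤ ν)
    (hlam' : lam₂ ≤ ν₂) :
    let lam := invCell (dg m b) (dg m j) ρ μ ν a
    let x := a + ρ + lam - μ - ν
    lam ≤ μ ∧ lam ≤ ν ∧ (b < m → ν ≤ lam + 1) ∧ (j < m → μ ≤ lam + 1) ∧ lam₂ ≤ lam ∧
      (m ≤ b → ν₂ ≤ lam) ∧ (m ≤ j → μ₂ ≤ lam) ∧ μ + ν ≤ a + ρ + lam ∧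
      ((b < m ∧ dg m j = 0) ∨ (m ≤ b ∧ dg m j ≠ 0) ∨ x ≤ 1) ∧
      ρ = cell (dg m b) (dg m j) lam μ ν x := by
  intro lam x
  have hx : x = a + ρ + lam - μ - ν := rfl
  have hl : lam = invCell (dg m b) (dg m j) ρ μ ν a := rfl
  clear_value x lam
  rcases dg_cases m b with ⟨d1, d1'⟩ | ⟨d1, d1'⟩ <;>
    rcases dg_cases m j with ⟨d2, d2'⟩ | ⟨d2, d2'⟩ <;>
    simp only [cell, invCell, d1', d2', one_ne_zero, if_true, if_false] at * <;>
    grind (splits := 40)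

/-- The conditions on a row of partial sums `p` of a last passage table whose residual matrix
has the partial sums `p'`. -/
structure Fits (m : ℕ) (p p' : ℕ → ℕ) : Prop where
  zero : p 0 = 0
  mono : ∀ b, p b ≤ p (b + 1)
  step : ∀ b, b < m → p (b + 1) ≤ p b + 1
  desc : ∀ b, p' b ≤ p b
  hook : ∀ b, m ≤ b → p' (b + 1) ≤ p b

theorem invTable_step (m N : ℕ) (R : ℕ → ℕ → ℕ) (p q : ℕ → ℕ) {b j : ℕ} (hb : b < N)
    (hj : j < N) :
    invTable m N R p q (N - b) (N - j) = invCell (dg m b) (dg m j)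
      (invTable m N R p q (N - (b + 1)) (N - (j + 1)))
      (invTable m N R p q (N - b) (N - (j + 1)))
      (invTable m N R p q (N - (b + 1)) (N - j)) (R b j) := by
  obtain ⟨x, rfl⟩ : ∃ x, N = b + (x + 1) := ⟨N - b - 1, by omega⟩
  obtain ⟨y, hy⟩ : ∃ y, b + (x + 1) - j = y + 1 := ⟨b + (x + 1) - j - 1, by omega⟩
  rw [show b + (x + 1) - b = x + 1 by omega, hy, invTable]
  rw [show b + (x + 1) - (x + 1) = b by omega, show b + (x + 1) - (y + 1) = j by omega,
    show b + (x + 1) - (j + 1) = y by omega, show b + (x + 1) - (b + 1) = x by omega]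

/-- Given the residual matrix and the two boundary lines, the table is rebuilt from the far corner
and `A` is read off from its second differences. The conditions `Fits` are the boundary cases of the
bounds carried by `invCell_spec`. -/
theorem exists_resid_eq {R : ℕ → ℕ → ℕ} (hR : InM m n R) {p q : ℕ → ℕ}
    (hp : Fits m p fun b => lpp m R b (m + n)) (hq : Fits m q fun j => lpp m R (m + n) j)
    (hpq : p (m + n) = q (m + n)) :
    ∃ A, InM m n A ∧ resid m A = R ∧ (∀ b ≤ m + n, lpp m A b (m + n) = p b) ∧
      ∀ j ≤ m + n, lpp m A (m + n) j = q j := by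
  set N := m + n with hN
  set G : ℕ → ℕ → ℕ := fun b j => invTable m N R p q (N - b) (N - j) with hG
  have G1 : ∀ j ≤ N, G N j = q j := by
    intro j hj
    simp only [hG, Nat.sub_self, invTable]
    rw [show N - (N - j) = j by omega]
  have G2 : ∀ b ≤ N, G b N = p b := by
    intro b hb
    rcases hb.eq_or_lt with rfl | hb
    · rw [G1 _ le_rfl, hpq]
    · obtain ⟨x, hx⟩ : ∃ x, N - b = x + 1 := ⟨N - b - 1, by omega⟩
      simp only [hG, Nat.sub_self, hx, invTable]
      rw [show N - (x + 1) = b by omega]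
  have G3 : ∀ b j, b < N → j < N → G b j = invCell (dg m b) (dg m j) (G (b + 1) (j + 1))
      (G b (j + 1)) (G (b + 1) j) (R b j) := fun b j hb hj => invTable_step m N R p q hb hj
  clear_value G
  have key : ∀ x b, b + x = N → ∀ y j, j + y = N →
      (b < N → G b j ≤ G (b + 1) j ∧ (b < m → G (b + 1) j ≤ G b j + 1) ∧
        (m ≤ b → lpp m R (b + 1) j ≤ G b j)) ∧
      (j < N → G b j ≤ G b (j + 1) ∧ (j < m → G b (j + 1) ≤ G b j + 1) ∧
        (m ≤ j → lpp m R b (j + 1) ≤ G b j)) ∧ lpp m R b j ≤ G b j ∧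
      (b < N → j < N →
        G b (j + 1) + G (b + 1) j ≤ R b j + G (b + 1) (j + 1) + G b j ∧
        ((b < m ∧ dg m j = 0) ∨ (m ≤ b ∧ dg m j ≠ 0) ∨
          R b j + G (b + 1) (j + 1) + G b j - G b (j + 1) - G (b + 1) j ≤ 1) ∧
        G (b + 1) (j + 1) = cell (dg m b) (dg m j) (G b j) (G b (j + 1)) (G (b + 1) j)
          (R b j + G (b + 1) (j + 1) + G b j - G b (j + 1) - G (b + 1) j)) := by
    intro x
    induction x with
    | zero =>
      intro b hb y j hj
      obtain rfl : b = N := hb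
      have h1 := G1 j (by omega)
      have h2 := hq.desc j
      refine ⟨fun h => by omega, fun h => ?_, by rw [h1]; exact h2, fun h => by omega⟩
      rw [h1, G1 (j + 1) (by omega)]
      exact ⟨hq.mono j, hq.step j, hq.hook j⟩
    | succ x ih =>
      intro b hb y
      induction y with
      | zero =>
        intro j hj
        obtain rfl : j = N := hj
        have h1 := G2 b (by omega)
        have h2 := hp.desc b
        refine ⟨fun h => ?_, fun h => by omega, by rw [h1]; exact h2, fun _ h => by omega⟩
        rw [h1, G2 (b + 1) (by omega)]
        exact ⟨hp.mono b, hp.step b, hp.hook b⟩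
      | succ y ih' =>
        intro j hj
        obtain ⟨v1, -, v3, -⟩ := ih' (j + 1) (by omega)
        obtain ⟨-, w2, w3, -⟩ := ih (b + 1) (by omega) (y + 1) j hj
        obtain ⟨-, -, u3, -⟩ := ih (b + 1) (by omega) y (j + 1) (by omega)
        obtain ⟨v4, v5, v6⟩ := v1 (by omega)
        obtain ⟨w4, w5, w6⟩ := w2 (by omega)
        have hc := hR.cell_spec b j
        have := invCell_spec v4 w4 v5 w5 (hR.valid j b) (lpp_succ m R b j) hc.1 u3 v3 w3 v6 w6
          hc.2.1
        dsimp only at this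
        rw [← G3 b j (by omega) (by omega)] at this
        obtain ⟨t1, t2, t3, t4, t5, t6, t7, t8, t9, t10⟩ := this
        exact ⟨fun _ => ⟨t2, t3, t6⟩, fun _ => ⟨t1, t4, t7⟩, t5, fun _ _ => ⟨t8, t9, t10⟩⟩
  have key' := fun b j (hb : b ≤ N) (hj : j ≤ N) => key (N - b) b (by omega) (N - j) j (by omega)
  clear key
  -- The row 0 is nondecreasing and ends at `p 0 = 0`, so it vanishes; the column 0 vanishes
  -- likewise.
  have z1 : ∀ j ≤ N, G 0 j = 0 := by
    have : ∀ y j, j + y = N → G 0 j = 0 := by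
      intro y
      induction y with
      | zero =>
        intro j hj
        obtain rfl : j = N := hj
        rw [G2 0 (by omega), hp.zero]
      | succ y ih =>
        intro j hj
        have h1 := ((key' 0 j (by omega) (by omega)).2.1 (by omega)).1
        have h2 := ih (j + 1) (by omega)
        omega
    exact fun j hj => this (N - j) j (by omega)
  have z2 : ∀ b ≤ N, G b 0 = 0 := by
    have : ∀ x b, b + x = N → G b 0 = 0 := by
      intro x
      induction x with
      | zero =>
        intro b hb
        obtain rfl : b = N := hb
        rw [G1 0 (by omega), hq.zero]
      | succ x ih =>
        intro b hb
        have h1 := ((key' b 0 (by omega) (by omega)).1 (by omega)).1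
        have h2 := ih (b + 1) (by omega)
        omega
    exact fun b hb => this (N - b) b (by omega)
  set A : ℕ → ℕ → ℕ := fun b j => if b < N ∧ j < N then
    R b j + G (b + 1) (j + 1) + G b j - G b (j + 1) - G (b + 1) j else 0 with hA
  have A1 : ∀ b j, b < N → j < N →
      A b j = R b j + G (b + 1) (j + 1) + G b j - G b (j + 1) - G (b + 1) j :=
    fun b j hb hj => if_pos ⟨hb, hj⟩
  have A2 : ∀ b j, ¬ (b < N ∧ j < N) → A b j = 0 := fun b j h => if_neg h
  clear_value A
  have hM : InM m n A := by
    refine ⟨fun j b => ?_, fun b j h => A2 b j (by omega), fun b j h => A2 b j (by omega)⟩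
    dsimp only
    by_cases h : b < N ∧ j < N
    · rw [A1 b j h.1 h.2]
      exact ((key' b j h.1.le h.2.le).2.2.2 h.1 h.2).2.1
    · rw [A2 b j h]
      exact Or.inr (Or.inr zero_le_one)
  -- The table of `A` and `G` have zero boundaries and satisfy the same forward recursion.
  have hl : ∀ b j, b ≤ N → j ≤ N → lpp m A b j = G b j := by
    intro b
    induction b with
    | zero => intro j _ hj; rw [lpp_zero_left, z1 j hj]
    | succ b ih =>
      intro j
      induction j with
      | zero => intro hb _; rw [lpp_zero_right, z2 _ hb]
      | succ j ih' =>
        intro hb hj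
        rw [lpp_succ, ih j (by omega) (by omega), ih (j + 1) (by omega) hj, ih' hb (by omega),
          A1 b j hb hj]
        exact (((key' b j (by omega) (by omega)).2.2.2 hb hj).2.2).symm
  refine ⟨A, hM, ?_, fun b hb => by rw [hl b N hb le_rfl, G2 b hb],
    fun j hj => by rw [hl N j le_rfl hj, G1 j hj]⟩
  funext b j
  by_cases h : b < N ∧ j < N
  · have h1 := (hM.cell_spec b j).2.2.2.2.2.2.2.2
    have h2 := ((key' b j h.1.le h.2.le).2.2.2 h.1 h.2).1
    rw [hl _ _ (by omega) (by omega), hl _ _ (by omega) (by omega), hl _ _ (by omega) (by omega),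
      hl _ _ (by omega) (by omega), A1 b j h.1 h.2] at h1
    omega
  · rcases not_and_or.1 h with h | h
    · rw [hM.resid.row b j (by omega), hR.row b j (by omega)]
    · rw [hM.resid.col b j (by omega), hR.col b j (by omega)]

theorem InM.zero : InM m n fun _ _ => 0 :=
  ⟨fun _ _ => Or.inr (Or.inr zero_le_one), fun _ _ _ => rfl, fun _ _ _ => rfl⟩

theorem lpp_zero (b j : ℕ) : lpp m (fun _ _ => 0) b j = 0 := by
  induction b generalizing j with
  | zero => exact lpp_zero_left _ _ _
  | succ b ih =>
    induction j with
    | zero => exact lpp_zero_right _ _ _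
    | succ j ih' =>
      have := cell_cases (dg m b) (dg m j) 0 0 0 0
      rw [lpp_succ, ih, ih, ih']
      omega

theorem iterate_resid_zero (t : ℕ) : (resid m)^[t] (fun _ _ => 0) = fun _ _ => 0 := by
  apply Function.iterate_fixed
  funext b j
  have := ((InM.zero (m := m) (n := 0)).cell_spec b j).2.2.2.2.2.2.2.2
  simp only [lpp_zero] at this
  omega

theorem InM.colState_eq_zero {A : ℕ → ℕ → ℕ} (hA : InM m n A) (j : ℕ) {b : ℕ} (hb : m + n ≤ b) :
    GLCrystal.colState m A j b = 0 := by
  induction j with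
  | zero => rfl
  | succ j ih =>
    have h1 := hA.row b j hb
    have h2 := (insCol_spec (hA.valid j) (hA.colState j) b).1
    rw [GLCrystal.colState]
    omega

theorem InM.lpp_const_left {A : ℕ → ℕ → ℕ} (hA : InM m n A) (j b : ℕ) (hb : m + n ≤ b) :
    lpp m A b j = lpp m A (m + n) j := by
  induction b, hb using Nat.le_induction with
  | base => rfl
  | succ k hk ih =>
    rw [← ih, lpp, lpp, psum, hA.colState_eq_zero j hk, add_zero]

theorem InM.lpp_const_right {A : ℕ → ℕ → ℕ} (hA : InM m n A) (b j : ℕ) (hj : m + n ≤ j) :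
    lpp m A b j = lpp m A b (m + n) := by
  have h := hA.transpose.lpp_const_left b j hj
  rw [lpp_transpose] at h
  exact h.trans (lpp_transpose m A (m + n) b)

theorem exists_lpp_iterate_eq (K : ℕ) (P Q : ℕ → ℕ → ℕ) (hP : ∀ t, Fits m (P t) (P (t + 1)))
    (hQ : ∀ t, Fits m (Q t) (Q (t + 1))) (hPK : ∀ t b, K ≤ t → P t b = 0)
    (hQK : ∀ t b, K ≤ t → Q t b = 0) (hPQ : ∀ t, P t (m + n) = Q t (m + n)) :
    ∃ A, InM m n A ∧ (∀ t, ∀ b ≤ m + n, lpp m ((resid m)^[t] A) b (m + n) = P t b) ∧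
      ∀ t, ∀ j ≤ m + n, lpp m ((resid m)^[t] A) (m + n) j = Q t j := by
  induction K generalizing P Q with
  | zero =>
    refine ⟨_, InM.zero, fun t b _ => ?_, fun t j _ => ?_⟩
    · rw [iterate_resid_zero, lpp_zero, hPK t b (Nat.zero_le _)]
    · rw [iterate_resid_zero, lpp_zero, hQK t j (Nat.zero_le _)]
  | succ K ih =>
    obtain ⟨R, hR, hRP, hRQ⟩ := ih (fun t => P (t + 1)) (fun t => Q (t + 1))
      (fun t => hP (t + 1)) (fun t => hQ (t + 1)) (fun t b h => hPK _ b (by omega))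
      (fun t b h => hQK _ b (by omega)) (fun t => hPQ _)
    -- `Fits` concerns all `b`, but the induction hypothesis gives values only for `b ≤ m + n`;
    -- beyond that the table is constant.
    have ext_row : ∀ (p p' : ℕ → ℕ) (l : ℕ → ℕ), Fits m p p' → (∀ b ≤ m + n, l b = p' b) →
        (∀ b, m + n ≤ b → l b = l (m + n)) → Fits m p l := by
      intro p p' l h h1 h2
      have hm : ∀ b, m + n ≤ b → p (m + n) ≤ p b := fun b hb =>
        monotone_nat_of_le_succ h.mono hb
      refine ⟨h.zero, h.mono, h.step, fun b => ?_, fun b hb => ?_⟩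
      · rcases le_total b (m + n) with hb | hb
        · rw [h1 b hb]; exact h.desc b
        · rw [h2 b hb, h1 _ le_rfl]; exact (h.desc _).trans (hm b hb)
      · rcases le_or_gt (m + n) b with hb' | hb'
        · rw [h2 (b + 1) (by omega), h1 _ le_rfl]; exact (h.desc _).trans (hm b hb')
        · rw [h1 (b + 1) hb']; exact h.hook b hb
    have hc1 := hR.lpp_const_left (m + n)
    have hc2 := hR.lpp_const_right (m + n)
    obtain ⟨A, hA, hAR, hAp, hAq⟩ := exists_resid_eq hR (ext_row _ _ _ (hP 0) (hRP 0) hc1)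
      (ext_row _ _ _ (hQ 0) (hRQ 0) hc2) (hPQ 0)
    refine ⟨A, hA, fun t b hb => ?_, fun t j hj => ?_⟩
    · cases t with
      | zero => exact hAp b hb
      | succ t => rw [Function.iterate_succ_apply, hAR]; exact hRP t b hb
    · cases t with
      | zero => exact hAq j hj
      | succ t => rw [Function.iterate_succ_apply, hAR]; exact hRQ t j hj

/-! ### Symmetric matrices and the statistic of the diagonal -/

/-- The symmetric matrices in `𝐌`, extended by zero. -/
structure InS (m n : ℕ) (A : ℕ → ℕ → ℕ) : Prop extends InM m n A where
  symm : (fun b j => A j b) = A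

theorem InS.lpp_symm {A : ℕ → ℕ → ℕ} (hA : InS m n A) (b j : ℕ) : lpp m A b j = lpp m A j b := by
  rw [← lpp_transpose, hA.symm]

theorem InS.resid {A : ℕ → ℕ → ℕ} (hA : InS m n A) : InS m n (resid m A) :=
  ⟨hA.toInM.resid, by rw [← resid_transpose hA.toInM, hA.symm]⟩

theorem InS.iterate {A : ℕ → ℕ → ℕ} (hA : InS m n A) (t : ℕ) :
    InS m n ((GLCrystal.resid m)^[t] A) := by
  induction t generalizing A with
  | zero => exact hA
  | succ t ih => exact ih hA.resid

/-- Transposition exchanges the two tableaux; if they agree, `A` and its transpose have the same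
pair of tableaux and so coincide. -/
theorem InM.symm_of_lpp {A : ℕ → ℕ → ℕ} (hA : InM m n A)
    (h : ∀ t, ∀ b ≤ m + n, lpp m ((GLCrystal.resid m)^[t] A) b (m + n) =
      lpp m ((GLCrystal.resid m)^[t] A) (m + n) b) : InS m n A := by
  refine ⟨hA, eq_of_lpp_iterate hA.transpose hA (fun t b hb => ?_) fun t j hj => ?_⟩
  · rw [iterate_resid_transpose hA, lpp_transpose, h t b hb]
  · rw [iterate_resid_transpose hA, lpp_transpose, h t j hj]

theorem exists_symm_lpp_iterate_eq (K : ℕ) (P : ℕ → ℕ → ℕ) (hP : ∀ t, Fits m (P t) (P (t + 1)))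
    (hPK : ∀ t b, K ≤ t → P t b = 0) :
    ∃ A, InS m n A ∧ ∀ t, ∀ b ≤ m + n, lpp m ((resid m)^[t] A) b (m + n) = P t b := by
  obtain ⟨A, hA, h1, h2⟩ := exists_lpp_iterate_eq (n := n) K P P hP hP hPK hPK fun _ => rfl
  exact ⟨A, hA.symm_of_lpp fun t b hb => (h1 t b hb).trans (h2 t b hb).symm, h1⟩

theorem InS.eq_of_lpp {A B : ℕ → ℕ → ℕ} (hA : InS m n A) (hB : InS m n B)
    (hp : ∀ t, ∀ b ≤ m + n,
      lpp m ((GLCrystal.resid m)^[t] A) b (m + n) = lpp m ((GLCrystal.resid m)^[t] B) b (m + n)) :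
    A = B :=
  eq_of_lpp_iterate hA.toInM hB.toInM hp fun t j hj => by
    rw [(hA.iterate t).lpp_symm, (hB.iterate t).lpp_symm, hp t j hj]

/-- The statistic `𝔬` for the letters before `N`. -/
def oStat (m : ℕ) (A : ℕ → ℕ → ℕ) (N : ℕ) : ℕ :=
  ∑ b ∈ Finset.range N, if b < m then A b b % 2 else A b b

/-- At a diagonal cell `mu = nu`. For degree 0, the local rule makes the increase of the table along
the diagonal equal to the sum of the parities of the entry and the residual entry; for degree 1, to
the sum of the two entries themselves. These increases telescope. -/
theorem InS.oStat_add {A : ℕ → ℕ → ℕ} (hA : InS m n A) (N : ℕ) :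
    oStat m A N + oStat m (GLCrystal.resid m A) N = lpp m A N N := by
  induction N with
  | zero => rfl
  | succ N ih =>
    rw [oStat, oStat, Finset.sum_range_succ, Finset.sum_range_succ]
    rw [oStat, oStat] at ih
    have h1 := hA.cell_spec N N
    have h2 := lpp_succ m A N N
    have h3 := hA.lpp_symm N (N + 1)
    have h4 := dg_cases m N
    have h5 := cell_cases (dg m N) (dg m N) (lpp m A N N) (lpp m A N (N + 1)) (lpp m A (N + 1) N)
      (A N N)
    split_ifs <;> omega

/-- The difference of the numbers of boxes in the even and in the odd columns is `𝔬`. -/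
theorem InS.oStat_congr {A B : ℕ → ℕ → ℕ} (hA : InS m n A) (hB : InS m n B)
    (h : ∀ t, lpp m ((GLCrystal.resid m)^[t] A) (m + n) (m + n) =
      lpp m ((GLCrystal.resid m)^[t] B) (m + n) (m + n)) :
    oStat m A (m + n) = oStat m B (m + n) := by
  have key : ∀ (K : ℕ) {A B : ℕ → ℕ → ℕ}, InS m n A → InS m n B →
      (∀ t, lpp m ((GLCrystal.resid m)^[t] A) (m + n) (m + n) =
        lpp m ((GLCrystal.resid m)^[t] B) (m + n) (m + n)) →
      (GLCrystal.resid m)^[K] A = (GLCrystal.resid m)^[K] B →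
      oStat m A (m + n) = oStat m B (m + n) := by
    intro K
    induction K with
    | zero => exact fun _ _ _ h => congrArg (oStat m · (m + n)) h
    | succ K ih =>
      intro A B hA hB h h1
      have h2 := ih hA.resid hB.resid (fun t => h (t + 1)) h1
      have h3 := hA.oStat_add (m + n)
      have h4 := hB.oStat_add (m + n)
      have h5 := h 0
      simp only [Function.iterate_zero, id] at h5
      omega
  refine key (max (total (m + n) A) (total (m + n) B)) hA hB h ?_
  rw [hA.toInM.iterate_eq_zero (le_max_left _ _), hB.toInM.iterate_eq_zero (le_max_right _ _)]

/-- Two applications of `oStat_add` show that `𝔬` drops under two residual steps by the difference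
of two consecutive column lengths, which is nonnegative. So `𝔬(A)` is a sum of such gaps and
vanishes only if each does. -/
theorem InS.oStat_eq_zero_iff {A : ℕ → ℕ → ℕ} (hA : InS m n A) :
    oStat m A (m + n) = 0 ↔ ∀ k, lpp m ((GLCrystal.resid m)^[2 * k] A) (m + n) (m + n) =
      lpp m ((GLCrystal.resid m)^[2 * k + 1] A) (m + n) (m + n) := by
  have two : ∀ {A : ℕ → ℕ → ℕ}, InS m n A →
      lpp m A (m + n) (m + n) + oStat m ((GLCrystal.resid m)^[2] A) (m + n) =
      lpp m (GLCrystal.resid m A) (m + n) (m + n) + oStat m A (m + n) := by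
    intro A hA
    have h1 := hA.oStat_add (m + n)
    have h2 := hA.resid.oStat_add (m + n)
    simp only [Function.iterate_succ, Function.iterate_zero, Function.comp, id]
    omega
  have desc : ∀ {A : ℕ → ℕ → ℕ}, InS m n A →
      lpp m (GLCrystal.resid m A) (m + n) (m + n) ≤ lpp m A (m + n) (m + n) :=
    fun hA => (lpp_resid_le hA.toInM _ _).1
  have key : ∀ (K : ℕ) {A : ℕ → ℕ → ℕ}, InS m n A → (GLCrystal.resid m)^[2 * K] A = (fun _ _ => 0) →
      (oStat m A (m + n) = 0 ↔ ∀ k, lpp m ((GLCrystal.resid m)^[2 * k] A) (m + n) (m + n) =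
        lpp m ((GLCrystal.resid m)^[2 * k + 1] A) (m + n) (m + n)) := by
    intro K
    induction K with
    | zero =>
      intro A hA h
      obtain rfl : A = fun _ _ => 0 := h
      simp [iterate_resid_zero, lpp_zero, oStat]
    | succ K ih =>
      intro A hA h
      have h1 := two hA
      have h2 := desc hA
      have h3 := ih (hA.iterate 2) (by
        rw [← Function.iterate_add_apply]; exact h)
      constructor
      · intro h4 k
        cases k with
        | zero =>
          simp only [mul_zero, Function.iterate_zero, id, zero_add, Function.iterate_one]
          omega
        | succ k =>
          have := h3.1 (by omega) k
          rw [← Function.iterate_add_apply, ← Function.iterate_add_apply] at this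
          exact this
      · intro h4
        have h5 := h4 0
        simp only [mul_zero, Function.iterate_zero, id, zero_add, Function.iterate_one] at h5
        have h6 := h3.2 fun k => by
          rw [← Function.iterate_add_apply, ← Function.iterate_add_apply]
          exact h4 (k + 1)
        omega
  exact key (total (m + n) A) hA (hA.toInM.iterate_eq_zero (by omega))

/-! ### The operators as mutually inverse partial maps on columns -/

theorem colEps_raise {i : Index m n} {d : ℕ} {v : ℕ → ℕ} (hv : ColValid m d v)
    (h : 0 < colEps i d (v i) (v (i + 1))) :
    colEps i d (v i) (v (i + 1)) = colEps i d (raise i v i) (raise i v (i + 1)) + 1 ∧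
      colPhi i d (raise i v i) (raise i v (i + 1)) = colPhi i d (v i) (v (i + 1)) + 1 := by
  have h1 := wordE_colWord i hv
  rw [if_pos h] at h1
  have h2 := wordE_spec h1
  rw [(word_colWord i d v).1, (word_colWord i d v).2, (word_colWord i d _).1,
    (word_colWord i d _).2] at h2
  exact ⟨h2.1, h2.2.1⟩

theorem raise_lower {i : Index m n} {v : ℕ → ℕ} (h : 0 < v i) : raise i (lower i v) = v := by
  funext k
  simp only [raise, lower]
  split_ifs <;> first | omega | (subst_vars; omega)

theorem lower_raise {i : Index m n} {v : ℕ → ℕ} (h : 0 < v (i + 1)) :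
    lower i (raise i v) = v := by
  funext k
  simp only [raise, lower]
  split_ifs <;> first | omega | (subst_vars; omega)

theorem colEps_lower {i : Index m n} {d : ℕ} {v : ℕ → ℕ} (hv : ColValid m d v)
    (h : 0 < colPhi i d (v i) (v (i + 1))) :
    colEps i d (lower i v i) (lower i v (i + 1)) = colEps i d (v i) (v (i + 1)) + 1 ∧
      colPhi i d (v i) (v (i + 1)) = colPhi i d (lower i v i) (lower i v (i + 1)) + 1 := by
  have h1 := wordF_colWord i hv
  rw [if_pos h] at h1
  have h2 := wordE_spec (wordE_of_wordF h1)
  rw [(word_colWord i d v).1, (word_colWord i d v).2, (word_colWord i d _).1,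
    (word_colWord i d _).2] at h2
  exact ⟨h2.1, h2.2.1⟩

theorem colsE_spec {i : Index m n} {L L' : List (ℕ × (ℕ → ℕ))} (hL : ∀ c ∈ L, ColValid m c.1 c.2)
    (h : colsE i L = some L') :
    wordEps i (colsWord m n L) = wordEps i (colsWord m n L') + 1 ∧
      wordPhi i (colsWord m n L') = wordPhi i (colsWord m n L) + 1 ∧
      wordWt (colsWord m n L') = wordWt (colsWord m n L) + root i := by
  have h1 := wordE_colsWord i hL
  rw [h] at h1
  have h2 := wordE_spec h1
  exact ⟨h2.1, h2.2.1, h2.2.2.1⟩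

theorem colsF_of_colsE {i : Index m n} {L L' : List (ℕ × (ℕ → ℕ))}
    (hL : ∀ c ∈ L, ColValid m c.1 c.2) (h : colsE i L = some L') : colsF i L' = some L := by
  induction L generalizing L' with
  | nil => simp [colsE] at h
  | cons c L ih =>
    obtain ⟨d, v⟩ := c
    have hv : ColValid m d v := hL _ List.mem_cons_self
    have hL' := fun c hc => hL c (List.mem_cons_of_mem _ hc)
    rw [colsE] at h
    split_ifs at h with h1 h2
    · obtain rfl := Option.some.inj h
      obtain ⟨h3, h4⟩ := colEps_raise hv h2
      rw [colsF, if_pos, if_pos (by omega), lower_raise (colEps_pos h2)]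
      unfold tensorLeftE at h1
      unfold tensorLeftF
      split_ifs at h1 ⊢ <;> omega
    · obtain ⟨L₁, h3, rfl⟩ := Option.map_eq_some_iff.1 h
      obtain ⟨h4, h5, -⟩ := colsE_spec hL' h3
      rw [colsF, if_neg, ih hL' h3]
      · rfl
      · unfold tensorLeftE at h1
        unfold tensorLeftF
        split_ifs at h1 ⊢ <;> omega

theorem colsE_of_colsF {i : Index m n} {L L' : List (ℕ × (ℕ → ℕ))}
    (hL : ∀ c ∈ L, ColValid m c.1 c.2) (h : colsF i L = some L') : colsE i L' = some L := by
  induction L generalizing L' with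
  | nil => simp [colsF] at h
  | cons c L ih =>
    obtain ⟨d, v⟩ := c
    have hv : ColValid m d v := hL _ List.mem_cons_self
    have hL' := fun c hc => hL c (List.mem_cons_of_mem _ hc)
    rw [colsF] at h
    split_ifs at h with h1 h2
    · obtain rfl := Option.some.inj h
      obtain ⟨h3, h4⟩ := colEps_lower hv h2
      have h5 := colEps_colPhi_cases i d (v i) (v (i + 1))
      rw [colsE, if_pos, if_pos (by omega), raise_lower (by omega)]
      unfold tensorLeftF at h1
      unfold tensorLeftE
      split_ifs at h1 ⊢ <;> omega
    · obtain ⟨L₁, h3, rfl⟩ := Option.map_eq_some_iff.1 h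
      have h1' := wordF_colsWord i hL'
      rw [h3] at h1'
      obtain ⟨h4, h5, -⟩ := wordE_spec (wordE_of_wordF h1')
      rw [colsE, if_neg, ih hL' h3]
      · rfl
      · unfold tensorLeftF at h1
        unfold tensorLeftE
        split_ifs at h1 ⊢ <;> omega

/-- The matrix `A` with the column `k` replaced by `v`. -/
def updCol (A : ℕ → ℕ → ℕ) (k : ℕ) (v : ℕ → ℕ) (b j : ℕ) : ℕ := if j = k then v b else A b j

theorem cols_getElem? (m : ℕ) (A : ℕ → ℕ → ℕ) (N k : ℕ) :
    (cols m A 0 N)[k]? = if k < N then some (dg m k, fun b => A b k) else none := by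
  rw [cols, List.getElem?_map]
  split_ifs with h
  · rw [List.getElem?_range' h]; simp
  · rw [List.getElem?_eq_none (by simp; omega)]; rfl

theorem cols_updCol {m : ℕ} {A : ℕ → ℕ → ℕ} {N k : ℕ} (v : ℕ → ℕ) :
    cols m (updCol A k v) 0 N = (cols m A 0 N).set k (dg m k, v) := by
  apply List.ext_getElem?
  intro j
  rw [cols_getElem?, List.getElem?_set, cols_getElem?, length_cols]
  by_cases h : k = j
  · subst h; simp [updCol]
  · simp [updCol, h, Ne.symm h]

theorem InM.updCol {A : ℕ → ℕ → ℕ} (hA : InM m n A) {k : ℕ} (hk : k < m + n) {v : ℕ → ℕ}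
    (hv : ColValid m (dg m k) v) (hv' : ∀ b, m + n ≤ b → v b = 0) :
    InM m n (updCol A k v) where
  valid j := by
    by_cases h : j = k
    · subst h; simpa [GLCrystal.updCol] using hv
    · simpa [GLCrystal.updCol, h] using hA.valid j
  row b j h := by
    unfold GLCrystal.updCol
    split_ifs
    · exact hv' b h
    · exact hA.row b j h
  col b j h := by
    unfold GLCrystal.updCol
    rw [if_neg (by omega)]
    exact hA.col b j h

theorem InM.exists_rowE {A : ℕ → ℕ → ℕ} (hA : InM m n A) {i : Index m n}
    {L : List (ℕ × (ℕ → ℕ))} (h : colsE i (cols m A 0 (m + n)) = some L) :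
    ∃ B, InM m n B ∧ L = cols m B 0 (m + n) := by
  obtain ⟨k, d, v, h1, h2, rfl⟩ := colsE_eq_set h
  rw [cols_getElem?] at h1
  split_ifs at h1 with hk
  obtain ⟨rfl, rfl⟩ := Prod.mk.inj (Option.some.inj h1)
  refine ⟨_, hA.updCol hk ((hA.valid k).raise h2) fun b hb => ?_, (cols_updCol _).symm⟩
  have := i.2
  simp only [raise]
  rw [if_neg (by omega), if_neg (by omega), hA.row b k hb]

theorem InM.exists_rowF {A : ℕ → ℕ → ℕ} (hA : InM m n A) {i : Index m n}
    {L : List (ℕ × (ℕ → ℕ))} (h : colsF i (cols m A 0 (m + n)) = some L) :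
    ∃ B, InM m n B ∧ L = cols m B 0 (m + n) := by
  obtain ⟨k, d, v, h1, h2, rfl⟩ := colsF_eq_set h
  rw [cols_getElem?] at h1
  split_ifs at h1 with hk
  obtain ⟨rfl, rfl⟩ := Prod.mk.inj (Option.some.inj h1)
  refine ⟨_, hA.updCol hk ((hA.valid k).lower h2) fun b hb => ?_, (cols_updCol _).symm⟩
  have := i.2
  simp only [lower]
  rw [if_neg (by omega), if_neg (by omega), hA.row b k hb]

/-- A letter is exchanged within one column, so the word of column indices of the biword is
unchanged. This allows the new row word to be paired with the old column indices. -/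
theorem RowE.col_sum {i : Index m n} {A B : ℕ → ℕ → ℕ} (h : RowE i A B) {j : ℕ} (hj : j < m + n) :
    psum (fun b => B b j) (m + n) = psum (fun b => A b j) (m + n) := by
  obtain ⟨k, d, v, h1, h2, h3⟩ := colsE_eq_set h
  have h4 := congrArg (·[j]?) h3
  simp only [List.getElem?_set, cols_getElem?, length_cols, if_pos hj] at h4
  rw [cols_getElem?] at h1
  split_ifs at h1 with hk
  obtain ⟨rfl, rfl⟩ := Prod.mk.inj (Option.some.inj h1)
  split_ifs at h4 with h5
  · subst h5
    rw [(Prod.mk.inj (Option.some.inj h4)).2, psum_raise_top h2]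
  · rw [(Prod.mk.inj (Option.some.inj h4)).2]

/-! ### Return to the matrices of the statement -/

/-- A matrix extended by zero. -/
def extendZero (A : Mat m n) (b j : ℕ) : ℕ :=
  if h : b < m + n ∧ j < m + n then A ⟨b, h.1⟩ ⟨j, h.2⟩ else 0

theorem extendZero_val (A : Mat m n) (b j : Letter m n) : extendZero A b j = A b j := by
  simp [extendZero]

theorem deg_eq_dg (b : Letter m n) : deg b = dg m b := rfl

theorem inM_extendZero {A : Mat m n} : InM m n (extendZero A) ↔ A ∈ bigM m n := by
  constructor
  · intro h b j hbj
    have h1 := h.valid j b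
    have h2 := dg_cases m b
    have h3 := dg_cases m j
    rw [deg_eq_dg, deg_eq_dg] at hbj
    dsimp only at h1
    rw [extendZero_val] at h1
    omega
  · intro h
    refine ⟨fun j b => ?_, fun b j hb => dif_neg (by omega), fun b j hb => dif_neg (by omega)⟩
    dsimp only
    by_cases hbj : b < m + n ∧ j < m + n
    · have h1 := h ⟨b, hbj.1⟩ ⟨j, hbj.2⟩
      have h2 := dg_cases m b
      have h3 := dg_cases m j
      rw [deg_eq_dg, deg_eq_dg] at h1
      rw [extendZero, dif_pos hbj]
      dsimp only at h1
      omega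
    · rw [extendZero, dif_neg hbj]
      exact Or.inr (Or.inr zero_le_one)

theorem InM.extendZero_of {A : ℕ → ℕ → ℕ} (hA : InM m n A) :
    extendZero (Matrix.of fun b j : Letter m n => A b j) = A := by
  funext b j
  unfold extendZero
  split_ifs with h
  · rfl
  · rcases not_and_or.1 h with h | h
    · rw [hA.row b j (by omega)]
    · rw [hA.col b j (by omega)]

theorem extendZero_injective : Function.Injective (extendZero (m := m) (n := n)) := by
  intro A B h
  ext b j
  rw [← extendZero_val A, ← extendZero_val B, h]

theorem extendZero_transpose (A : Mat m n) :
    extendZero A.transpose = fun b j => extendZero A j b := by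
  funext b j
  simp only [extendZero, and_comm, Matrix.transpose_apply]

theorem transpose_mem_bigM {A : Mat m n} (h : A ∈ bigM m n) : A.transpose ∈ bigM m n := by
  rw [← inM_extendZero, extendZero_transpose]
  exact (inM_extendZero.2 h).transpose

theorem map_val_finRange_flatMap {X : Type*} (N : ℕ) (g : ℕ → List X) :
    (List.range' 0 N).flatMap g = (List.finRange N).flatMap fun j : Fin N => g j := by
  rw [← List.range_eq_range', ← List.map_coe_finRange_eq_range, List.flatMap_map]

theorem map_fst_biword (A : Mat m n) :
    (biword A).map Prod.fst = colsWord m n (cols m (extendZero A) 0 (m + n)) := by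
  rw [colsWord, cols, List.flatMap_map, map_val_finRange_flatMap, biword, List.map_flatMap]
  refine List.flatMap_congr fun j _ => ?_
  rw [List.map_flatMap, colWord]
  simp only [List.map_replicate, extendZero_val]
  rfl

theorem psum_eq_sum (v : ℕ → ℕ) (N : ℕ) : psum v N = ∑ b ∈ Finset.range N, v b := by
  induction N with
  | zero => rfl
  | succ N ih => rw [psum, ih, Finset.sum_range_succ]

theorem flatMap_replicate_const {X Y : Type*} (l : List X) (g : X → ℕ) (y : Y) :
    (l.flatMap fun x => List.replicate (g x) y) = List.replicate (l.map g).sum y := by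
  induction l with
  | nil => rfl
  | cons x l ih => rw [List.flatMap_cons, ih, List.map_cons, List.sum_cons, List.replicate_add]

theorem map_snd_biword (A : Mat m n) :
    (biword A).map Prod.snd = (List.finRange (m + n)).flatMap fun j : Letter m n =>
      List.replicate (psum (fun b => extendZero A b j) (m + n)) j := by
  rw [biword, List.map_flatMap]
  congr 1
  funext j
  rw [List.map_flatMap]
  simp only [List.map_replicate]
  rw [flatMap_replicate_const]
  congr 1
  rw [psum_eq_sum, ← Fin.sum_univ_eq_sum_range (fun b => extendZero A b j)]
  simp only [extendZero_val]
  rw [Fin.sum_univ_def]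
  split_ifs
  · rw [List.map_reverse, List.sum_reverse]
  · rfl

theorem onRows_eq_some {op : List (Letter m n) → Option (List (Letter m n))} {A B : Mat m n}
    (h1 : op ((biword A).map Prod.fst) = some ((biword B).map Prod.fst))
    (h2 : (biword A).map Prod.snd = (biword B).map Prod.snd) : onRows op A = some B := by
  rw [onRows, h1, h2, Option.map_some, List.zip_map', List.map_congr_left (g := id),
    List.map_id, ofBiword_biword]
  exact fun _ _ => rfl

theorem RowE.wordE {i : Index m n} {A B : Mat m n} (hA : A ∈ bigM m n)
    (h : RowE i (extendZero A) (extendZero B)) :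
    GLCrystal.wordE i ((biword A).map Prod.fst) = some ((biword B).map Prod.fst) := by
  rw [map_fst_biword, wordE_colsWord i ((inM_extendZero.2 hA).cols_valid _ _), h, map_fst_biword]
  rfl

theorem RowE.map_snd {i : Index m n} {A B : Mat m n} (h : RowE i (extendZero A) (extendZero B)) :
    (biword A).map Prod.snd = (biword B).map Prod.snd := by
  rw [map_snd_biword, map_snd_biword]
  congr 1
  funext j
  rw [h.col_sum j.2]

/-- The changed row word is that of a matrix with the same column sums, so zipping it with the old
column indices gives the biword of that matrix. -/
theorem matE_eq_some {i : Index m n} {A B : Mat m n} (hA : A ∈ bigM m n) :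
    matE i A = some B ↔ B ∈ bigM m n ∧ RowE i (extendZero A) (extendZero B) := by
  have hA' := inM_extendZero.2 hA
  constructor
  · intro h
    obtain ⟨w, h1, -⟩ := Option.map_eq_some_iff.1 h
    rw [map_fst_biword, wordE_colsWord i (hA'.cols_valid _ _)] at h1
    obtain ⟨L, h2, -⟩ := Option.map_eq_some_iff.1 h1
    obtain ⟨B', h3, rfl⟩ := hA'.exists_rowE h2
    have h4 : RowE i (extendZero A) (extendZero (Matrix.of fun b j : Letter m n => B' b j)) := by
      rw [h3.extendZero_of]
      exact h2
    have h5 : matE i A = some _ := onRows_eq_some (h4.wordE hA) h4.map_snd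
    obtain rfl := Option.some.inj (h.symm.trans h5)
    exact ⟨inM_extendZero.1 (by rwa [h3.extendZero_of]), h4⟩
  · rintro ⟨-, h⟩
    exact onRows_eq_some (h.wordE hA) h.map_snd

theorem matF_eq_some {i : Index m n} {A B : Mat m n} (hA : A ∈ bigM m n) :
    matF i A = some B ↔ B ∈ bigM m n ∧ RowE i (extendZero B) (extendZero A) := by
  have hA' := inM_extendZero.2 hA
  have key : ∀ {B : Mat m n}, B ∈ bigM m n → RowE i (extendZero B) (extendZero A) →
      matF i A = some B := fun hB h =>
    onRows_eq_some (wordF_iff_wordE.2 (h.wordE hB)) h.map_snd.symm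
  constructor
  · intro h
    obtain ⟨w, h1, -⟩ := Option.map_eq_some_iff.1 h
    rw [map_fst_biword, wordF_colsWord i (hA'.cols_valid _ _)] at h1
    obtain ⟨L, h2, -⟩ := Option.map_eq_some_iff.1 h1
    obtain ⟨B', h3, rfl⟩ := hA'.exists_rowF h2
    have h4 : RowE i (extendZero (Matrix.of fun b j : Letter m n => B' b j)) (extendZero A) := by
      rw [h3.extendZero_of]
      exact colsE_of_colsF (hA'.cols_valid _ _) h2
    have h5 := inM_extendZero.1 (show InM m n (extendZero _) by rwa [h3.extendZero_of])
    obtain rfl := Option.some.inj (h.symm.trans (key h5 h4))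
    exact ⟨h5, h4⟩
  · rintro ⟨hB, h⟩
    exact key hB h

/-! ### Matrices with the same tableau -/

/-- The row word of a matrix. -/
def rowWord (m n : ℕ) (A : ℕ → ℕ → ℕ) : List (Letter m n) := colsWord m n (cols m A 0 (m + n))

/-- `A` and `B` have the same tableau. -/
def TabEq (m n : ℕ) (A B : ℕ → ℕ → ℕ) : Prop :=
  ∀ t, colState m ((resid m)^[t] A) (m + n) = colState m ((resid m)^[t] B) (m + n)

theorem TabEq.symm {A B : ℕ → ℕ → ℕ} (h : TabEq m n A B) : TabEq m n B A := fun t => (h t).symm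

theorem TabEq.trans {A B C : ℕ → ℕ → ℕ} (h : TabEq m n A B) (h' : TabEq m n B C) :
    TabEq m n A C := fun t => (h t).trans (h' t)

theorem TabEq.lpp {A B : ℕ → ℕ → ℕ} (h : TabEq m n A B) (t b : ℕ) :
    lpp m ((resid m)^[t] A) b (m + n) = GLCrystal.lpp m ((resid m)^[t] B) b (m + n) := by
  rw [GLCrystal.lpp, GLCrystal.lpp, h t]

theorem TabEq.of_lpp {A B : ℕ → ℕ → ℕ} (hA : InM m n A) (hB : InM m n B)
    (h : ∀ t, ∀ b ≤ m + n, GLCrystal.lpp m ((resid m)^[t] A) b (m + n) =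
      GLCrystal.lpp m ((resid m)^[t] B) b (m + n)) : TabEq m n A B := by
  intro t
  funext b
  rcases Nat.lt_or_ge b (m + n) with hb | hb
  · have h1 := h t b hb.le
    have h2 := h t (b + 1) hb
    simp only [GLCrystal.lpp, psum] at h1 h2
    omega
  · rw [(hA.iterate t).colState_eq_zero _ hb, (hB.iterate t).colState_eq_zero _ hb]

theorem TabEq.tabCols {A B : ℕ → ℕ → ℕ} (h : TabEq m n A B) (K : ℕ) :
    tabCols m (m + n) K A = GLCrystal.tabCols m (m + n) K B := by
  induction K generalizing A B with
  | zero => rfl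
  | succ K ih =>
    have h0 := h 0
    rw [GLCrystal.tabCols, GLCrystal.tabCols, ih fun t => h (t + 1)]
    simp only [Function.iterate_zero, id] at h0
    rw [h0]

theorem TabEq.of_tabCols {A B : ℕ → ℕ → ℕ} {K : ℕ} (hA : (resid m)^[K] A = fun _ _ => 0)
    (hB : (resid m)^[K] B = fun _ _ => 0)
    (h : GLCrystal.tabCols m (m + n) K A = GLCrystal.tabCols m (m + n) K B) : TabEq m n A B := by
  induction K generalizing A B with
  | zero =>
    obtain rfl : A = _ := hA
    obtain rfl : B = _ := hB
    exact fun _ => rfl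
  | succ K ih =>
    rw [GLCrystal.tabCols, GLCrystal.tabCols] at h
    obtain ⟨h1, h2⟩ := List.append_inj' h rfl
    simp only [List.cons.injEq, Prod.mk.injEq, true_and, and_true] at h2
    intro t
    cases t with
    | zero => exact h2
    | succ t => exact ih hA hB h1 t

theorem InM.exists_iterate_eq_zero {A : ℕ → ℕ → ℕ} (hA : InM m n A) :
    ∃ K, ∀ k, K ≤ k → (GLCrystal.resid m)^[k] A = fun _ _ => 0 :=
  ⟨_, fun _ hk => hA.iterate_eq_zero hk⟩

theorem TabEq.iterate_eq_zero {A B : ℕ → ℕ → ℕ} (h : TabEq m n A B) (hA : InM m n A) {K : ℕ}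
    (hB : (resid m)^[K] B = fun _ _ => 0) : (resid m)^[K] A = fun _ _ => 0 := by
  apply (hA.iterate K).eq_zero_of_lpp
  rw [h.lpp, hB, lpp_zero]

theorem colsWord_zero_append (j k : ℕ) (L : List (ℕ × (ℕ → ℕ))) :
    colsWord m n (cols m (fun _ _ => 0) j k ++ L) = colsWord m n L := by
  induction k generalizing j with
  | zero => rfl
  | succ k ih =>
    rw [cols_succ, List.cons_append, colsWord_cons, ih]
    simp [colWord]

theorem wordEps_rowWord (i : Index m n) {A : ℕ → ℕ → ℕ} (hA : InM m n A) {K : ℕ}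
    (hK : (resid m)^[K] A = fun _ _ => 0) :
    wordEps i (colsWord m n (tabCols m (m + n) K A)) = wordEps i (rowWord m n A) ∧
      wordPhi i (colsWord m n (tabCols m (m + n) K A)) = wordPhi i (rowWord m n A) := by
  have h := wordEps_tabCols i hA K
  rw [hK, colsWord_zero_append] at h
  exact h

theorem TabEq.wordEps {A B : ℕ → ℕ → ℕ} (h : TabEq m n A B) (hA : InM m n A) (hB : InM m n B)
    (i : Index m n) : wordEps i (rowWord m n A) = GLCrystal.wordEps i (rowWord m n B) ∧
      wordPhi i (rowWord m n A) = wordPhi i (rowWord m n B) := by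
  obtain ⟨K₁, h₁⟩ := hA.exists_iterate_eq_zero
  obtain ⟨K₂, h₂⟩ := hB.exists_iterate_eq_zero
  obtain ⟨h3, h4⟩ := wordEps_rowWord i hA (h₁ _ (le_max_left K₁ K₂))
  obtain ⟨h5, h6⟩ := wordEps_rowWord i hB (h₂ _ (le_max_right K₁ K₂))
  rw [← h3, ← h4, ← h5, ← h6, h.tabCols]
  exact ⟨rfl, rfl⟩

/-- The action on tableaux is an injective partial map: equal tableaux have equal images by `colsE`,
and `colsF` recovers them. -/
theorem RowE.tabEq {i : Index m n} {A A' B B' : ℕ → ℕ → ℕ} (hA : InM m n A) (hA' : InM m n A')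
    (hB : InM m n B) (hB' : InM m n B') (h : RowE i A B) (h' : RowE i A' B') :
    TabEq m n A A' ↔ TabEq m n B B' := by
  obtain ⟨K₁, h₁⟩ := hA.exists_iterate_eq_zero
  obtain ⟨K₂, h₂⟩ := hB.exists_iterate_eq_zero
  obtain ⟨K₃, h₃⟩ := hA'.exists_iterate_eq_zero
  obtain ⟨K₄, h₄⟩ := hB'.exists_iterate_eq_zero
  -- A common number of steps that exhausts all four matrices, so that only tableau columns
  -- contribute letters.
  obtain ⟨K, hK⟩ : ∃ K, K = K₁ + K₂ + K₃ + K₄ := ⟨_, rfl⟩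
  specialize h₁ K (by omega)
  specialize h₂ K (by omega)
  specialize h₃ K (by omega)
  specialize h₄ K (by omega)
  have e1 := h.tabCols hA hB K
  have e2 := h'.tabCols hA' hB' K
  rw [h₁, h₂] at e1
  rw [h₃, h₄] at e2
  have v : ∀ {C : ℕ → ℕ → ℕ}, InM m n C → ∀ c ∈ cols m (fun _ _ => 0) 0 (m + n) ++
      GLCrystal.tabCols m (m + n) K C, ColValid m c.1 c.2 := by
    intro C hC c hc
    rcases List.mem_append.1 hc with hc | hc
    · exact InM.zero.cols_valid (n := n) _ _ c hc
    · exact hC.tabCols_valid _ _ c hc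
  constructor
  · intro e
    rw [e.tabCols K, e2] at e1
    exact (TabEq.of_tabCols h₄ h₂ (List.append_cancel_left (Option.some.inj e1))).symm
  · intro e
    have f1 := colsF_of_colsE (v hA) e1
    have f2 := colsF_of_colsE (v hA') e2
    rw [e.tabCols K, f2] at f1
    exact (TabEq.of_tabCols h₃ h₁ (List.append_cancel_left (Option.some.inj f1))).symm

/-- The insertion tableau of the transpose is the recording tableau, which `e_i` fixes. -/
theorem RowE.tabEq_transpose {i : Index m n} {A B : ℕ → ℕ → ℕ} (hA : InM m n A) (hB : InM m n B)
    (h : RowE i A B) : TabEq m n (fun b j => A j b) fun b j => B j b := by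
  refine TabEq.of_lpp hA.transpose hB.transpose fun t b hb => ?_
  rw [iterate_resid_transpose hA, iterate_resid_transpose hB]
  exact (lpp_transpose m _ b (m + n)).trans
    ((h.lpp_top_iterate hA hB t hb).symm.trans (lpp_transpose m _ b (m + n)).symm)

theorem InM.symm_of_tabEq {A : ℕ → ℕ → ℕ} (hA : InM m n A)
    (h : TabEq m n A fun b j => A j b) : InS m n A := by
  refine hA.symm_of_lpp fun t b _ => ?_
  rw [h.lpp t b, iterate_resid_transpose hA, lpp_transpose]

theorem RowE.spec {i : Index m n} {A B : ℕ → ℕ → ℕ} (hA : InM m n A) (h : RowE i A B) :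
    wordEps i (rowWord m n A) = wordEps i (rowWord m n B) + 1 ∧
      wordPhi i (rowWord m n B) = wordPhi i (rowWord m n A) + 1 ∧
      wordWt (rowWord m n B) = wordWt (rowWord m n A) + root i :=
  colsE_spec (hA.cols_valid _ _) h

theorem wordWt_apply (w : List (Letter m n)) (b : Letter m n) : wordWt w b = w.count b := by
  induction w with
  | nil => rfl
  | cons c w ih =>
    rw [wordWt, Pi.add_apply, ih, List.count_cons, letterWt, Pi.single_apply]
    by_cases h : c = b
    · subst h; simp [add_comm]
    · simp [h, Ne.symm h]

theorem count_colWord (d : ℕ) (v : ℕ → ℕ) (b : Letter m n) :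
    (colWord m n d v).count b = v b := by
  have h : ((List.finRange (m + n)).map fun c : Letter m n =>
      (List.replicate (v c) c).count b).sum = v b := by
    rw [← Fin.sum_univ_def]
    simp [List.count_replicate]
  rw [colWord, List.count_flatMap]
  split_ifs
  · rw [List.map_reverse, List.sum_reverse]
    exact h
  · exact h

theorem count_colsWord (L : List (ℕ × (ℕ → ℕ))) (b : Letter m n) :
    (colsWord m n L).count b = (L.map fun c => c.2 b).sum := by
  rw [colsWord, List.count_flatMap]
  simp only [Function.comp_def, count_colWord]

theorem count_rowWord (A : ℕ → ℕ → ℕ) (b : Letter m n) :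
    (rowWord m n A).count b = ∑ j ∈ Finset.range (m + n), A b j := by
  rw [rowWord, count_colsWord, cols, List.map_map, ← List.range_eq_range', Finset.sum_range,
    Fin.sum_univ_def, ← List.map_coe_finRange_eq_range, List.map_map]
  rfl

theorem sum_resid {A : ℕ → ℕ → ℕ} (hA : InM m n A) (b N : ℕ) :
    ∑ j ∈ Finset.range N, resid m A b j + colState m A N b = ∑ j ∈ Finset.range N, A b j := by
  induction N with
  | zero => rfl
  | succ N ih =>
    rw [Finset.sum_range_succ, Finset.sum_range_succ]
    have h1 := (insCol_spec (hA.valid N) (hA.colState N) b).1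
    have h2 : resid m A b N = A b N + colState m A N b - colState m A (N + 1) b := rfl
    change colState m A (N + 1) b ≤ _ at h1
    omega

theorem count_tabCols {A : ℕ → ℕ → ℕ} (hA : InM m n A) {K : ℕ}
    (hK : (resid m)^[K] A = fun _ _ => 0) (b : Letter m n) :
    (colsWord m n (tabCols m (m + n) K A)).count b = (rowWord m n A).count b := by
  rw [count_rowWord, count_colsWord]
  induction K generalizing A with
  | zero =>
    obtain rfl : A = fun _ _ => 0 := hK
    simp [tabCols]
  | succ K ih =>
    rw [tabCols, List.map_append, List.sum_append, ih hA.resid hK, ← sum_resid hA]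
    simp

theorem TabEq.wordWt {A B : ℕ → ℕ → ℕ} (h : TabEq m n A B) (hA : InM m n A) (hB : InM m n B) :
    wordWt (rowWord m n A) = GLCrystal.wordWt (rowWord m n B) := by
  obtain ⟨K₁, h₁⟩ := hA.exists_iterate_eq_zero
  obtain ⟨K₂, h₂⟩ := hB.exists_iterate_eq_zero
  funext b
  rw [wordWt_apply, wordWt_apply, ← count_tabCols hA (h₁ _ (le_max_left K₁ K₂)),
    ← count_tabCols hB (h₂ _ (le_max_right K₁ K₂)), h.tabCols]

/-! ### The diagonal operators on symmetric matrices -/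

/-- `𝐞_i` sends `A` to `B`. -/
def DiagE (i : Index m n) (A B : ℕ → ℕ → ℕ) : Prop :=
  ∃ D, InM m n D ∧ RowE i A D ∧ RowE i (fun b j => D j b) B

/-- Since `e_i` fixes recording tableaux, the transpose of `D` has the tableau of `A`. Applying
`e_i` to both shows that `B` has the tableau of `D`; and the transpose of `B` has it too, again
because the recording tableau is fixed. So both tableaux of `B` agree. -/
theorem InS.symm_of_rowE {i : Index m n} {A B D : ℕ → ℕ → ℕ} (hA : InS m n A) (hD : InM m n D)
    (hB : InM m n B) (h1 : RowE i A D) (h2 : RowE i (fun b j => D j b) B) :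
    TabEq m n D B ∧ InS m n B := by
  have t1 := h1.tabEq_transpose hA.toInM hD
  rw [hA.symm] at t1
  have t2 := (h1.tabEq hA.toInM hD.transpose hD hB h2).1 t1
  have t3 : TabEq m n D fun b j => B j b := h2.tabEq_transpose hD.transpose hB
  exact ⟨t2, hB.symm_of_tabEq (t2.symm.trans t3)⟩

theorem InS.symm_of_rowE' {i : Index m n} {A B D : ℕ → ℕ → ℕ} (hA : InS m n A) (hD : InM m n D)
    (hB : InM m n B) (h1 : RowE i D A) (h2 : RowE i B fun b j => D j b) : InS m n B := by
  have t1 := h1.tabEq_transpose hD hA.toInM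
  rw [hA.symm] at t1
  have t2 := (h2.tabEq hB hD hD.transpose hA.toInM h1).2 t1
  have t3 : TabEq m n (fun b j => B j b) D := h2.tabEq_transpose hB hD.transpose
  exact hB.symm_of_tabEq (t2.trans t3.symm)

theorem DiagE.symm {i : Index m n} {A B : ℕ → ℕ → ℕ} (h : DiagE i A B) (hA : InS m n A)
    (hB : InM m n B) : InS m n B := by
  obtain ⟨D, hD, h1, h2⟩ := h
  exact (hA.symm_of_rowE hD hB h1 h2).2

/-- `B` has the same tableau as `D`, one ordinary step away from `A`. Hence `𝐞_i` shifts `ε_i`,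
`φ_i` and the weight exactly as a single `e_i` does. -/
theorem DiagE.spec {i : Index m n} {A B : ℕ → ℕ → ℕ} (h : DiagE i A B) (hA : InS m n A)
    (hB : InM m n B) :
    wordEps i (rowWord m n A) = wordEps i (rowWord m n B) + 1 ∧
      wordPhi i (rowWord m n B) = wordPhi i (rowWord m n A) + 1 ∧
      wordWt (rowWord m n B) = wordWt (rowWord m n A) + root i := by
  obtain ⟨D, hD, h1, h2⟩ := h
  have t := (hA.symm_of_rowE hD hB h1 h2).1
  have h3 := h1.spec hA.toInM
  rwa [(t.wordEps hD hB i).1, (t.wordEps hD hB i).2, t.wordWt hD hB] at h3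

theorem DiagE.lpp_top {i : Index m n} {A B : ℕ → ℕ → ℕ} (h : DiagE i A B) (hA : InS m n A)
    (hB : InM m n B) (t : ℕ) : lpp m ((resid m)^[t] A) (m + n) (m + n) =
      lpp m ((resid m)^[t] B) (m + n) (m + n) := by
  obtain ⟨D, hD, h1, h2⟩ := h
  rw [← (hA.symm_of_rowE hD hB h1 h2).1.lpp t, h1.lpp_top_iterate hA.toInM hD t le_rfl]

theorem DiagE.oStat_eq {i : Index m n} {A B : ℕ → ℕ → ℕ} (h : DiagE i A B) (hA : InS m n A)
    (hB : InM m n B) : oStat m A (m + n) = oStat m B (m + n) :=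
  hA.oStat_congr (h.symm hA hB) (h.lpp_top hA hB)

theorem DiagE.tabCols {i : Index m n} {A B : ℕ → ℕ → ℕ} (h : DiagE i A B) (hA : InS m n A)
    (hB : InM m n B) {K : ℕ} (hAK : (resid m)^[K] A = fun _ _ => 0)
    (hBK : (resid m)^[K] B = fun _ _ => 0) :
    wordE i (colsWord m n (tabCols m (m + n) K A)) =
      some (colsWord m n (GLCrystal.tabCols m (m + n) K B)) := by
  obtain ⟨D, hD, h1, h2⟩ := h
  have t := (hA.symm_of_rowE hD hB h1 h2).1
  have h3 := h1.tabCols hA.toInM hD K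
  have h4 := wordE_colsWord (m := m) (n := n) i
    (L := cols m ((resid m)^[K] A) 0 (m + n) ++ GLCrystal.tabCols m (m + n) K A) (by
      intro c hc
      rcases List.mem_append.1 hc with hc | hc
      · exact (hA.toInM.iterate K).cols_valid _ _ c hc
      · exact hA.toInM.tabCols_valid _ _ c hc)
  rw [h3, hAK, t.iterate_eq_zero hD hBK, colsWord_zero_append, t.tabCols, Option.map_some,
    colsWord_zero_append] at h4
  exact h4

/-- The second half of `𝐞_i` never fails after the first: the transpose of `D` has the tableau of
`A`, hence the same positive `ε_i`. -/
theorem InS.exists_diagE {i : Index m n} {A : ℕ → ℕ → ℕ} (hA : InS m n A)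
    (h : wordEps i (rowWord m n A) ≠ 0) : ∃ B, InM m n B ∧ DiagE i A B := by
  have ex : ∀ {A : ℕ → ℕ → ℕ}, InM m n A → wordEps i (rowWord m n A) ≠ 0 →
      ∃ B, InM m n B ∧ RowE i A B := by
    intro A hA h
    rw [rowWord, ne_eq, ← wordE_eq_none_iff, wordE_colsWord i (hA.cols_valid _ _)] at h
    have hne : colsE i (cols m A 0 (m + n)) ≠ none := fun h' => h (by rw [h']; rfl)
    obtain ⟨L, hL⟩ := Option.ne_none_iff_exists'.1 hne
    obtain ⟨B, hB, rfl⟩ := hA.exists_rowE hL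
    exact ⟨B, hB, hL⟩
  obtain ⟨D, hD, h1⟩ := ex hA.toInM h
  have t1 := h1.tabEq_transpose hA.toInM hD
  rw [hA.symm] at t1
  rw [(t1.wordEps hA.toInM hD.transpose i).1] at h
  obtain ⟨B, hB, h2⟩ := ex hD.transpose h
  exact ⟨B, hB, D, hD, h1, h2⟩

theorem InS.exists_diagE' {i : Index m n} {A : ℕ → ℕ → ℕ} (hA : InS m n A)
    (h : wordPhi i (rowWord m n A) ≠ 0) : ∃ B, InS m n B ∧ DiagE i B A := by
  have ex : ∀ {A : ℕ → ℕ → ℕ}, InM m n A → wordPhi i (rowWord m n A) ≠ 0 →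
      ∃ B, InM m n B ∧ RowE i B A := by
    intro A hA h
    rw [rowWord, ne_eq, ← wordF_eq_none_iff, wordF_colsWord i (hA.cols_valid _ _)] at h
    have hne : colsF i (cols m A 0 (m + n)) ≠ none := fun h' => h (by rw [h']; rfl)
    obtain ⟨L, hL⟩ := Option.ne_none_iff_exists'.1 hne
    obtain ⟨B, hB, rfl⟩ := hA.exists_rowF hL
    exact ⟨B, hB, colsE_of_colsF (hA.cols_valid _ _) hL⟩
  obtain ⟨D, hD, h1⟩ := ex hA.toInM h
  have t1 := h1.tabEq_transpose hD hA.toInM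
  rw [hA.symm] at t1
  rw [← (t1.wordEps hD.transpose hA.toInM i).2] at h
  obtain ⟨B, hB, h2⟩ := ex hD.transpose h
  exact ⟨B, hA.symm_of_rowE' hD hB h1 h2, _, hD.transpose, h2, h1⟩

/-! ### The diagonal action -/

theorem inS_extendZero {A : Mat m n} : InS m n (extendZero A) ↔ A ∈ symM m n := by
  constructor
  · intro h
    refine ⟨inM_extendZero.1 h.toInM, extendZero_injective ?_⟩
    rw [extendZero_transpose, h.symm]
  · intro h
    refine ⟨inM_extendZero.2 h.1, ?_⟩
    rw [← extendZero_transpose, h.2]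

theorem InM.exists_extendZero {A : ℕ → ℕ → ℕ} (hA : InM m n A) :
    ∃ B : Mat m n, extendZero B = A := ⟨_, hA.extendZero_of⟩

theorem diagE_eq_some {i : Index m n} {A B : Mat m n} (hA : A ∈ symM m n) :
    diagE i A = some B ↔ B ∈ bigM m n ∧ DiagE i (extendZero A) (extendZero B) := by
  rw [diagE, matEStar, onCols, hA.2, Option.bind_eq_some_iff]
  constructor
  · rintro ⟨C, h1, h2⟩
    obtain ⟨D, h3, rfl⟩ := Option.map_eq_some_iff.1 h1
    obtain ⟨h4, h5⟩ := (matE_eq_some hA.1).1 h3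
    obtain ⟨h6, h7⟩ := (matE_eq_some (transpose_mem_bigM h4)).1 h2
    rw [extendZero_transpose] at h7
    exact ⟨h6, _, inM_extendZero.2 h4, h5, h7⟩
  · rintro ⟨h1, D, h2, h3, h4⟩
    obtain ⟨D, rfl⟩ := h2.exists_extendZero
    have h5 := inM_extendZero.1 h2
    rw [← extendZero_transpose] at h4
    exact ⟨_, Option.map_eq_some_iff.2 ⟨D, (matE_eq_some hA.1).2 ⟨h5, h3⟩, rfl⟩,
      (matE_eq_some (transpose_mem_bigM h5)).2 ⟨h1, h4⟩⟩

theorem diagF_eq_some {i : Index m n} {A B : Mat m n} (hA : A ∈ symM m n) :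
    diagF i A = some B ↔ B ∈ symM m n ∧ DiagE i (extendZero B) (extendZero A) := by
  rw [diagF, matFStar, onCols, hA.2, Option.bind_eq_some_iff]
  constructor
  · rintro ⟨C, h1, h2⟩
    obtain ⟨D, h3, rfl⟩ := Option.map_eq_some_iff.1 h1
    obtain ⟨h4, h5⟩ := (matF_eq_some hA.1).1 h3
    obtain ⟨h6, h7⟩ := (matF_eq_some (transpose_mem_bigM h4)).1 h2
    rw [extendZero_transpose] at h7
    have h8 := inM_extendZero.2 h4
    exact ⟨inS_extendZero.1
      ((inS_extendZero.2 hA).symm_of_rowE' h8 (inM_extendZero.2 h6) h5 h7),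
      _, h8.transpose, h7, h5⟩
  · rintro ⟨h1, D, h2, h3, h4⟩
    obtain ⟨D, rfl⟩ := h2.exists_extendZero
    have h5 := inM_extendZero.1 h2
    rw [← extendZero_transpose] at h4
    exact ⟨_, Option.map_eq_some_iff.2 ⟨D.transpose,
      (matF_eq_some hA.1).2 ⟨transpose_mem_bigM h5, h4⟩, rfl⟩,
      (matF_eq_some h5).2 ⟨h1.1, h3⟩⟩

theorem diagE_mem_symM {i : Index m n} {A B : Mat m n} (hA : A ∈ symM m n)
    (h : diagE i A = some B) : B ∈ symM m n := by
  obtain ⟨h1, h2⟩ := (diagE_eq_some hA).1 h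
  exact inS_extendZero.1 (h2.symm (inS_extendZero.2 hA) (inM_extendZero.2 h1))

theorem diagF_iff_diagE {i : Index m n} {A B : Mat m n} (hA : A ∈ symM m n)
    (hB : B ∈ symM m n) : diagF i A = some B ↔ diagE i B = some A := by
  rw [diagF_eq_some hA, diagE_eq_some hB]
  exact ⟨fun h => ⟨hA.1, h.2⟩, fun h => ⟨hB, h.2⟩⟩

theorem diagE_spec {i : Index m n} {A B : Mat m n} (hA : A ∈ symM m n)
    (h : diagE i A = some B) :
    wordEps i ((biword A).map Prod.fst) = wordEps i ((biword B).map Prod.fst) + 1 ∧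
      wordPhi i ((biword B).map Prod.fst) = wordPhi i ((biword A).map Prod.fst) + 1 ∧
      wordWt ((biword B).map Prod.fst) = wordWt ((biword A).map Prod.fst) + root i := by
  obtain ⟨h1, h2⟩ := (diagE_eq_some hA).1 h
  rw [map_fst_biword, map_fst_biword]
  exact h2.spec (inS_extendZero.2 hA) (inM_extendZero.2 h1)

theorem diagE_eq_none_iff {i : Index m n} {A : Mat m n} (hA : A ∈ symM m n) :
    diagE i A = none ↔ wordEps i ((biword A).map Prod.fst) = 0 := by
  constructor
  · intro h
    by_contra h0
    rw [map_fst_biword] at h0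
    obtain ⟨B, hB, h1⟩ := (inS_extendZero.2 hA).exists_diagE h0
    obtain ⟨B, rfl⟩ := hB.exists_extendZero
    rw [(diagE_eq_some hA).2 ⟨inM_extendZero.1 hB, h1⟩] at h
    cases h
  · intro h
    by_contra h0
    obtain ⟨B, hB⟩ := Option.ne_none_iff_exists'.1 h0
    have := (diagE_spec hA hB).1
    omega

theorem diagF_eq_none_iff {i : Index m n} {A : Mat m n} (hA : A ∈ symM m n) :
    diagF i A = none ↔ wordPhi i ((biword A).map Prod.fst) = 0 := by
  constructor
  · intro h
    by_contra h0
    rw [map_fst_biword] at h0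
    obtain ⟨B, hB, h1⟩ := (inS_extendZero.2 hA).exists_diagE' h0
    obtain ⟨B, rfl⟩ := hB.toInM.exists_extendZero
    rw [(diagF_eq_some hA).2 ⟨inS_extendZero.1 hB, h1⟩] at h
    cases h
  · intro h
    by_contra h0
    obtain ⟨B, hB⟩ := Option.ne_none_iff_exists'.1 h0
    have hB' := ((diagF_eq_some hA).1 hB).1
    have := (diagE_spec hB' ((diagF_iff_diagE hA hB').1 hB)).2.1
    omega

/-- A counter that drops by one at each step and vanishes exactly where the operator gives `0` is
the number of possible steps. -/
theorem maxIter_eq {X : Type*} {g : X → Option X} {S : Set X} {c : X → ℕ}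
    (h0 : ∀ x ∈ S, g x = none ↔ c x = 0)
    (h1 : ∀ x ∈ S, ∀ y, g x = some y → y ∈ S ∧ c x = c y + 1) {x : X} (hx : x ∈ S) :
    maxIter g x = c x := by
  have key : ∀ k, ∀ x ∈ S, iter g k x ≠ none ↔ k ≤ c x := by
    intro k
    induction k with
    | zero => simp [iter]
    | succ k ih =>
      intro x hx
      rw [iter]
      rcases hg : g x with _ | y
      · have := (h0 x hx).1 hg
        simp [this]
      · obtain ⟨h2, h3⟩ := h1 x hx y hg
        rw [Option.bind_some, ih y h2, h3, Nat.succ_le_succ_iff]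
  have : {k | iter g k x ≠ none} = Set.Iic (c x) := by
    ext k
    exact key k x hx
  rw [maxIter, this, csSup_Iic]

theorem maxIter_diagE {i : Index m n} {A : Mat m n} (hA : A ∈ symM m n) :
    maxIter (diagE i) A = wordEps i ((biword A).map Prod.fst) :=
  maxIter_eq (S := symM m n) (fun _ h => diagE_eq_none_iff h)
    (fun _ h _ h' => ⟨diagE_mem_symM h h', (diagE_spec h h').1⟩) hA

theorem maxIter_diagF {i : Index m n} {A : Mat m n} (hA : A ∈ symM m n) :
    maxIter (diagF i) A = wordPhi i ((biword A).map Prod.fst) := by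
  refine maxIter_eq (S := symM m n) (c := fun A => wordPhi i ((biword A).map Prod.fst))
    (fun _ h => diagF_eq_none_iff h) (fun A h B h' => ?_) hA
  have hB := ((diagF_eq_some h).1 h').1
  exact ⟨hB, (diagE_spec hB ((diagF_iff_diagE h hB).1 h')).2.1⟩

/-! ### The crystal `𝔐` and its decomposition -/

namespace Precrystal

variable {B B₁ : Type*}

theorem induced_e_eq_some {C : Precrystal m n B} {g : B₁ ↪ B} {i : Index m n} {b b' : B₁} :
    (C.induced g).e i b = some b' ↔ C.e i (g b) = some (g b') := by
  simp only [induced]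
  split_ifs with h
  · constructor
    · intro h'
      rw [← Option.some.inj h']
      exact h.choose_spec
    · intro h'
      exact congrArg some (g.injective (Option.some.inj (h.choose_spec.symm.trans h')))
  · exact ⟨fun h' => (by cases h'), fun h' => absurd ⟨b', h'⟩ h⟩

theorem induced_f_eq_some {C : Precrystal m n B} {g : B₁ ↪ B} {i : Index m n} {b b' : B₁} :
    (C.induced g).f i b = some b' ↔ C.f i (g b) = some (g b') := by
  simp only [induced]
  split_ifs with h
  · constructor
    · intro h'
      rw [← Option.some.inj h']
      exact h.choose_spec
    · intro h'
      exact congrArg some (g.injective (Option.some.inj (h.choose_spec.symm.trans h')))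
  · exact ⟨fun h' => (by cases h'), fun h' => absurd ⟨b', h'⟩ h⟩

theorem IsCrystal.induced {C : Precrystal m n B} (hC : C.IsCrystal) (g : B₁ ↪ B) :
    (C.induced g).IsCrystal where
  phi_sub_eps i hi b := hC.phi_sub_eps i hi (g b)
  coroot_zero_nonneg i hi b := hC.coroot_zero_nonneg i hi (g b)
  phi_add_eps i hi b := hC.phi_add_eps i hi (g b)
  of_e i b b' h := hC.of_e i (g b) (g b') (induced_e_eq_some.1 h)
  of_f i b b' h := hC.of_f i (g b) (g b') (induced_f_eq_some.1 h)
  f_iff_e i b b' := by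
    rw [induced_e_eq_some, induced_f_eq_some]
    exact hC.f_iff_e i (g b) (g b')

end Precrystal

theorem diagonal_stableOn (m n : ℕ) : (diagonal m n).StableOn (symM m n) := by
  rintro i A hA B (h | h)
  · exact diagE_mem_symM hA h
  · exact ((diagF_eq_some hA).1 h).1

theorem symCrystal_eps (i : Index m n) (A : symM m n) :
    (symCrystal m n).eps i A = wordEps i ((biword A.1).map Prod.fst) := maxIter_diagE A.2

theorem symCrystal_phi (i : Index m n) (A : symM m n) :
    (symCrystal m n).phi i A = wordPhi i ((biword A.1).map Prod.fst) := maxIter_diagF A.2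

theorem symCrystal_wt (A : symM m n) :
    (symCrystal m n).wt A = wordWt ((biword A.1).map Prod.fst) := rfl

theorem symCrystal_e {i : Index m n} {A B : symM m n} :
    (symCrystal m n).e i A = some B ↔ diagE i A.1 = some B.1 :=
  Precrystal.induced_e_eq_some

theorem symCrystal_f {i : Index m n} {A B : symM m n} :
    (symCrystal m n).f i A = some B ↔ diagF i A.1 = some B.1 :=
  Precrystal.induced_f_eq_some

theorem symCrystal_isCrystal (m n : ℕ) : (symCrystal m n).IsCrystal where
  phi_sub_eps i hi A := by
    rw [symCrystal_eps, symCrystal_phi, symCrystal_wt]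
    exact (wordCrystal_isCrystal m n).phi_sub_eps i hi _
  coroot_zero_nonneg i hi A := (wordCrystal_isCrystal m n).coroot_zero_nonneg i hi _
  phi_add_eps i hi A := by
    rw [symCrystal_eps, symCrystal_phi, symCrystal_wt]
    exact (wordCrystal_isCrystal m n).phi_add_eps i hi _
  of_e i A B h := by
    rw [symCrystal_eps, symCrystal_eps, symCrystal_phi, symCrystal_phi, symCrystal_wt,
      symCrystal_wt]
    exact diagE_spec A.2 (symCrystal_e.1 h)
  of_f i A B h := by
    rw [symCrystal_eps, symCrystal_eps, symCrystal_phi, symCrystal_phi, symCrystal_wt,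
      symCrystal_wt]
    obtain ⟨h1, h2, h3⟩ := diagE_spec B.2 ((diagF_iff_diagE A.2 B.2).1 (symCrystal_f.1 h))
    exact ⟨h1, h2, by rw [h3, add_sub_cancel_right]⟩
  f_iff_e i A B := by
    rw [symCrystal_e, symCrystal_f, diagF_iff_diagE A.2 B.2]

theorem oddStat_eq (A : Mat m n) : oddStat A = oStat m (extendZero A) (m + n) := by
  rw [oddStat, oStat, Finset.sum_range, Finset.card_filter, Finset.sum_filter,
    ← Finset.sum_add_distrib]
  refine Finset.sum_congr rfl fun b _ => ?_
  rw [extendZero_val]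
  unfold deg
  have := Nat.mod_two_eq_zero_or_one (A b b)
  split_ifs <;> simp_all

theorem oddStat_diagE {i : Index m n} {A B : Mat m n} (hA : A ∈ symM m n)
    (h : diagE i A = some B) : oddStat A = oddStat B := by
  obtain ⟨h1, h2⟩ := (diagE_eq_some hA).1 h
  rw [oddStat_eq, oddStat_eq, h2.oStat_eq (inS_extendZero.2 hA) (inM_extendZero.2 h1)]

theorem symCrystal_stableOn (m n k : ℕ) : (symCrystal m n).StableOn (symMk m n k) := by
  rintro i A hA B (h | h)
  · exact (oddStat_diagE A.2 (symCrystal_e.1 h)).symm.trans hA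
  · exact (oddStat_diagE B.2 ((diagF_iff_diagE A.2 B.2).1 (symCrystal_f.1 h))).trans hA

theorem symMk_isSubcrystal (m n k : ℕ) : (symCrystal m n).IsSubcrystal (symMk m n k) :=
  ⟨symCrystal_stableOn m n k, (symCrystal_isCrystal m n).induced _⟩

namespace Precrystal

variable {B ι : Type*}

/-- A crystal that is the disjoint union of stable subsets is their direct sum. -/
theorem isIso_directSum {C : Precrystal m n B} {S : ι → Set B} (hS : ∀ k, C.StableOn (S k))
    (ψ : (Σ k, S k) ≃ B) (hψ : ∀ x, ψ x = x.2.1) :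
    IsIso (directSum fun k => C.restrict (S k)) C ψ where
  wt x := by rw [hψ]; rfl
  eps i x := by rw [hψ]; rfl
  phi i x := by rw [hψ]; rfl
  e i x := by
    obtain ⟨k, b, hb⟩ := x
    rw [hψ]
    refine Option.ext fun b' => ?_
    simp only [directSum, Option.map_map, Option.map_eq_some_iff, Function.comp, hψ]
    constructor
    · intro h
      exact ⟨⟨b', hS k i b hb b' (Or.inl h)⟩, induced_e_eq_some.2 h, rfl⟩
    · rintro ⟨c, h, rfl⟩
      exact induced_e_eq_some.1 h
  f i x := by
    obtain ⟨k, b, hb⟩ := x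
    rw [hψ]
    refine Option.ext fun b' => ?_
    simp only [directSum, Option.map_map, Option.map_eq_some_iff, Function.comp, hψ]
    constructor
    · intro h
      exact ⟨⟨b', hS k i b hb b' (Or.inr h)⟩, induced_f_eq_some.2 h, rfl⟩
    · rintro ⟨c, h, rfl⟩
      exact induced_f_eq_some.1 h

end Precrystal

theorem symM_directSum (m n : ℕ) :
    ∃ ψ : (Σ k, symMk m n k) ≃ symM m n, (∀ x, ψ x = x.2.1) ∧
      Precrystal.IsIso
        (Precrystal.directSum fun k => (symCrystal m n).restrict (symMk m n k))
        (symCrystal m n) ψ := by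
  let ψ : (Σ k, symMk m n k) ≃ symM m n :=
    { toFun := fun x => x.2.1
      invFun := fun A => ⟨oddStat A.1, A, rfl⟩
      left_inv := by rintro ⟨k, A, rfl⟩; rfl
      right_inv := fun A => rfl }
  exact ⟨ψ, fun _ => rfl, Precrystal.isIso_directSum (symCrystal_stableOn m n) ψ fun _ => rfl⟩

/-! ### Tableaux -/

/-- In a sorted list the letters below `b` form an initial segment. This turns comparisons of
tableau entries into comparisons of partial sums. -/
theorem getElem_lt_iff {L : List (Letter m n)} (hL : L.Pairwise (· ≤ ·)) (b r : ℕ)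
    (hr : r < L.length) : (L[r] : ℕ) < b ↔ r < L.countP fun x : Letter m n => (x : ℕ) < b := by
  induction L generalizing r with
  | nil => simp at hr
  | cons x L ih =>
    obtain ⟨h1, h2⟩ := List.pairwise_cons.1 hL
    rw [List.countP_cons]
    by_cases hx : (x : ℕ) < b
    · cases r with
      | zero => simp [hx]
      | succ r => simp [hx, ih h2 r (by simpa using hr)]
    · have h3 : L.countP (fun x : Letter m n => (x : ℕ) < b) = 0 := by
        rw [List.countP_eq_zero]
        intro y hy
        have := Fin.le_def.1 (h1 y hy)
        simp only [decide_eq_true_eq]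
        omega
      cases r with
      | zero => simp [hx, h3]
      | succ r =>
        have := Fin.le_def.1 (h1 _ (List.getElem_mem (show r < L.length by simpa using hr)))
        simp only [List.getElem_cons_succ, h3, hx, decide_false, Bool.false_eq_true, if_false]
        omega

theorem countP_lt_succ (L : List (Letter m n)) (b : ℕ) :
    L.countP (fun x : Letter m n => (x : ℕ) < b + 1) =
      L.countP (fun x : Letter m n => (x : ℕ) < b) + L.countP fun x : Letter m n => (x : ℕ) = b := by
  induction L with
  | nil => rfl
  | cons x L ih =>
    simp only [List.countP_cons, decide_eq_true_eq]
    split_ifs <;> omega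

theorem psum_countP (L : List (Letter m n)) (b : ℕ) :
    psum (fun b => L.countP fun x : Letter m n => (x : ℕ) = b) b =
      L.countP fun x : Letter m n => (x : ℕ) < b := by
  induction b with
  | zero => simp [psum]
  | succ b ih => rw [psum, ih, countP_lt_succ]

theorem pairwise_colWord (v : ℕ → ℕ) : (colWord m n 1 v).Pairwise (· ≤ ·) := by
  rw [colWord, if_neg one_ne_zero, List.pairwise_flatMap]
  refine ⟨fun b _ => ?_, (List.pairwise_lt_finRange _).imp fun {a b} h x hx y hy => ?_⟩
  · rw [List.pairwise_replicate]
    exact Or.inr le_rfl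
  · rw [List.eq_of_mem_replicate hx, List.eq_of_mem_replicate hy]
    exact h.le

theorem eq_colWord {L : List (Letter m n)} (hL : L.Pairwise (· ≤ ·)) {v : ℕ → ℕ}
    (hv : ∀ b : Letter m n, v b = L.count b) : L = colWord m n 1 v := by
  refine List.Perm.eq_of_pairwise (fun _ _ _ _ h h' => le_antisymm h h') hL (pairwise_colWord v) ?_
  rw [List.perm_iff_count]
  intro b
  rw [count_colWord, hv]

theorem countP_eq_count (L : List (Letter m n)) (b : Letter m n) :
    L.countP (fun x : Letter m n => (x : ℕ) = (b : ℕ)) = L.count b := by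
  rw [List.count]
  exact List.countP_congr fun x _ => by simp [Fin.ext_iff]

theorem countP_colWord {v : ℕ → ℕ} (hv : ∀ b, m + n ≤ b → v b = 0) (b : ℕ) :
    ((colWord m n 1 v).countP fun x : Letter m n => (x : ℕ) < b) = psum v b := by
  rw [← psum_countP]
  congr 1
  funext b
  rcases Nat.lt_or_ge b (m + n) with h | h
  · exact (countP_eq_count _ (⟨b, h⟩ : Letter m n)).trans (count_colWord 1 v ⟨b, h⟩)
  · rw [hv b h, List.countP_eq_zero]
    intro x _
    have := x.2
    simp only [decide_eq_true_eq]
    omega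

theorem length_colWord {v : ℕ → ℕ} (hv : ∀ b, m + n ≤ b → v b = 0) :
    (colWord m n 1 v).length = psum v (m + n) := by
  rw [← countP_colWord hv, eq_comm, List.countP_eq_length]
  intro x _
  simp [x.2]

theorem tabCols_eq (m N K : ℕ) (A : ℕ → ℕ → ℕ) :
    tabCols m N K A = (List.range K).reverse.map fun t => (1, colState m ((resid m)^[t] A) N) := by
  induction K generalizing A with
  | zero => rfl
  | succ K ih =>
    rw [tabCols, ih, List.range_succ_eq_map, List.reverse_cons, List.map_append,
      ← List.map_reverse, List.map_map]
    rfl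

namespace HookTableau

variable {μ : YoungDiagram} (T : HookTableau m n μ)

theorem length_column (t : ℕ) : (T.column t).length = μ.colLen t := by simp [column]

theorem getElem_column {r t : ℕ} (h : r < (T.column t).length) :
    (T.column t)[r] =
      T.entry ⟨(r, t), YoungDiagram.mem_iff_lt_colLen.2 (T.length_column t ▸ h)⟩ := by
  simp [column]

theorem pairwise_column (t : ℕ) : (T.column t).Pairwise (· ≤ ·) := by
  rw [List.pairwise_iff_getElem]
  intro i j hi hj hij
  rw [T.getElem_column hi, T.getElem_column hj]
  exact T.col_weak _ _ rfl hij

/-- The number of letters before `b` in the column `t`. -/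
def below (t b : ℕ) : ℕ := (T.column t).countP fun x : Letter m n => (x : ℕ) < b

/-- The multiplicity of `b` in the column `t`. -/
def mult (t b : ℕ) : ℕ := (T.column t).countP fun x : Letter m n => (x : ℕ) = b

theorem psum_mult (t b : ℕ) : psum (T.mult t) b = T.below t b := psum_countP _ b

theorem mult_eq_zero (t : ℕ) {b : ℕ} (hb : m + n ≤ b) : T.mult t b = 0 := by
  rw [mult, List.countP_eq_zero]
  intro x _
  have := x.2
  simp only [decide_eq_true_eq]
  omega

theorem column_eq (t : ℕ) : T.column t = colWord m n 1 (T.mult t) :=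
  eq_colWord (T.pairwise_column t) fun b => countP_eq_count _ b

theorem below_le (t b : ℕ) : T.below t b ≤ μ.colLen t :=
  (List.countP_le_length).trans_eq (T.length_column t)

theorem below_top (t : ℕ) : T.below t (m + n) = μ.colLen t := by
  rw [← T.length_column t, below, List.countP_eq_length]
  intro x _
  simp [x.2]

theorem entry_lt_iff {r t : ℕ} (h : (r, t) ∈ μ) (b : ℕ) :
    (T.entry ⟨(r, t), h⟩ : ℕ) < b ↔ r < T.below t b := by
  have h' : r < (T.column t).length := by
    rw [T.length_column]
    exact YoungDiagram.mem_iff_lt_colLen.1 h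
  rw [below, ← getElem_lt_iff (T.pairwise_column t) b r h', T.getElem_column h']

/-- The tableau conditions in terms of partial sums: `step` is strictness of the letters of degree 0
down a column, `desc` weak increase along rows, and `hook` strictness of the letters of degree 1
along rows. -/
theorem fits (t : ℕ) : Fits m (T.below t) (T.below (t + 1)) := by
  have mem : ∀ {r t b : ℕ}, r < T.below t b → (r, t) ∈ μ := fun {r t b} h =>
    YoungDiagram.mem_iff_lt_colLen.2 (h.trans_le (T.below_le t b))
  have left : ∀ {r t : ℕ}, (r, t + 1) ∈ μ → (r, t) ∈ μ := fun h =>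
    μ.up_left_mem le_rfl (Nat.le_succ _) h
  refine ⟨by simp [below], fun b => ?_, fun b hb => ?_, fun b => ?_, fun b hb => ?_⟩
  · exact List.countP_mono_left fun x _ h => by simp only [decide_eq_true_eq] at h ⊢; omega
  -- Otherwise the row `below t b` and the next one both hold the letter `b`, of degree 0.
  · by_contra! h
    have m1 : (T.below t b, t) ∈ μ := mem (show _ < T.below t (b + 1) by omega)
    have m2 : (T.below t b + 1, t) ∈ μ := mem h
    have e1 := (T.entry_lt_iff m1 (b + 1)).2 (by omega)
    have e2 := (T.entry_lt_iff m2 (b + 1)).2 h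
    have e3 := mt (T.entry_lt_iff m1 b).1 (by omega)
    have e4 := mt (T.entry_lt_iff m2 b).1 (by omega)
    have e5 := T.col_strict ⟨_, m1⟩ ⟨_, m2⟩ rfl (Nat.lt_succ_self _)
      (by rw [deg, if_pos (by omega)]) (by rw [deg, if_pos (by omega)])
    rw [Fin.lt_def] at e5
    omega
  · by_contra! h
    have m1 := mem h
    have e1 := (T.entry_lt_iff m1 b).2 h
    have e2 := T.row_weak ⟨_, left m1⟩ ⟨_, m1⟩ rfl (Nat.lt_succ_self _)
    have e3 := (T.entry_lt_iff (left m1) b).1 ((Fin.le_def.1 e2).trans_lt e1)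
    exact lt_irrefl _ e3
  -- In the row `below t b`, the entry of column `t` is at least `b` and that of column `t + 1` at
  -- most `b`; both would be the letter `b`, of degree 1.
  · by_contra! h
    have m1 := mem h
    have e1 := (T.entry_lt_iff m1 (b + 1)).2 h
    have e2 := Fin.le_def.1 (T.row_weak ⟨_, left m1⟩ ⟨_, m1⟩ rfl (Nat.lt_succ_self _))
    have e3 := mt (T.entry_lt_iff (left m1) b).1 (lt_irrefl _)
    have e4 := T.row_strict ⟨_, left m1⟩ ⟨_, m1⟩ rfl (Nat.lt_succ_self _)
      (by rw [deg, if_neg (by omega)]) (by rw [deg, if_neg (by omega)])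
    rw [Fin.lt_def] at e4
    omega

theorem colLen_eq_zero {t : ℕ} (ht : μ.rowLen 0 ≤ t) : μ.colLen t = 0 := by
  by_contra h
  have := YoungDiagram.mem_iff_lt_rowLen.1
    (YoungDiagram.mem_iff_lt_colLen.2 (Nat.pos_of_ne_zero h))
  omega

/-- `T` is the tableau of `A`. -/
def IsTabOf (A : ℕ → ℕ → ℕ) : Prop :=
  ∀ t, colState m ((resid m)^[t] A) (m + n) = T.mult t

theorem IsTabOf.lpp {T : HookTableau m n μ} {A : ℕ → ℕ → ℕ} (h : T.IsTabOf A) (t b : ℕ) :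
    lpp m ((resid m)^[t] A) b (m + n) = T.below t b := by
  rw [GLCrystal.lpp, h t, psum_mult]

theorem exists_isTabOf : ∃ A, InS m n A ∧ T.IsTabOf A := by
  obtain ⟨A, hA, h⟩ := exists_symm_lpp_iterate_eq (m := m) (n := n) (μ.rowLen 0) T.below T.fits
    fun t b ht => Nat.le_zero.1 ((T.below_le t b).trans_eq (colLen_eq_zero ht))
  refine ⟨A, hA, fun t => ?_⟩
  funext b
  rcases Nat.lt_or_ge b (m + n) with hb | hb
  · have h1 := h t b hb.le
    have h2 := h t (b + 1) hb
    rw [GLCrystal.lpp, ← psum_mult] at h1 h2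
    rw [psum, psum] at h2
    omega
  · rw [(hA.toInM.iterate t).colState_eq_zero _ hb, T.mult_eq_zero t hb]

theorem IsTabOf.unique {T : HookTableau m n μ} {A B : ℕ → ℕ → ℕ} (hA : InS m n A) (hB : InS m n B)
    (h : T.IsTabOf A) (h' : T.IsTabOf B) : A = B :=
  hA.eq_of_lpp hB fun t b _ => by rw [h.lpp, h'.lpp]

theorem IsTabOf.iterate_eq_zero {T : HookTableau m n μ} {A : ℕ → ℕ → ℕ} (h : T.IsTabOf A)
    (hA : InM m n A) {K : ℕ} (hK : μ.rowLen 0 ≤ K) : (resid m)^[K] A = fun _ _ => 0 := by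
  apply (hA.iterate K).eq_zero_of_lpp
  rw [h.lpp, below_top, colLen_eq_zero hK]

theorem IsTabOf.word {T : HookTableau m n μ} {A : ℕ → ℕ → ℕ} (h : T.IsTabOf A) {K : ℕ}
    (hK : μ.rowLen 0 ≤ K) : colsWord m n (tabCols m (m + n) K A) = T.word := by
  rw [tabCols_eq, colsWord, List.flatMap_map, HookTableau.word]
  simp only [h _, ← column_eq]
  induction K, hK using Nat.le_induction with
  | base => rfl
  | succ k hk ih =>
    have : T.column k = [] := by
      rw [← List.length_eq_zero_iff, T.length_column, colLen_eq_zero hk]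
    rw [List.range_succ, List.reverse_append, List.flatMap_append, ih]
    simp [this]

theorem IsTabOf.shape_eq {μ' : YoungDiagram} {T : HookTableau m n μ} {T' : HookTableau m n μ'}
    {A A' : ℕ → ℕ → ℕ} (h : T.IsTabOf A) (h' : T'.IsTabOf A')
    (hl : ∀ t, GLCrystal.lpp m ((resid m)^[t] A) (m + n) (m + n) =
      GLCrystal.lpp m ((resid m)^[t] A') (m + n) (m + n)) : μ = μ' := by
  have h1 : ∀ t, μ.colLen t = μ'.colLen t := fun t => by
    rw [← T.below_top, ← T'.below_top, ← h.lpp, ← h'.lpp, hl]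
  ext ⟨r, t⟩
  rw [YoungDiagram.mem_cells, YoungDiagram.mem_cells, YoungDiagram.mem_iff_lt_colLen,
    YoungDiagram.mem_iff_lt_colLen, h1]

theorem IsTabOf.tab_eq {T T' : HookTableau m n μ} {A : ℕ → ℕ → ℕ} (h : T.IsTabOf A)
    (h' : T'.IsTabOf A) : T = T' :=
  word_injective (by rw [← h.word le_rfl, ← h'.word le_rfl])

/-- With columns counted from 0, a row of odd length ends in a column `2 * k`, which is then longer
than the column `2 * k + 1`. -/
theorem IsTabOf.isEven_iff {T : HookTableau m n μ} {A : ℕ → ℕ → ℕ} (h : T.IsTabOf A)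
    (hA : InS m n A) : IsEven μ ↔ oStat m A (m + n) = 0 := by
  rw [hA.oStat_eq_zero_iff]
  simp only [h.lpp, below_top]
  constructor
  · intro he k
    have h1 := μ.colLen_anti (2 * k) (2 * k + 1) (Nat.le_succ _)
    by_contra hne
    have m1 : (μ.colLen (2 * k + 1), 2 * k) ∈ μ := YoungDiagram.mem_iff_lt_colLen.2 (by omega)
    have m2 : (μ.colLen (2 * k + 1), 2 * k + 1) ∉ μ := fun hm =>
      lt_irrefl _ (YoungDiagram.mem_iff_lt_colLen.1 hm)
    rw [YoungDiagram.mem_iff_lt_rowLen] at m1 m2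
    obtain ⟨r, hr⟩ := he (μ.colLen (2 * k + 1))
    omega
  · intro he r
    by_contra hr
    obtain ⟨k, hk⟩ := Nat.not_even_iff_odd.1 hr
    have m1 : (r, 2 * k) ∈ μ := YoungDiagram.mem_iff_lt_rowLen.2 (by omega)
    have m2 : (r, 2 * k + 1) ∉ μ := fun hm => by
      have := YoungDiagram.mem_iff_lt_rowLen.1 hm
      omega
    rw [YoungDiagram.mem_iff_lt_colLen] at m1 m2
    rw [he k] at m1
    exact m2 m1

end HookTableau

/-! ### From matrices to tableaux -/

theorem InM.fits {A : ℕ → ℕ → ℕ} (hA : InM m n A) :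
    Fits m (fun b => lpp m A b (m + n)) fun b => lpp m (GLCrystal.resid m A) b (m + n) where
  zero := rfl
  mono b := (hA.cell_spec b _).2.1
  step b hb := (hA.cell_spec b _).2.2.2.2.1 hb
  desc b := (lpp_resid_le hA b _).1
  hook b hb := (lpp_resid_le hA (b + 1) _).2.1 (by omega)

theorem InM.fits_iterate {A : ℕ → ℕ → ℕ} (hA : InM m n A) (t : ℕ) :
    Fits m (fun b => lpp m ((GLCrystal.resid m)^[t] A) b (m + n))
      fun b => lpp m ((GLCrystal.resid m)^[t + 1] A) b (m + n) := by
  have := (hA.iterate t).fits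
  rwa [← Function.iterate_succ_apply' (f := GLCrystal.resid m)] at this

/-- The column 0 holds each of the first `m` letters at most once, and each further column gives up
one letter of degree 1. At `t = n` all letters are used, which is the hook condition. -/
theorem Fits.hook_le {P : ℕ → ℕ → ℕ} (h : ∀ t, Fits m (P t) (P (t + 1))) (t : ℕ) :
    P t (m + t) ≤ m := by
  induction t with
  | zero =>
    have : ∀ b ≤ m, P 0 b ≤ b := by
      intro b
      induction b with
      | zero => exact fun _ => (h 0).zero.le
      | succ b ih =>
        intro hb
        have h1 := (h 0).step b hb
        have h2 := ih (by omega)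
        omega
    exact this m le_rfl
  | succ t ih => exact ((h t).hook (m + t) (Nat.le_add_right _ _)).trans ih

theorem HookTableau.isHook {μ : YoungDiagram} (T : HookTableau m n μ) : IsHook m n μ := by
  have h := Fits.hook_le T.fits n
  rw [T.below_top] at h
  by_contra hn
  have := YoungDiagram.mem_iff_lt_colLen.1
    (YoungDiagram.mem_iff_lt_rowLen.2 (Nat.lt_of_not_le hn))
  omega

theorem Fits.anti {P : ℕ → ℕ → ℕ} (h : ∀ t, Fits m (P t) (P (t + 1))) (b : ℕ) :
    Antitone fun t => P t b := antitone_nat_of_succ_le fun t => (h t).desc b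

/-- The Young diagram with columns of lengths `l 0 ≥ l 1 ≥ ⋯`. -/
def ofColLens (l : ℕ → ℕ) (hl : Antitone l) (K : ℕ) : YoungDiagram where
  cells := (Finset.range (l 0) ×ˢ Finset.range K).filter fun c => c.1 < l c.2
  isLowerSet := by
    rintro ⟨r, t⟩ ⟨r', t'⟩ ⟨h1, h2⟩ h
    simp only [Finset.coe_filter, Finset.mem_product, Finset.mem_range, Set.mem_ofPred_eq] at *
    have := hl h2
    omega

theorem mem_ofColLens {l : ℕ → ℕ} {hl : Antitone l} {K : ℕ} (hK : l K = 0) {r t : ℕ} :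
    (r, t) ∈ ofColLens l hl K ↔ r < l t := by
  rw [← YoungDiagram.mem_cells]
  simp only [ofColLens, Finset.mem_filter, Finset.mem_product, Finset.mem_range]
  have h1 := hl (Nat.zero_le t)
  have h2 : K ≤ t → l t ≤ l K := fun h => hl h
  omega

/-- Each column is filled by sorting its letters. The entry in row `r` of column `t` is below `b`
exactly when `r < P t b`, so the inequalities of `Fits` become the tableau conditions. -/
theorem InM.exists_tab {A : ℕ → ℕ → ℕ} (hA : InM m n A) :
    ∃ (μ : YoungDiagram) (T : HookTableau m n μ), T.IsTabOf A := by
  obtain ⟨K, hK⟩ := hA.exists_iterate_eq_zero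
  set P : ℕ → ℕ → ℕ := fun t b => lpp m ((GLCrystal.resid m)^[t] A) b (m + n) with hP
  set C : ℕ → ℕ → ℕ := fun t => GLCrystal.colState m ((GLCrystal.resid m)^[t] A) (m + n) with hC
  have hF : ∀ t, Fits m (P t) (P (t + 1)) := hA.fits_iterate
  have hPK : P K (m + n) = 0 := by
    simp only [hP, hK K le_rfl, lpp_zero]
  have hPC : ∀ t b, psum (C t) b = P t b := fun _ _ => rfl
  have hC0 : ∀ t b, m + n ≤ b → C t b = 0 := fun t b hb => (hA.iterate t).colState_eq_zero _ hb
  clear_value P C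
  set μ := ofColLens (fun t => P t (m + n)) (Fits.anti hF _) K with hμ
  have hmem : ∀ {r t}, (r, t) ∈ μ ↔ r < P t (m + n) := fun {r t} =>
    mem_ofColLens (l := fun t => P t (m + n)) hPK
  clear_value μ
  have hlen : ∀ t, (colWord m n 1 (C t)).length = P t (m + n) := fun t => by
    rw [length_colWord (hC0 t), hPC]
  have hcol : ∀ t, μ.colLen t = P t (m + n) := fun t => by
    have h1 : ∀ r, r < μ.colLen t ↔ r < P t (m + n) := fun r => by
      rw [← YoungDiagram.mem_iff_lt_colLen, hmem]
    have h2 := h1 (μ.colLen t)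
    have h3 := h1 (P t (m + n))
    omega
  have hlt : ∀ r t (h : r < (colWord m n 1 (C t)).length) b,
      ((colWord m n 1 (C t))[r] : ℕ) < b ↔ r < P t b := fun r t h b => by
    rw [getElem_lt_iff (pairwise_colWord _) b r h, countP_colWord (hC0 t), hPC]
  have hb : ∀ c : {c : ℕ × ℕ // c ∈ μ}, c.1.1 < (colWord m n 1 (C c.1.2)).length := fun c => by
    rw [hlen]
    exact hmem.1 c.2
  set E : {c : ℕ × ℕ // c ∈ μ} → Letter m n := fun c => (colWord m n 1 (C c.1.2))[c.1.1]'(hb c)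
    with hE
  have hElt : ∀ (c : {c : ℕ × ℕ // c ∈ μ}) b, (E c : ℕ) < b ↔ c.1.1 < P c.1.2 b := fun c b =>
    hlt c.1.1 c.1.2 (hb c) b
  have hdesc : ∀ {t t' b}, t ≤ t' → P t' b ≤ P t b := fun h => Fits.anti hF _ h
  have hmono : ∀ {t b b'}, b ≤ b' → P t b ≤ P t b' := fun h =>
    monotone_nat_of_le_succ (hF _).mono h
  let T : HookTableau m n μ :=
    { entry := E
      row_weak := by
        rintro ⟨⟨r, t⟩, hc⟩ ⟨⟨r', t'⟩, hd⟩ h1 h2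
        obtain rfl : r = r' := h1
        rw [Fin.le_def, ← Nat.lt_succ_iff, hElt]
        exact ((hElt ⟨(r, t'), hd⟩ _).1 (Nat.lt_succ_self _)).trans_le (hdesc (le_of_lt h2))
      col_weak := by
        rintro ⟨⟨r, t⟩, hc⟩ ⟨⟨r', t'⟩, hd⟩ h1 h2
        obtain rfl : t = t' := h1
        rw [Fin.le_def, ← Nat.lt_succ_iff, hElt]
        exact lt_trans h2 ((hElt _ _).1 (Nat.lt_succ_self _))
      row_strict := by
        rintro ⟨⟨r, t⟩, hc⟩ ⟨⟨r', t'⟩, hd⟩ h1 h2 - h3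
        obtain rfl : r = r' := h1
        rw [Fin.lt_def, hElt]
        have h4 : m ≤ (E ⟨(r, t'), hd⟩ : ℕ) := by
          unfold deg at h3
          split_ifs at h3
          omega
        exact ((hElt ⟨(r, t'), hd⟩ _).1 (Nat.lt_succ_self _)).trans_le
          ((hdesc (Nat.succ_le_of_lt h2)).trans ((hF t).hook _ h4))
      col_strict := by
        rintro ⟨⟨r, t⟩, hc⟩ ⟨⟨r', t'⟩, hd⟩ h1 h2 - h3
        obtain rfl : t = t' := h1
        rw [Fin.lt_def, hElt]
        have h4 : (E ⟨(r', t), hd⟩ : ℕ) < m := by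
          unfold deg at h3
          split_ifs at h3
          omega
        have h5 := (hElt ⟨(r', t), hd⟩ (E ⟨(r', t), hd⟩ + 1)).1 (Nat.lt_succ_self _)
        have h6 := (hF t).step _ h4
        dsimp only at h2 h5 ⊢
        omega }
  refine ⟨μ, T, fun t => ?_⟩
  have hTt : T.column t = colWord m n 1 (C t) := by
    apply List.ext_getElem
    · rw [T.length_column, hlen, hcol]
    · intro r h1 h2
      rw [T.getElem_column h1]
  funext b
  rw [HookTableau.mult, hTt]
  rcases Nat.lt_or_ge b (m + n) with h | h
  · have := (countP_eq_count (colWord m n 1 (C t)) (⟨b, h⟩ : Letter m n)).trans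
      (count_colWord 1 (C t) ⟨b, h⟩)
    simp only at this
    rw [this, hC]
  · rw [← hTt, ← HookTableau.mult, T.mult_eq_zero t h, (hA.iterate t).colState_eq_zero _ h]

/-! ### The isomorphism for `𝔐_0` -/

/-- The set of all hook tableaux whose shape is even. -/
abbrev EvenTab (m n : ℕ) : Type :=
  Σ μ : {μ : YoungDiagram // IsHook m n μ ∧ IsEven μ}, HookTableau m n μ.1

theorem exists_equiv_evenTab (m n : ℕ) :
    ∃ ψ : symMk m n 0 ≃ EvenTab m n, ∀ A, (ψ A).2.IsTabOf (extendZero A.1.1) := by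
  have hS : ∀ A : symMk m n 0, InS m n (extendZero A.1.1) := fun A => inS_extendZero.2 A.1.2
  have h1 : ∀ A : symMk m n 0, ∃ x : EvenTab m n, x.2.IsTabOf (extendZero A.1.1) := by
    intro A
    obtain ⟨μ, T, hT⟩ := (hS A).toInM.exists_tab
    have h0 : oStat m (extendZero A.1.1) (m + n) = 0 := (oddStat_eq A.1.1).symm.trans A.2
    exact ⟨⟨⟨μ, T.isHook, (hT.isEven_iff (hS A)).2 h0⟩, T⟩, hT⟩
  choose g hg using h1
  refine ⟨Equiv.ofBijective g ⟨fun A B h => ?_, fun x => ?_⟩, hg⟩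
  · have hA := hg A
    rw [h] at hA
    exact Subtype.ext (Subtype.ext
      (extendZero_injective (hA.unique (hS A) (hS B) (hg B))))
  · obtain ⟨⟨μ, hμ, he⟩, T⟩ := x
    obtain ⟨A, hA, hT⟩ := T.exists_isTabOf
    obtain ⟨A, rfl⟩ := hA.toInM.exists_extendZero
    have h0 := (oddStat_eq A).trans ((hT.isEven_iff hA).1 he)
    refine ⟨⟨⟨A, inS_extendZero.1 hA⟩, h0⟩, ?_⟩
    have hx := hg ⟨⟨A, inS_extendZero.1 hA⟩, h0⟩
    -- The tableau attached to `A` lives over its own shape; the shapes are identified through the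
    -- column lengths before the tableaux can be compared.
    generalize g ⟨⟨A, inS_extendZero.1 hA⟩, h0⟩ = y at hx
    obtain ⟨⟨μ', hμ', he'⟩, T'⟩ := y
    obtain rfl := hx.shape_eq hT fun _ => rfl
    obtain rfl := hx.tab_eq hT
    rfl

theorem HookTableau.IsTabOf.wordEps {μ : YoungDiagram} {T : HookTableau m n μ} {A : Mat m n}
    (h : T.IsTabOf (extendZero A)) (hA : A ∈ bigM m n) (i : Index m n) :
    wordEps i T.word = GLCrystal.wordEps i ((biword A).map Prod.fst) ∧
      wordPhi i T.word = wordPhi i ((biword A).map Prod.fst) := by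
  have hA' := inM_extendZero.2 hA
  rw [← h.word le_rfl, map_fst_biword]
  exact wordEps_rowWord i hA' (h.iterate_eq_zero hA' le_rfl)

theorem HookTableau.IsTabOf.count_word {μ : YoungDiagram} {T : HookTableau m n μ} {A : Mat m n}
    (h : T.IsTabOf (extendZero A)) (hA : A ∈ bigM m n) (b : Letter m n) :
    T.word.count b = ((biword A).map Prod.fst).count b := by
  have hA' := inM_extendZero.2 hA
  rw [← h.word le_rfl, map_fst_biword]
  exact count_tabCols hA' (h.iterate_eq_zero hA' le_rfl) b

theorem HookTableau.IsTabOf.wordE {μ μ' : YoungDiagram} {T : HookTableau m n μ}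
    {T' : HookTableau m n μ'} {A B : Mat m n} (h : T.IsTabOf (extendZero A))
    (h' : T'.IsTabOf (extendZero B)) (hA : A ∈ symM m n) {i : Index m n}
    (hAB : diagE i A = some B) : μ = μ' ∧ wordE i T.word = some T'.word := by
  obtain ⟨hB, hd⟩ := (diagE_eq_some hA).1 hAB
  have hA' := inS_extendZero.2 hA
  have hB' := inM_extendZero.2 hB
  have hμ := h.shape_eq h' (hd.lpp_top hA' hB')
  refine ⟨hμ, ?_⟩
  have h1 := hd.tabCols hA' hB' (K := μ.rowLen 0) (h.iterate_eq_zero hA'.toInM le_rfl)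
    (h'.iterate_eq_zero hB' (by rw [hμ]))
  rwa [h.word le_rfl, h'.word (by rw [hμ])] at h1

namespace Precrystal

variable {B₁ B₂ : Type*}

theorem isIso_of_e {C₁ : Precrystal m n B₁} {C₂ : Precrystal m n B₂} {ψ : B₁ ≃ B₂}
    (h₁ : ∀ i b b', C₁.f i b = some b' ↔ C₁.e i b' = some b)
    (h₂ : ∀ i b b', C₂.f i b = some b' ↔ C₂.e i b' = some b)
    (wt : ∀ b, C₂.wt (ψ b) = C₁.wt b) (eps : ∀ i b, C₂.eps i (ψ b) = C₁.eps i b)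
    (phi : ∀ i b, C₂.phi i (ψ b) = C₁.phi i b)
    (e : ∀ i b, C₂.e i (ψ b) = (C₁.e i b).map ψ) : IsIso C₁ C₂ ψ where
  wt := wt
  eps := eps
  phi := phi
  e := e
  f i b := by
    refine Option.ext fun b' => ?_
    obtain ⟨b', rfl⟩ := ψ.surjective b'
    rw [h₂, e, Option.map_eq_some_iff, Option.map_eq_some_iff]
    simp [h₁]

theorem directSum_e_eq_some {ι : Type*} {B : ι → Type*} {C : ∀ t, Precrystal m n (B t)}
    {i : Index m n} {x y : Σ t, B t} :
    (directSum C).e i x = some y ↔ ∃ b, (C x.1).e i x.2 = some b ∧ ⟨x.1, b⟩ = y :=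
  Option.map_eq_some_iff

theorem directSum_f_iff_e {ι : Type*} {B : ι → Type*} {C : ∀ t, Precrystal m n (B t)}
    (hC : ∀ t i b b', (C t).f i b = some b' ↔ (C t).e i b' = some b) (i : Index m n)
    (x y : Σ t, B t) : (directSum C).f i x = some y ↔ (directSum C).e i y = some x := by
  constructor
  · intro h
    obtain ⟨b, h1, rfl⟩ := Option.map_eq_some_iff.1 h
    exact Option.map_eq_some_iff.2 ⟨x.2, (hC _ _ _ _).1 h1, rfl⟩
  · intro h
    obtain ⟨b, h1, rfl⟩ := Option.map_eq_some_iff.1 h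
    exact Option.map_eq_some_iff.2 ⟨y.2, (hC _ _ _ _).2 h1, rfl⟩

end Precrystal

theorem symM_zero_isomorphic (m n : ℕ) :
    Precrystal.Isomorphic ((symCrystal m n).restrict (symMk m n 0))
      (Precrystal.directSum fun μ : {μ : YoungDiagram // IsHook m n μ ∧ IsEven μ} =>
        tableauCrystal m n μ.1) := by
  obtain ⟨ψ, hψ⟩ := exists_equiv_evenTab m n
  have hC : ∀ μ : {μ : YoungDiagram // IsHook m n μ ∧ IsEven μ},
      (tableauCrystal m n μ.1).IsCrystal := fun μ => (wordCrystal_isCrystal m n).induced _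
  refine ⟨ψ, Precrystal.isIso_of_e
    ((symCrystal_isCrystal m n).induced _).f_iff_e
    (Precrystal.directSum_f_iff_e fun μ => (hC μ).f_iff_e) ?_ ?_ ?_ ?_⟩
  · intro A
    show wordWt (ψ A).2.word = wordWt ((biword A.1.1).map Prod.fst)
    funext b
    rw [wordWt_apply, wordWt_apply, (hψ A).count_word A.1.2.1]
  · intro i A
    exact ((hψ A).wordEps A.1.2.1 i).1.trans (symCrystal_eps i A.1).symm
  · intro i A
    exact ((hψ A).wordEps A.1.2.1 i).2.trans (symCrystal_phi i A.1).symm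
  · intro i A
    rcases hA : ((symCrystal m n).restrict (symMk m n 0)).e i A with _ | B
    -- If the tableau could be raised, `ε_i` of its word would be positive; but it equals `ε_i` of
    -- the row word of `A`, which decides whether `𝐞_i` is defined at `A`.
    · rw [Option.map_none]
      by_contra hne
      obtain ⟨y, hy⟩ := Option.ne_none_iff_exists'.1 hne
      obtain ⟨T, hT, -⟩ := Precrystal.directSum_e_eq_some.1 hy
      have h1 : wordE i (ψ A).2.word = some T.word := Precrystal.induced_e_eq_some.1 hT
      have h2 := (wordE_spec h1).1
      rw [((hψ A).wordEps A.1.2.1 i).1] at h2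
      have h3 : diagE i A.1.1 ≠ none := fun h => by
        have := (diagE_eq_none_iff A.1.2).1 h
        omega
      obtain ⟨B, hB⟩ := Option.ne_none_iff_exists'.1 h3
      have hB' : (symCrystal m n).e i A.1 = some ⟨B, diagE_mem_symM A.1.2 hB⟩ :=
        symCrystal_e.2 hB
      have h4 : ((symCrystal m n).restrict (symMk m n 0)).e i A =
          some ⟨_, symCrystal_stableOn m n 0 i A.1 A.2 _ (Or.inl hB')⟩ :=
        Precrystal.induced_e_eq_some.2 hB'
      rw [h4] at hA
      cases hA
    · have h1 : diagE i A.1.1 = some B.1.1 := symCrystal_e.1 (Precrystal.induced_e_eq_some.1 hA)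
      obtain ⟨h2, h3⟩ := (hψ A).wordE (hψ B) A.1.2 h1
      rw [Option.map_some]
      generalize ψ A = x at h2 h3
      generalize ψ B = y at h2 h3
      obtain ⟨⟨μ, hμ⟩, T⟩ := x
      obtain ⟨⟨μ', hμ'⟩, T'⟩ := y
      obtain rfl : μ = μ' := h2
      exact Precrystal.directSum_e_eq_some.2 ⟨T', Precrystal.induced_e_eq_some.2 h3, rfl⟩

/-! ### Characters -/

theorem hasSum_geometric_of_constantCoeff_eq_zero {σ : Type*} {M : MvPowerSeries σ ℤ}
    (hM : MvPowerSeries.constantCoeff M = 0) :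
    HasSum (fun k : ℕ => M ^ k) (MvPowerSeries.invOfUnit (1 - M) 1) := by
  have h1 := MvPowerSeries.WithPiTopology.summable_pow_of_constantCoeff_eq_zero hM
  have h2 := MvPowerSeries.WithPiTopology.tsum_pow_mul_one_sub_of_constantCoeff_eq_zero hM
  have h3 := MvPowerSeries.mul_invOfUnit (1 - M) 1 (by simp [hM])
  have h4 : ∑' k : ℕ, M ^ k = MvPowerSeries.invOfUnit (1 - M) 1 := by
    have h5 := congrArg (· * MvPowerSeries.invOfUnit (1 - M) 1) h2
    simpa only [mul_assoc, h3, mul_one, one_mul] using h5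
  rw [← h4]
  exact h1.hasSum

section PowerSeries

variable {σ : Type} [Fintype σ]

open MvPowerSeries in
theorem coeff_prod_X_pow (e : σ → ℕ) (d : σ →₀ ℕ) :
    coeff d (∏ b, X b ^ e b : MvPowerSeries σ ℤ) = if ⇑d = e then 1 else 0 := by
  classical
  have h : (∏ b, X b ^ e b : MvPowerSeries σ ℤ) =
      monomial (Finsupp.equivFunOnFinite.symm e) 1 := by
    rw [monomial_eq', Finsupp.prod_fintype _ _ fun _ => pow_zero _]
    simp
  rw [h, coeff_monomial]
  refine if_congr ?_ rfl rfl
  rw [Equiv.eq_symm_apply]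
  rfl

theorem summable_prod_X_pow {ι : Type} {w : ι → σ → ℕ} (h : ∀ d, {x | w x = d}.Finite) :
    Summable fun x => (∏ b, MvPowerSeries.X b ^ w x b : MvPowerSeries σ ℤ) := by
  rw [MvPowerSeries.WithPiTopology.summable_iff_summable_coeff]
  intro d
  refine summable_of_hasFiniteSupport ((h d).subset fun x hx => ?_)
  rw [Function.mem_support, coeff_prod_X_pow] at hx
  by_contra hne
  exact hx (if_neg fun h' => hne h'.symm)

/-- Expands a finite product of infinite sums of monomials, adding one factor at a time. The
finiteness hypothesis makes the family of all products summable. -/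
theorem hasSum_pi_prod_X_pow (α : Type) [Fintype α] : ∀ {κ : α → Type} (w : ∀ a, κ a → σ → ℕ)
    (_ : ∀ a d, {k | w a k ≤ d}.Finite) (G : α → MvPowerSeries σ ℤ)
    (_ : ∀ a, HasSum (fun k => ∏ b, MvPowerSeries.X b ^ w a k b) (G a)),
    HasSum (fun f : ∀ a, κ a => ∏ b, MvPowerSeries.X b ^ (∑ a, w a (f a) b)) (∏ a, G a) := by
  refine Fintype.induction_empty_option (P := fun α _ => ∀ {κ : α → Type} (w : ∀ a, κ a → σ → ℕ)
    (_ : ∀ a d, {k | w a k ≤ d}.Finite) (G : α → MvPowerSeries σ ℤ)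
    (_ : ∀ a, HasSum (fun k => ∏ b, MvPowerSeries.X b ^ w a k b) (G a)),
    HasSum (fun f : ∀ a, κ a => ∏ b, MvPowerSeries.X b ^ (∑ a, w a (f a) b)) (∏ a, G a))
    ?_ ?_ ?_ α
  · intro α β _ e ih κ w hw G hG
    let _ := Fintype.ofEquiv β e.symm
    have h := ih (fun a => w (e a)) (fun a => hw (e a)) (fun a => G (e a)) fun a => hG (e a)
    rw [← (Equiv.piCongrLeft κ e).hasSum_iff, ← e.prod_comp]
    convert h using 1
    funext f
    simp only [Function.comp]
    refine Finset.prod_congr rfl fun b _ => ?_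
    rw [← e.sum_comp]
    simp only [Equiv.piCongrLeft_apply_apply]
  · intro κ w _ G _
    simp
  · intro α _ ih κ w hw G hG
    have h1 : HasSum (fun f : ∀ a, κ (some a) => (∏ b, MvPowerSeries.X b ^
        (∑ a, w (some a) (f a) b) : MvPowerSeries σ ℤ)) (∏ a, G (some a)) :=
      ih (fun a => w (some a)) (fun a => hw (some a)) (fun a => G (some a)) fun a => hG (some a)
    -- A product with exponent `d` has all its factors of exponent at most `d`, so only finitely
    -- many products contribute to each coefficient.
    have hs : Summable fun x : κ none × ∀ a, κ (some a) => (∏ b, MvPowerSeries.X b ^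
        (w none x.1 b + ∑ a, w (some a) (x.2 a) b) : MvPowerSeries σ ℤ) := by
      refine summable_prod_X_pow fun d => ?_
      refine ((hw none d).prod (Set.Finite.pi fun a => hw (some a) d)).subset fun x hx => ?_
      have hx' : ∀ b, w none x.1 b + ∑ a, w (some a) (x.2 a) b = d b := fun b => congrFun hx b
      refine ⟨fun b => (Nat.le_add_right _ _).trans_eq (hx' b), fun a _ b => ?_⟩
      show w (some a) (x.2 a) b ≤ d b
      have h3 := Finset.single_le_sum (f := fun a => w (some a) (x.2 a) b)
        (fun _ _ => Nat.zero_le _) (Finset.mem_univ a)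
      exact h3.trans ((Nat.le_add_left _ _).trans_eq (hx' b))
    have h0 := hG none
    rw [← Equiv.piOptionEquivProd.symm.hasSum_iff, Fintype.prod_option]
    generalize hF : (fun k => (∏ b, MvPowerSeries.X b ^ w none k b : MvPowerSeries σ ℤ)) = F at h0
    generalize hH : (fun f : ∀ a, κ (some a) => (∏ b, MvPowerSeries.X b ^
      (∑ a, w (some a) (f a) b) : MvPowerSeries σ ℤ)) = H at h1
    have h2 : ∀ x : κ none × ∀ a, κ (some a), (∏ b, MvPowerSeries.X b ^
        (w none x.1 b + ∑ a, w (some a) (x.2 a) b) : MvPowerSeries σ ℤ) = F x.1 * H x.2 := by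
      intro x
      rw [← hF, ← hH]
      simp only [pow_add, Finset.prod_mul_distrib]
    simp only [h2] at hs
    have h3 := h0.mul h1 hs
    have h4 : ((fun f : ∀ a, κ a => (∏ b, MvPowerSeries.X b ^ (∑ a, w a (f a) b) :
        MvPowerSeries σ ℤ)) ∘ Equiv.piOptionEquivProd.symm) = fun x => F x.1 * H x.2 := by
      funext x
      rw [← h2]
      simp only [Function.comp, Fintype.sum_option]
      rfl
    rw [h4]
    exact h3

end PowerSeries

/-! ### The generating function of `𝔐_0` -/

/-- The possible values of the entry of a matrix in `𝔐_0` at a position on or above the diagonal;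
below the diagonal we put `0`. -/
def entries (p : Letter m n × Letter m n) : Set ℕ :=
  {a | (p.2 < p.1 → a = 0) ∧ (p.1 = p.2 → deg p.1 = 0 → Even a) ∧
    (p.1 = p.2 → deg p.1 = 1 → a = 0) ∧ (deg p.1 ≠ deg p.2 → a ≤ 1)}

/-- The contribution to the weight of the entry `a` at the position `p`. -/
def entryWt (p : Letter m n × Letter m n) (a : ℕ) (c : Letter m n) : ℕ :=
  (if c = p.1 then a else 0) + if c = p.2 ∧ p.1 ≠ p.2 then a else 0

theorem deg_cases (b : Letter m n) : deg b = 0 ∨ deg b = 1 := by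
  unfold deg; split_ifs <;> simp

theorem oddStat_eq_zero_iff (A : Mat m n) :
    oddStat A = 0 ↔ ∀ b, (deg b = 0 → Even (A b b)) ∧ (deg b = 1 → A b b = 0) := by
  rw [oddStat, Nat.add_eq_zero_iff, Finset.card_eq_zero, Finset.filter_eq_empty_iff,
    Finset.sum_eq_zero_iff]
  simp only [Finset.mem_univ, true_and, true_implies, Finset.mem_filter, not_and, forall_and,
    Nat.even_iff, Nat.mod_two_ne_one]

/-- A symmetric matrix is free on and above the diagonal, and membership in `𝔐_0` constrains each
entry separately. Positions below the diagonal are kept with the single value `0`, so that the index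
set is a full product. -/
theorem exists_equiv_entries (m n : ℕ) :
    ∃ θ : symMk m n 0 ≃ ∀ p : Letter m n × Letter m n, entries p,
      ∀ A p, (θ A p : ℕ) = if p.1 ≤ p.2 then A.1.1 p.1 p.2 else 0 := by
  let g : symMk m n 0 → ∀ p : Letter m n × Letter m n, entries p := fun A p =>
    ⟨if p.1 ≤ p.2 then A.1.1 p.1 p.2 else 0, by
      have h0 := (oddStat_eq_zero_iff A.1.1).1 A.2
      refine ⟨fun h => if_neg h.not_ge, fun h hd => ?_, fun h hd => ?_, fun h => ?_⟩
      · rw [if_pos h.le, ← h]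
        exact (h0 _).1 hd
      · rw [if_pos h.le, ← h]
        exact (h0 _).2 hd
      · split_ifs
        · exact A.1.2.1 _ _ h
        · exact zero_le_one⟩
  refine ⟨Equiv.ofBijective g ⟨fun A B h => ?_, fun f => ?_⟩, fun A p => rfl⟩
  · have key : ∀ b b', b ≤ b' → A.1.1 b b' = B.1.1 b b' := fun b b' hb => by
      have := congrArg Subtype.val (congrFun h (b, b'))
      simpa [g, hb] using this
    refine Subtype.ext (Subtype.ext ?_)
    ext b b'
    rcases le_total b b' with hb | hb
    · exact key b b' hb
    · rw [← A.1.2.2, ← B.1.2.2]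
      exact key b' b hb
  · obtain ⟨u, hu⟩ : ∃ u : Letter m n × Letter m n → ℕ, ∀ p, u p = f p := ⟨_, fun _ => rfl⟩
    have hu' : ∀ p, u p ∈ entries p := fun p => by rw [hu]; exact (f p).2
    let A : Mat m n := Matrix.of fun b b' => u (min b b', max b b')
    have hA : A ∈ symM m n := by
      refine ⟨fun b b' h => ?_, ?_⟩
      · refine (hu' (min b b', max b b')).2.2.2 ?_
        rcases le_total b b' with hb | hb
        · simpa [hb] using h
        · simpa [hb] using h.symm
      · ext b b'
        simp only [A, Matrix.transpose_apply, Matrix.of_apply, min_comm, max_comm]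
    have h0 : oddStat A = 0 := by
      rw [oddStat_eq_zero_iff]
      intro b
      have h1 := hu' (b, b)
      simp only [A, Matrix.of_apply, min_self, max_self]
      exact ⟨h1.2.1 rfl, h1.2.2.1 rfl⟩
    refine ⟨⟨⟨A, hA⟩, h0⟩, ?_⟩
    funext p
    apply Subtype.ext
    show (if p.1 ≤ p.2 then A p.1 p.2 else 0) = _
    split_ifs with hp
    · exact (congrArg u (by rw [min_eq_left hp, max_eq_right hp])).trans (hu p)
    · exact ((f p).2.1 (lt_of_not_ge hp)).symm

/-- The part of the row `c` left of the diagonal is counted through the part of the column `c` above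
it, by symmetry. -/
theorem sum_entryWt {A : Mat m n} (hA : A.transpose = A) (c : Letter m n) :
    ∑ p : Letter m n × Letter m n, entryWt p (if p.1 ≤ p.2 then A p.1 p.2 else 0) c =
      ∑ j, A c j := by
  simp only [entryWt, Finset.sum_add_distrib, Fintype.sum_prod_type]
  have h1 : ∀ x : Letter m n,
      (∑ y, if c = x then (if x ≤ y then A x y else 0) else 0) =
        if c = x then (∑ y, if x ≤ y then A x y else 0) else 0 := fun x => by
    split_ifs <;> simp
  have h2 : ∀ x : Letter m n,
      (∑ y, if c = y ∧ x ≠ y then (if x ≤ y then A x y else 0) else 0) =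
        if x < c then A x c else 0 := fun x => by
    rw [Finset.sum_eq_single c]
    · by_cases h : x < c
      · simp [h, h.ne, h.le]
      · by_cases h' : x = c
        · simp [h']
        · have : ¬ x ≤ c := fun h'' => h (lt_of_le_of_ne h'' h')
          simp [h, this]
    · intro y _ hy
      rw [if_neg fun h => hy h.1.symm]
    · simp
  simp only [h1, h2]
  rw [Finset.sum_ite_eq, if_pos (Finset.mem_univ _), ← Finset.sum_add_distrib]
  refine Finset.sum_congr rfl fun y _ => ?_
  have h3 : A y c = A c y := congrFun (congrFun hA c) y
  by_cases h : c ≤ y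
  · rw [if_pos h, if_neg h.not_gt, add_zero]
  · rw [if_neg h, if_pos (lt_of_not_ge h), zero_add, h3]

/-- The numerator at the position `p`. -/
noncomputable def entryNum (p : Letter m n × Letter m n) : MvPowerSeries (Letter m n) ℤ :=
  if p.1 < p.2 ∧ deg p.1 ≠ deg p.2 then 1 + MvPowerSeries.X p.1 * MvPowerSeries.X p.2 else 1

/-- The denominator at the position `p`. -/
noncomputable def entryDen (p : Letter m n × Letter m n) : MvPowerSeries (Letter m n) ℤ :=
  (if p.1 = p.2 then (if deg p.1 = 0 then 1 - MvPowerSeries.X p.1 ^ 2 else 1) else 1) *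
    if p.1 < p.2 ∧ deg p.1 = deg p.2 then 1 - MvPowerSeries.X p.1 * MvPowerSeries.X p.2 else 1

theorem prod_entryNum : ∏ p : Letter m n × Letter m n, entryNum p = charNum m n := by
  rw [charNum, Finset.prod_filter]
  rfl

theorem prod_entryDen : ∏ p : Letter m n × Letter m n, entryDen p = charDen m n := by
  rw [charDen, Finset.prod_filter, Finset.prod_filter]
  simp only [entryDen, Finset.prod_mul_distrib]
  congr 1
  rw [Fintype.prod_prod_type]
  refine Finset.prod_congr rfl fun b _ => ?_
  rw [Finset.prod_ite_eq, if_pos (Finset.mem_univ _)]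

theorem constantCoeff_charDen : MvPowerSeries.constantCoeff (charDen m n) = 1 := by
  simp [charDen, map_prod]

theorem entryTerm_eq (p : Letter m n × Letter m n) (a : ℕ) :
    (∏ c, MvPowerSeries.X c ^ entryWt p a c : MvPowerSeries (Letter m n) ℤ) =
      if p.1 = p.2 then MvPowerSeries.X p.1 ^ a
      else (MvPowerSeries.X p.1 * MvPowerSeries.X p.2) ^ a := by
  have h : ∀ b : Letter m n, (∏ c, MvPowerSeries.X c ^ (if c = b then a else 0) :
      MvPowerSeries (Letter m n) ℤ) = MvPowerSeries.X b ^ a := fun b => by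
    simp [Finset.prod_ite_eq', pow_ite]
  simp only [entryWt, pow_add, Finset.prod_mul_distrib, h]
  split_ifs with hp
  · simp [hp]
  · simp only [hp, ne_eq, not_false_eq_true, and_true, h, mul_pow]

/-- Above the diagonal, equal degrees give a geometric series and unequal degrees two terms. On the
diagonal, degree 0 gives a geometric series in the square; the remaining positions allow only the
entry `0`. -/
theorem hasSum_entries (p : Letter m n × Letter m n) :
    ∃ G, HasSum (fun k : entries p => (∏ c, MvPowerSeries.X c ^ entryWt p k c :
      MvPowerSeries (Letter m n) ℤ)) G ∧ G * entryDen p = entryNum p := by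
  simp only [entryTerm_eq]
  have single : entries p = {0} → ∃ G, HasSum (fun k : entries p =>
      (if p.1 = p.2 then MvPowerSeries.X p.1 ^ (k : ℕ)
        else (MvPowerSeries.X p.1 * MvPowerSeries.X p.2) ^ (k : ℕ) :
        MvPowerSeries (Letter m n) ℤ)) G ∧ G = 1 := by
    intro h
    refine ⟨1, ?_, rfl⟩
    rw [h]
    have := hasSum_unique (fun k : ({0} : Set ℕ) => (if p.1 = p.2 then
      MvPowerSeries.X p.1 ^ (k : ℕ) else (MvPowerSeries.X p.1 * MvPowerSeries.X p.2) ^ (k : ℕ) :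
        MvPowerSeries (Letter m n) ℤ))
    simpa using this
  rcases lt_trichotomy p.1 p.2 with hp | hp | hp
  · simp only [if_neg hp.ne]
    by_cases hd : deg p.1 = deg p.2
    · have hK : entries p = Set.univ := by
        ext a
        simp [entries, hp.not_gt, hp.ne, hd]
      have h := hasSum_geometric_of_constantCoeff_eq_zero
        (M := (MvPowerSeries.X p.1 * MvPowerSeries.X p.2 : MvPowerSeries (Letter m n) ℤ))
        (by simp)
      refine ⟨MvPowerSeries.invOfUnit (1 - MvPowerSeries.X p.1 * MvPowerSeries.X p.2) 1, ?_, ?_⟩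
      · rw [hK]
        exact (Equiv.Set.univ ℕ).hasSum_iff.2 h
      · rw [entryDen, entryNum, if_neg hp.ne, if_pos ⟨hp, hd⟩, if_neg fun h => h.2 hd, one_mul]
        exact MvPowerSeries.invOfUnit_mul _ _ (by simp)
    · have hK : entries p = ((Finset.range 2 : Finset ℕ) : Set ℕ) := by
        ext a
        simp [entries, hp.not_gt, hp.ne, hd]
      refine ⟨1 + MvPowerSeries.X p.1 * MvPowerSeries.X p.2, ?_, ?_⟩
      · rw [hK]
        have := (Finset.range 2).hasSum fun k : ℕ =>
          ((MvPowerSeries.X p.1 * MvPowerSeries.X p.2) ^ k : MvPowerSeries (Letter m n) ℤ)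
        rw [Finset.sum_range_succ, Finset.sum_range_one, pow_zero, pow_one] at this
        exact this
      · rw [entryDen, entryNum, if_neg hp.ne, if_neg fun h => hd h.2, if_pos ⟨hp, hd⟩, one_mul,
          mul_one]
  · by_cases hd : deg p.1 = 0
    · simp only [if_pos hp]
      have hK : entries p = Set.range fun k : ℕ => 2 * k := by
        ext a
        obtain ⟨b, c⟩ := p
        obtain rfl : b = c := hp
        simp only at hd
        simp [entries, hd, even_iff_exists_two_mul]
      have h := hasSum_geometric_of_constantCoeff_eq_zero
        (M := (MvPowerSeries.X p.1 ^ 2 : MvPowerSeries (Letter m n) ℤ)) (by simp)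
      refine ⟨MvPowerSeries.invOfUnit (1 - MvPowerSeries.X p.1 ^ 2) 1, ?_, ?_⟩
      · rw [hK]
        have hinj : Function.Injective fun k : ℕ => 2 * k := fun a b h => by
          simp only at h
          omega
        rw [← (Equiv.ofInjective _ hinj).hasSum_iff]
        refine h.congr_fun ?_
        intro k
        simp [pow_mul]
      · rw [entryDen, entryNum, if_pos hp, if_pos hd, if_neg fun h => h.1.ne hp,
          if_neg fun h => h.1.ne hp, mul_one]
        exact MvPowerSeries.invOfUnit_mul _ _ (by simp)
    · have hd1 := (deg_cases p.1).resolve_left hd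
      have hK : entries p = {0} := by
        ext a
        obtain ⟨b, c⟩ := p
        obtain rfl : b = c := hp
        simp only at hd1
        simp [entries, hd1]
      obtain ⟨G, hG, rfl⟩ := single hK
      refine ⟨1, hG, ?_⟩
      rw [entryDen, entryNum, if_pos hp, if_neg hd, if_neg fun h => h.1.ne hp,
        if_neg fun h => h.1.ne hp, mul_one, mul_one]
  · have hK : entries p = {0} := by
      ext a
      simp only [entries, hp, hp.ne', true_implies, false_implies, true_and,
        Set.mem_ofPred_eq, Set.mem_singleton_iff]
      constructor
      · exact fun h => h.1
      · rintro rfl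
        simp
    obtain ⟨G, hG, rfl⟩ := single hK
    refine ⟨1, hG, ?_⟩
    rw [entryDen, entryNum, if_neg hp.ne', if_neg fun h => h.1.not_gt hp,
      if_neg fun h => h.1.not_gt hp, mul_one, mul_one]

theorem hasSum_symMk_zero (m n : ℕ) :
    HasSum (fun A : symMk m n 0 => (∏ c, MvPowerSeries.X c ^ (∑ j, A.1.1 c j) :
      MvPowerSeries (Letter m n) ℤ)) (charNum m n * MvPowerSeries.invOfUnit (charDen m n) 1) := by
  choose G hG hG' using hasSum_entries (m := m) (n := n)
  have h1 := hasSum_pi_prod_X_pow (Letter m n × Letter m n)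
    (κ := fun p => entries p) (fun p k => entryWt p k) (fun p d => ?_) G hG
  · have h2 : ∏ p, G p = charNum m n * MvPowerSeries.invOfUnit (charDen m n) 1 := by
      rw [← prod_entryNum, ← Finset.prod_congr rfl fun p _ => hG' p, Finset.prod_mul_distrib,
        prod_entryDen, mul_assoc, MvPowerSeries.mul_invOfUnit _ _ constantCoeff_charDen, mul_one]
    rw [h2] at h1
    obtain ⟨θ, hθ⟩ := exists_equiv_entries m n
    have h3 := θ.hasSum_iff.2 h1
    convert h3 using 1
    funext A
    simp only [Function.comp, hθ, sum_entryWt A.1.2.2]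
  -- The entry `a` at `p` already contributes `a` to the exponent of `p.1`, which bounds it.
  · refine Set.Finite.of_finite_image (f := Subtype.val) ?_ Subtype.val_injective.injOn
    refine (Set.finite_Iic (d p.1)).subset ?_
    rintro _ ⟨k, hk, rfl⟩
    have := hk p.1
    simp only [entryWt, if_true] at this
    exact le_trans (Nat.le_add_right _ _) this

/-- The bijection with tableaux preserves weights, so the series of `𝔐_0` is a sum over all tableaux
of even shape, regrouped by shape. -/
theorem hasSum_hookSchur (m n : ℕ) :
    HasSum (fun μ : {μ : YoungDiagram // IsHook m n μ ∧ IsEven μ} => hookSchur m n μ.1)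
      (charNum m n * MvPowerSeries.invOfUnit (charDen m n) 1) := by
  obtain ⟨ψ, hψ⟩ := exists_equiv_evenTab m n
  have h1 : HasSum (fun x : EvenTab m n => (∏ b, MvPowerSeries.X b ^ x.2.word.count b :
      MvPowerSeries (Letter m n) ℤ)) (charNum m n * MvPowerSeries.invOfUnit (charDen m n) 1) := by
    rw [← ψ.hasSum_iff]
    convert hasSum_symMk_zero m n using 1
    funext A
    refine Finset.prod_congr rfl fun b _ => ?_
    congr 1
    rw [(hψ A).count_word A.1.2.1, map_fst_biword]
    refine (count_rowWord _ b).trans ?_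
    rw [Finset.sum_range]
    simp only [extendZero_val]
  exact h1.sigma fun μ => hasSum_fintype _

end GLCrystal

theorem corollary3p11 (m n : ℕ) (hmn : 0 < m + n) :
    -- `𝔐` is a crystal for the diagonal action
    ((GLCrystal.diagonal m n).StableOn (GLCrystal.symM m n) ∧
      (GLCrystal.symCrystal m n).IsCrystal) ∧
    -- each `𝔐_k` is a subcrystal of `𝔐`, and `𝔐` is their direct sum
    (∀ k, (GLCrystal.symCrystal m n).IsSubcrystal (GLCrystal.symMk m n k)) ∧
    (∃ ψ : (Σ k, GLCrystal.symMk m n k) ≃ GLCrystal.symM m n, (∀ x, ψ x = x.2.1) ∧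
      GLCrystal.Precrystal.IsIso
        (GLCrystal.Precrystal.directSum fun k =>
          (GLCrystal.symCrystal m n).restrict (GLCrystal.symMk m n k))
        (GLCrystal.symCrystal m n) ψ) ∧
    -- `𝔐_0` is the direct sum of the `𝐁_{m|n}(μ)` over the even hook partitions `μ`
    GLCrystal.Precrystal.Isomorphic
      ((GLCrystal.symCrystal m n).restrict (GLCrystal.symMk m n 0))
      (GLCrystal.Precrystal.directSum
        fun μ : {μ : YoungDiagram // GLCrystal.IsHook m n μ ∧ GLCrystal.IsEven μ} =>
          GLCrystal.tableauCrystal m n μ.1) ∧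
    -- the identity of characters
    HasSum
      (fun μ : {μ : YoungDiagram // GLCrystal.IsHook m n μ ∧ GLCrystal.IsEven μ} =>
        GLCrystal.hookSchur m n μ.1)
      (GLCrystal.charNum m n * MvPowerSeries.invOfUnit (GLCrystal.charDen m n) 1) :=
  ⟨⟨GLCrystal.diagonal_stableOn m n, GLCrystal.symCrystal_isCrystal m n⟩,
    GLCrystal.symMk_isSubcrystal m n, GLCrystal.symM_directSum m n,
    GLCrystal.symM_zero_isomorphic m n, GLCrystal.hasSum_hookSchur m n⟩
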